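/- Let $\rho>0$, $a_0>0$, and for real $\varepsilon$ put $a_\varepsilon^2=a_0^2-\varepsilon$ and $V_\varepsilon(x)=-a_\varepsilon^2$ for $|x|\le\rho$, $V_\varepsilon(x)=0$ for $|x|>\rho$, $x\in\mathbb R^2$. Let $J_\ell$ and $H^{(1)}_\ell$ be the Bessel and Hankel functions of the first kind, with the branch of $H^{(1)}_\ell(z)$ that is continuous on $-\pi/2\le\arg z<3\pi/2$, and let $\gamma$ be Euler's constant. A resonant state of $-\Delta+V_\varepsilon$ at $\lambda\in\mathbb C$ is a function $u\in L^2_{\mathrm{loc}}(\mathbb R^2)$, $u\not\equiv0$, with $(-\Delta+V_\varepsilon-\lambda^2)u=0$ in the sense of distributions which is outgoing, that is, for large $r$ it has an expansion $u(r,\theta)=\sum_{\ell\in\mathbb Z}c_\ell H^{(1)}_\ell(\lambda r)e^{i\ell\theta}$ if $\lambda\ne0$, and $u(r,\theta)=\sum_{\ell\in\mathbb Z}c_\ell r^{-|\ell|}e^{i\ell\theta}$ if $\lambda=0$. We say that $\lambda$ is a resonance in the $\ell=0$ mode if there is a radial resonant state at $\lambda$. Suppose that for some $\varepsilon_1>0$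 and every $\varepsilon\in(-\varepsilon_1,0)$ there is a nontrivial radial function $\psi_\varepsilon\in L^2(\mathbb R^2)$ with $(-\Delta+V_\varepsilon-E_\varepsilon)\psi_\varepsilon=0$, where $E_\varepsilon\in\mathbb R$ and $E_\varepsilon\uparrow0$ (that is, $E_\varepsilon\to 0$ through negative values) as $\varepsilon\uparrow0$. Then: 1. $J_1(\rho a_0)=0$. 2. There are $\delta_0,\varepsilon_0>0$ such that for $0<\varepsilon<\varepsilon_0$ the operator $-\Delta+V_\varepsilon$ has no resonance in the $\ell=0$ mode in $\{\lambda\in\mathbb C: 0\le|\lambda|<\delta_0,\ |\arg\lambda|\le\pi/2\}$ (the point $\lambda=0$ is included). 3. As $\varepsilon\uparrow0$, $$E_\varepsilon=-\frac{4}{\rho^2}\,e^{4/(\rho^2\varepsilon)-2\gamma}\,(1+O(\varepsilon)).$$ -/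

import Mathlib

open scoped ContDiff

noncomputable section

namespace CircularWell

open MeasureTheory

/-! ### Bessel and Hankel functions on the plane cut along the negative imaginary axis -/

/-- The logarithm of `z ≠ 0` with imaginary part in `[-π/2, 3π/2)`. -/
def cutLog (z : ℂ) : ℂ :=
  starRingEnd ℂ (Complex.log (starRingEnd ℂ (-Complex.I * z))) + Complex.I * (Real.pi / 2)

/-- The Bessel function of the first kind
`J_ν(z) = (z/2)^ν ∑_k (-z²/4)^k / (k! Γ(ν+k+1))`, for `z ≠ 0`, with `-π/2 ≤ arg z < 3π/2`.
(Mathlib sets `Γ = 0` at the poles of `Γ`, so that `(Γ s)⁻¹` is the entire function `1/Γ`.) -/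
def besselJ (ν z : ℂ) : ℂ :=
  Complex.exp (ν * cutLog (z / 2)) *
    ∑' k : ℕ, (-z ^ 2 / 4) ^ k * ((k.factorial : ℂ) * Complex.Gamma (ν + k + 1))⁻¹

/-- The Bessel function of the second kind of integer order,
`Y_ℓ(z) = π⁻¹ ∂_ν J_ν(z)|_{ν=ℓ} + (-1)^ℓ π⁻¹ ∂_ν J_ν(z)|_{ν=-ℓ}`. -/
def besselY (l : ℤ) (z : ℂ) : ℂ :=
  (1 / Real.pi) * deriv (fun ν : ℂ => besselJ ν z) (l : ℂ) +
    ((-1) ^ l / Real.pi) * deriv (fun ν : ℂ => besselJ ν z) (-(l : ℂ))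

/-- The Hankel function of the first kind `H_ℓ^{(1)} = J_ℓ + i Y_ℓ` of integer order. -/
def hankel1 (l : ℤ) (z : ℂ) : ℂ :=
  besselJ l z + Complex.I * besselY l z

/-! ### Schrödinger operators on the plane

The plane `ℝ²` is `ℂ` with its real inner product and Lebesgue measure; thus `r = ‖x‖` and
`e^{iℓθ} = (x / ‖x‖)^ℓ`. -/

/-- `u ∈ L²_loc(ℝ²)` and `(-Δ + V - z) u = 0` in the sense of distributions. -/
def IsSolution (V : ℂ → ℝ) (z : ℂ) (u : ℂ → ℂ) : Prop :=
  (∀ K : Set ℂ, IsCompact K → MemLp u 2 (volume.restrict K)) ∧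
  ∀ φ : ℂ → ℂ, ContDiff ℝ ∞ φ → HasCompactSupport φ →
    ∫ x : ℂ, u x * (-((Laplacian.laplacian φ : ℂ → ℂ) x) + ((V x : ℂ) - z) * φ x) = 0

/-- `u` is not the zero element of `L²_loc`. -/
def IsNontrivial (u : ℂ → ℂ) : Prop :=
  ¬ (∀ᵐ x : ℂ, u x = 0)

/-- `u` is (almost everywhere) a function of `r = ‖x‖` only. -/
def IsRadial (u : ℂ → ℂ) : Prop :=
  ∃ f : ℝ → ℂ, ∀ᵐ x : ℂ, u x = f ‖x‖

/-- `ψ` is an `L²` eigenfunction of `-Δ + V` with eigenvalue `E`. -/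
def IsEigenfunction (V : ℂ → ℝ) (E : ℝ) (ψ : ℂ → ℂ) : Prop :=
  MemLp ψ 2 volume ∧ IsNontrivial ψ ∧ IsSolution V (E : ℂ) ψ

/-- The outgoing condition: for large `r`,
`u = ∑_ℓ c_ℓ H_ℓ^{(1)}(λ r) e^{iℓθ}` if `λ ≠ 0`, and `u = ∑_ℓ c_ℓ r^{-|ℓ|} e^{iℓθ}` if `λ = 0`. -/
def IsOutgoing (lam : ℂ) (u : ℂ → ℂ) : Prop :=
  ∃ (c : ℤ → ℂ) (R : ℝ), ∀ᵐ x : ℂ, R < ‖x‖ →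
    HasSum (fun l : ℤ => c l *
        (if lam = 0 then (‖x‖ : ℂ) ^ (-|l|) else hankel1 l (lam * ‖x‖)) * (x / ‖x‖) ^ l)
      (u x)

/-- `u` is a resonant state of `-Δ + V` at `λ`, so that `λ` is a resonance. -/
def IsResonantState (V : ℂ → ℝ) (lam : ℂ) (u : ℂ → ℂ) : Prop :=
  IsNontrivial u ∧ IsSolution V (lam ^ 2) u ∧ IsOutgoing lam u

open Classical in
/-- The circular well `-a² 𝟙_{r ≤ ρ}`, as a function of `ρ` and of `a²`. -/
def circularWell (ρ asq : ℝ) (x : ℂ) : ℝ :=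
  if ‖x‖ ≤ ρ then -asq else 0

end CircularWell

end

/-! A radial solution is described in the variable s = r² by F and Q = 4sF′, so that the Laplacian
becomes Q′. At the edge s = ρ² the pair (F, Q) must be parallel to two solutions. One is the
solution regular at the origin, J₀(√κ r) with κ = a_ε² + z, where z is the spectral parameter (E or
λ²). The other is the admissible exterior solution: K₀ for an L² eigenfunction with E < 0, H₀⁽¹⁾ for
a resonant state with λ ≠ 0, the constant 1 for λ = 0. Put j(w) = J₀(2√w), w = κρ²/4, w₀ = a₀²ρ²/4
and g = w j′/j. The interior enters the matching only through g(w).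

Eigenvalues. With y = -Eρ²/4 and K(y) = 2K₀(2√y), M = -yK′, the condition is g(w) = -t, where t =
M(y)/K(y). As y → 0, M → 1 and K = -log y - 2γ + o(1), so t → 0 and j′(w₀) = 0, which is J₁(ρa₀) =
0. The Riccati equation g′ = -1 - g²/w then gives g(w) = -(w - w₀) + O(|w - w₀|³). Here w - w₀ =
-ερ²/4 - y exactly, and y ≤ t³, so 1/t = -4/(ρ²ε) + O(ε). Also 1/t = -log y - 2γ + O(t), and
exponentiating gives the expansion of E. A quadratic term in g would leave an error O(1) in 1/t and
destroy the constant prefactor.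

Resonances for ε > 0. Let η = ερ²/4 > 0. For λ ≠ 0 the matching condition is 2ηL ≈ 1 with L =
log(λρ/2) + γ - iπ/2. For small λ the real part of L is large and negative, so the two sides have
real parts of opposite sign. The errors are either O(x log x) with x = |λ|²ρ²/4, or absorbed by η|Re
L|. For λ = 0 one would need g(w₀ - η) = 0, whereas g(w₀ - η) = η + O(η³).

The main weight is carried by `IsSolution.exists_isRadialProfile` (distributional solutions to the
ordinary equation, with regularity at the origin), `IsRadialProfile.matching`, `decay_asymptotics`,
`logDerivJ_cubic`, `abs_inv_sub_inv_le` and `matching_contradiction`. -/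

noncomputable section

namespace CircularWell

open MeasureTheory

/-! ### Entire power series -/

/-- The coefficients of a power series that converges absolutely on the whole plane. -/
def IsEntireCoeff (a : ℕ → ℂ) : Prop :=
  ∀ R : ℝ, 0 < R → Summable fun k => ‖a k‖ * R ^ k

/-- The coefficients of the derived power series. -/
def derivCoeff (a : ℕ → ℂ) (k : ℕ) : ℂ := (k + 1) * a (k + 1)

/-- The sum of a power series. -/
def entireSum (a : ℕ → ℂ) (w : ℂ) : ℂ := ∑' k : ℕ, a k * w ^ k

lemma IsEntireCoeff.derivCoeff {a : ℕ → ℂ} (ha : IsEntireCoeff a) :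
    IsEntireCoeff (derivCoeff a) := by
  intro R hR
  -- The factor k + 1 is at most 2^(k+1), so doubling the radius absorbs it.
  have h := ((summable_nat_add_iff 1).2 (ha (2 * R) (by positivity))).mul_left (1 / R)
  refine Summable.of_nonneg_of_le (fun k => by positivity) (fun k => ?_) h
  have h1 : ‖((k : ℂ) + 1)‖ ≤ 2 ^ (k + 1) := by
    have : ((k : ℂ) + 1) = ((k + 1 : ℕ) : ℂ) := by push_cast; ring
    rw [this, Complex.norm_natCast]
    exact_mod_cast (Nat.lt_two_pow_self (n := k + 1)).le
  calc ‖CircularWell.derivCoeff a k‖ * R ^ k = ‖((k : ℂ) + 1)‖ * (‖a (k + 1)‖ * R ^ k) := by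
        rw [CircularWell.derivCoeff, norm_mul]; ring
    _ ≤ 2 ^ (k + 1) * (‖a (k + 1)‖ * R ^ k) := by gcongr
    _ = 1 / R * (‖a (k + 1)‖ * (2 * R) ^ (k + 1)) := by
        rw [mul_pow, pow_succ R]; field_simp

lemma IsEntireCoeff.summable {a : ℕ → ℂ} (ha : IsEntireCoeff a) (w : ℂ) :
    Summable fun k => a k * w ^ k := by
  refine Summable.of_norm_bounded (ha (‖w‖ + 1) (by positivity)) fun k => ?_
  rw [norm_mul, norm_pow]
  gcongr
  linarith

lemma IsEntireCoeff.hasDerivAt {a : ℕ → ℂ} (ha : IsEntireCoeff a) (w : ℂ) :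
    HasDerivAt (entireSum a) (entireSum (CircularWell.derivCoeff a) w) w := by
  have hw : w ∈ Metric.ball (0 : ℂ) (‖w‖ + 1) := by simp
  have hd : ∀ k : ℕ, DifferentiableOn ℂ (fun w : ℂ => a k * w ^ k)
      (Metric.ball (0 : ℂ) (‖w‖ + 1)) := fun k => by fun_prop
  have hb : ∀ (k : ℕ) (v : ℂ), v ∈ Metric.ball (0 : ℂ) (‖w‖ + 1) →
      ‖a k * v ^ k‖ ≤ ‖a k‖ * (‖w‖ + 1) ^ k := by
    intro k v hv
    rw [norm_mul, norm_pow]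
    rw [mem_ball_zero_iff] at hv
    gcongr
  have hs := ha (‖w‖ + 1) (by positivity)
  have h1 := (Complex.differentiableOn_tsum_of_summable_norm hs hd Metric.isOpen_ball hb)
    |>.differentiableAt (Metric.isOpen_ball.mem_nhds hw) |>.hasDerivAt
  have h2 := Complex.hasSum_deriv_of_summable_norm hs hd Metric.isOpen_ball hb hw
  have h3 : (fun k : ℕ => deriv (fun w : ℂ => a k * w ^ k) w) =
      fun k : ℕ => a k * (k * w ^ (k - 1)) := by
    funext k; simp
  rw [h3] at h2
  have h4 := (hasSum_nat_add_iff' 1).2 h2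
  simp only [Nat.add_sub_cancel, Finset.range_one, Finset.sum_singleton, Nat.cast_zero,
    zero_mul, mul_zero, sub_zero] at h4
  have h5 : entireSum (CircularWell.derivCoeff a) w =
      deriv (fun w : ℂ => ∑' k : ℕ, a k * w ^ k) w := by
    rw [← h4.tsum_eq]
    refine tsum_congr fun k => ?_
    rw [CircularWell.derivCoeff]; push_cast; ring
  rw [h5]
  exact h1

lemma IsEntireCoeff.continuous {a : ℕ → ℂ} (ha : IsEntireCoeff a) : Continuous (entireSum a) :=
  continuous_iff_continuousAt.2 fun w => (ha.hasDerivAt w).continuousAt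

lemma entireSum_zero (a : ℕ → ℂ) : entireSum a 0 = a 0 := by
  rw [entireSum, tsum_eq_single 0]
  · simp
  · intro k hk; simp [hk]

/-- `w S'' + S' + S` for the sum `S` of a power series, through the coefficients. -/
lemma IsEntireCoeff.mul_deriv_add {a c : ℕ → ℂ} (ha : IsEntireCoeff a)
    (hc : ∀ k : ℕ, ((k : ℂ) + 1) ^ 2 * a (k + 1) + a k = c k) (w : ℂ) :
    w * entireSum (CircularWell.derivCoeff (CircularWell.derivCoeff a)) w +
      entireSum (CircularWell.derivCoeff a) w + entireSum a w = entireSum c w := by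
  have h0 := (ha.summable w).hasSum
  have h1 := (ha.derivCoeff.summable w).hasSum
  have h2 := (ha.derivCoeff.derivCoeff.summable w).hasSum.mul_left w
  have h3 : HasSum (fun k : ℕ => (k : ℂ) * CircularWell.derivCoeff a k * w ^ k)
      (w * entireSum (CircularWell.derivCoeff (CircularWell.derivCoeff a)) w) := by
    rw [← hasSum_nat_add_iff' 1]
    simp only [Finset.range_one, Finset.sum_singleton, Nat.cast_zero, zero_mul, sub_zero]
    convert! h2 using 1
    funext k
    simp only [CircularWell.derivCoeff]; push_cast; ring
  have h4 := (h3.add h1).add h0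
  rw [entireSum, entireSum, entireSum] at *
  rw [← h4.tsum_eq]
  refine tsum_congr fun k => ?_
  rw [← hc k, CircularWell.derivCoeff]; ring

/-! ### The two solutions of `w S'' + S' + S = 0` -/

/-- The coefficients of `J₀(2√w)`. -/
def jCoeff (k : ℕ) : ℂ := (-1) ^ k / (k.factorial : ℂ) ^ 2

/-- The coefficients of the regular part of the second solution. -/
def nCoeff (k : ℕ) : ℂ := (harmonic k : ℂ) * jCoeff k

lemma harmonic_le_self (k : ℕ) : harmonic k ≤ k := by
  induction k with
  | zero => simp
  | succ k ih =>
    rw [harmonic_succ]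
    have : ((k + 1 : ℕ) : ℚ)⁻¹ ≤ 1 := by
      apply inv_le_one_of_one_le₀; push_cast; linarith [(Nat.cast_nonneg k : (0 : ℚ) ≤ k)]
    push_cast at *; linarith

lemma harmonic_nonneg (k : ℕ) : 0 ≤ harmonic k :=
  Finset.sum_nonneg fun _ _ => by positivity

lemma norm_harmonic_le (k : ℕ) : ‖((harmonic k : ℚ) : ℂ)‖ ≤ k.factorial := by
  have h1 : ((harmonic k : ℚ) : ℂ) = (((harmonic k : ℚ) : ℝ) : ℂ) := by simp
  have h3 : ((harmonic k : ℚ) : ℝ) ≤ (k : ℝ) := by exact_mod_cast harmonic_le_self k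
  have h4 : (0 : ℝ) ≤ ((harmonic k : ℚ) : ℝ) := by exact_mod_cast harmonic_nonneg k
  rw [h1, Complex.norm_real, Real.norm_of_nonneg h4]
  exact h3.trans (by exact_mod_cast Nat.self_le_factorial k)

lemma norm_jCoeff (k : ℕ) : ‖jCoeff k‖ = 1 / (k.factorial : ℝ) ^ 2 := by
  simp [jCoeff]

lemma isEntireCoeff_of_le {a : ℕ → ℂ} (h : ∀ k, ‖a k‖ ≤ 1 / (k.factorial : ℝ)) :
    IsEntireCoeff a := by
  intro R hR
  refine Summable.of_nonneg_of_le (fun k => by positivity) (fun k => ?_)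
    (Real.summable_pow_div_factorial R)
  calc ‖a k‖ * R ^ k ≤ 1 / (k.factorial : ℝ) * R ^ k := by gcongr; exact h k
    _ = R ^ k / k.factorial := by ring

lemma isEntireCoeff_j : IsEntireCoeff jCoeff := by
  refine isEntireCoeff_of_le fun k => ?_
  have h : (1 : ℝ) ≤ k.factorial := by exact_mod_cast Nat.one_le_iff_ne_zero.2 k.factorial_ne_zero
  rw [norm_jCoeff]
  apply one_div_le_one_div_of_le (by positivity)
  nlinarith

lemma isEntireCoeff_n : IsEntireCoeff nCoeff := by
  refine isEntireCoeff_of_le fun k => ?_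
  have h : (0 : ℝ) < k.factorial := by exact_mod_cast k.factorial_pos
  rw [nCoeff, norm_mul, norm_jCoeff]
  calc _ ≤ (k.factorial : ℝ) * (1 / (k.factorial : ℝ) ^ 2) := by
        gcongr; exact norm_harmonic_le k
    _ = _ := by field_simp

lemma jCoeff_succ (k : ℕ) : ((k : ℂ) + 1) ^ 2 * jCoeff (k + 1) = -jCoeff k := by
  have h1 : ((k : ℂ) + 1) ≠ 0 := by exact_mod_cast k.succ_ne_zero
  have h2 : (k.factorial : ℂ) ≠ 0 := by exact_mod_cast k.factorial_ne_zero
  rw [jCoeff, jCoeff, Nat.factorial_succ]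
  push_cast
  field_simp
  ring

/-- `J₀(2√w)` as an entire function of `w`. -/
def bj : ℂ → ℂ := entireSum jCoeff
/-- The derivative of `bj`. -/
def bj' : ℂ → ℂ := entireSum (derivCoeff jCoeff)
/-- The second derivative of `bj`. -/
def bj'' : ℂ → ℂ := entireSum (derivCoeff (derivCoeff jCoeff))
/-- The regular part of the second solution. -/
def bn : ℂ → ℂ := entireSum nCoeff
/-- The derivative of `bn`. -/
def bn' : ℂ → ℂ := entireSum (derivCoeff nCoeff)
/-- The second derivative of `bn`. -/
def bn'' : ℂ → ℂ := entireSum (derivCoeff (derivCoeff nCoeff))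

lemma hasDerivAt_bj (w : ℂ) : HasDerivAt bj (bj' w) w := isEntireCoeff_j.hasDerivAt w
lemma hasDerivAt_bj' (w : ℂ) : HasDerivAt bj' (bj'' w) w := isEntireCoeff_j.derivCoeff.hasDerivAt w
lemma hasDerivAt_bn (w : ℂ) : HasDerivAt bn (bn' w) w := isEntireCoeff_n.hasDerivAt w
lemma hasDerivAt_bn' (w : ℂ) : HasDerivAt bn' (bn'' w) w := isEntireCoeff_n.derivCoeff.hasDerivAt w

lemma continuous_bj : Continuous bj := isEntireCoeff_j.continuous
lemma continuous_bj' : Continuous bj' := isEntireCoeff_j.derivCoeff.continuous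
lemma continuous_bn : Continuous bn := isEntireCoeff_n.continuous
lemma continuous_bn' : Continuous bn' := isEntireCoeff_n.derivCoeff.continuous

lemma bj_zero : bj 0 = 1 := by simp [bj, entireSum_zero, jCoeff]
lemma bn_zero : bn 0 = 0 := by simp [bn, entireSum_zero, nCoeff]

lemma bj_ode (w : ℂ) : w * bj'' w + bj' w + bj w = 0 := by
  have := isEntireCoeff_j.mul_deriv_add (c := fun _ => 0)
    (fun k => by rw [jCoeff_succ]; ring) w
  simpa [entireSum, bj, bj', bj''] using this

/-- The source `bj'` is what `(log s)/2 * bj` leaves behind when the equation is applied to it; the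
logarithmic solution is therefore `(log s)/2 * bj - bn`. On coefficients this is the recursion
H_{k+1} = H_k + 1/(k+1). -/
lemma bn_ode (w : ℂ) : w * bn'' w + bn' w + bn w = bj' w := by
  refine isEntireCoeff_n.mul_deriv_add (fun k => ?_) w
  have h1 : ((k : ℂ) + 1) ≠ 0 := by exact_mod_cast k.succ_ne_zero
  have h2 : ((harmonic (k + 1) : ℚ) : ℂ) = (harmonic k : ℚ) + ((k : ℂ) + 1)⁻¹ := by
    rw [harmonic_succ]; push_cast; ring
  have h3 : jCoeff k = -(((k : ℂ) + 1) ^ 2 * jCoeff (k + 1)) := by rw [jCoeff_succ]; ring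
  rw [nCoeff, nCoeff, h2, h3, derivCoeff]
  field_simp
  ring

/-- On the negative axis `bj` is real and at least `1`. -/
lemma one_le_norm_bj_neg {y : ℝ} (hy : 0 ≤ y) : 1 ≤ ‖bj (-(y : ℂ))‖ := by
  have h : bj (-(y : ℂ)) = ((∑' k : ℕ, y ^ k / (k.factorial : ℝ) ^ 2 : ℝ) : ℂ) := by
    rw [bj, entireSum, Complex.ofReal_tsum]
    refine tsum_congr fun k => ?_
    rw [jCoeff, neg_pow (y : ℂ)]
    push_cast
    rw [div_mul_eq_mul_div, ← mul_assoc, ← mul_pow]; norm_num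
  have hs : Summable fun k : ℕ => y ^ k / (k.factorial : ℝ) ^ 2 := by
    have := (isEntireCoeff_j.summable (y : ℂ)).norm
    refine this.congr fun k => ?_
    rw [norm_mul, norm_jCoeff, norm_pow, Complex.norm_real, Real.norm_of_nonneg hy]; ring
  have h1 : 1 ≤ ∑' k : ℕ, y ^ k / (k.factorial : ℝ) ^ 2 := by
    have := hs.le_tsum 0 (fun k _ => by positivity)
    simpa using this
  rw [h, Complex.norm_real, Real.norm_of_nonneg (by linarith)]
  exact h1

/-! ### Bessel and Hankel functions through `bj` and `bn` -/

lemma exp_cutLog {z : ℂ} (hz : z ≠ 0) : Complex.exp (cutLog z) = z := by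
  have h2 : (starRingEnd ℂ) (-Complex.I * z) ≠ 0 := by simpa using hz
  rw [cutLog, Complex.exp_add, Complex.exp_conj, Complex.exp_log h2, Complex.conj_conj]
  have : Complex.exp (Complex.I * (Real.pi / 2)) = Complex.I := by
    rw [mul_comm]; exact Complex.exp_pi_div_two_mul_I
  rw [this]
  linear_combination (-z) * Complex.I_mul_I

/-- Scaling by a positive number does not move the argument, so no branch jump occurs and log(λr)
splits into log r plus a constant depending on λ alone. -/
lemma cutLog_ofReal_mul {r : ℝ} (hr : 0 < r) {z : ℂ} (hz : z ≠ 0) :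
    cutLog (r * z) = Real.log r + cutLog z := by
  have h2 : (starRingEnd ℂ) (-Complex.I * z) ≠ 0 := by simpa using hz
  have h3 : (starRingEnd ℂ) (-Complex.I * (r * z)) = r * (starRingEnd ℂ) (-Complex.I * z) := by
    simp only [map_mul, Complex.conj_ofReal]; ring
  rw [cutLog, cutLog, h3, Complex.log_ofReal_mul hr h2]
  simp only [map_add, Complex.conj_ofReal]
  ring

lemma besselJ_zero (z : ℂ) : besselJ 0 z = bj (z ^ 2 / 4) := by
  rw [besselJ, bj, entireSum]
  simp only [zero_mul, Complex.exp_zero, one_mul]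
  refine tsum_congr fun k => ?_
  rw [zero_add, Complex.Gamma_nat_eq_factorial, jCoeff, neg_div, neg_pow, pow_two, mul_inv]
  field_simp

lemma besselJ_one {z : ℂ} (hz : z ≠ 0) : besselJ 1 z = -(z / 2) * bj' (z ^ 2 / 4) := by
  rw [besselJ, one_mul, exp_cutLog (div_ne_zero hz two_ne_zero), neg_mul, ← mul_neg, bj',
    entireSum, ← tsum_neg]
  congr 1
  refine tsum_congr fun k => ?_
  have h : (1 : ℂ) + k + 1 = ((k + 1 : ℕ) : ℂ) + 1 := by push_cast; ring
  have h1 : ((k : ℂ) + 1) ≠ 0 := by exact_mod_cast k.succ_ne_zero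
  have h2 : (k.factorial : ℂ) ≠ 0 := by exact_mod_cast k.factorial_ne_zero
  rw [h, Complex.Gamma_nat_eq_factorial, derivCoeff, jCoeff, Nat.factorial_succ, neg_div,
    neg_pow (z ^ 2 / 4)]
  push_cast
  field_simp
  ring

/-- This is -ψ(k+1)/k! with ψ(k+1) = H_k - γ; it is the source of the harmonic numbers in `bn` and
of Euler's constant in the Hankel function. -/
lemma hasDerivAt_inv_Gamma_nat (k : ℕ) :
    HasDerivAt (fun ν : ℂ => (Complex.Gamma (ν + k + 1))⁻¹)
      (-(-(Real.eulerMascheroniConstant : ℂ) + harmonic k) / k.factorial) 0 := by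
  have h2 : (k.factorial : ℂ) ≠ 0 := by exact_mod_cast k.factorial_ne_zero
  have h0 : (0 : ℂ) + k + 1 = k + 1 := by ring
  have hG := Complex.hasDerivAt_Gamma_nat k
  rw [← h0] at hG
  have h3 : HasDerivAt (fun ν : ℂ => ν + k + 1) 1 0 :=
    ((hasDerivAt_id (0 : ℂ)).add_const _).add_const _
  have h4 := (hG.comp (0 : ℂ) h3).inv
    (by simp only [Function.comp_apply]; rw [h0, Complex.Gamma_nat_eq_factorial]; exact h2)
  refine h4.congr_deriv ?_
  simp only [Function.comp_apply]
  rw [h0, Complex.Gamma_nat_eq_factorial]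
  field_simp

/-- The case k = 0 is compactness. Each use of the functional equation then divides by ν + k + 1,
whose modulus is at least 1/2, at the cost of a factor 2. A bound uniform in ν is what allows
differentiating the Bessel series in the order. -/
lemma inv_Gamma_add_nat_bound :
    ∃ C : ℝ, ∀ ν ∈ Metric.ball (0 : ℂ) (1 / 2), ∀ k : ℕ,
      ‖(Complex.Gamma (ν + k + 1))⁻¹‖ ≤ C * 2 ^ k := by
  obtain ⟨C, hC⟩ := (isCompact_closedBall (0 : ℂ) (1 / 2)).exists_bound_of_continuousOn
    (f := fun ν : ℂ => (Complex.Gamma (ν + 1))⁻¹)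
    ((Complex.differentiable_one_div_Gamma.comp
      (differentiable_id.add_const 1)).continuous.continuousOn)
  refine ⟨C, fun ν hν k => ?_⟩
  induction k with
  | zero => simpa using hC ν (Metric.ball_subset_closedBall hν)
  | succ k ih =>
    rw [mem_ball_zero_iff] at hν
    have h1 : 1 / 2 ≤ ‖ν + k + 1‖ := by
      have h3 : ‖((k : ℂ) + 1)‖ = k + 1 := by
        rw [← Nat.cast_succ, Complex.norm_natCast]; push_cast; ring
      have h4 : ‖((k : ℂ) + 1)‖ ≤ ‖ν + k + 1‖ + ‖ν‖ := by
        calc ‖((k : ℂ) + 1)‖ = ‖(ν + k + 1) - ν‖ := by ring_nf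
          _ ≤ _ := norm_sub_le _ _
      have : (0 : ℝ) ≤ k := k.cast_nonneg
      linarith
    have h2 : ν + k + 1 ≠ 0 := by
      intro h; rw [h, norm_zero] at h1; linarith
    have h5 : ν + (k + 1 : ℕ) + 1 = (ν + k + 1) + 1 := by push_cast; ring
    rw [h5, Complex.Gamma_add_one _ h2, mul_inv, norm_mul, norm_inv]
    have h6 : ‖ν + k + 1‖⁻¹ ≤ 2 := by
      rw [inv_le_comm₀ (by linarith) (by norm_num)]; linarith
    calc _ ≤ 2 * (C * 2 ^ k) := by gcongr
      _ = _ := by ring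

lemma hasDerivAt_besselJ_order (z : ℂ) :
    HasDerivAt (fun ν : ℂ => besselJ ν z)
      ((cutLog (z / 2) + Real.eulerMascheroniConstant) * bj (z ^ 2 / 4) - bn (z ^ 2 / 4)) 0 := by
  obtain ⟨C, hC⟩ := inv_Gamma_add_nat_bound
  set x : ℂ := -z ^ 2 / 4 with hx
  set F : ℕ → ℂ → ℂ := fun k ν => x ^ k * ((k.factorial : ℂ) * Complex.Gamma (ν + k + 1))⁻¹
    with hF
  have hF' : ∀ k ν, F k ν = x ^ k * (k.factorial : ℂ)⁻¹ * (Complex.Gamma (ν + k + 1))⁻¹ := by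
    intro k ν; rw [hF]; simp only [mul_inv]; ring
  have hs : Summable fun k : ℕ => C * ((2 * ‖x‖) ^ k / k.factorial) :=
    (Real.summable_pow_div_factorial _).mul_left C
  have hd : ∀ k : ℕ, DifferentiableOn ℂ (F k) (Metric.ball (0 : ℂ) (1 / 2)) := by
    intro k
    have : F k = fun ν => x ^ k * (k.factorial : ℂ)⁻¹ * (Complex.Gamma (ν + k + 1))⁻¹ :=
      funext (hF' k)
    rw [this]
    refine (Differentiable.const_mul ?_ _).differentiableOn
    exact Complex.differentiable_one_div_Gamma.comp
      ((differentiable_id.add_const _).add_const _)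
  have hb : ∀ (k : ℕ) (ν : ℂ), ν ∈ Metric.ball (0 : ℂ) (1 / 2) →
      ‖F k ν‖ ≤ C * ((2 * ‖x‖) ^ k / k.factorial) := by
    intro k ν hν
    rw [hF', norm_mul, norm_mul, norm_inv, norm_pow, Complex.norm_natCast]
    calc _ ≤ ‖x‖ ^ k * (k.factorial : ℝ)⁻¹ * (C * 2 ^ k) := by
          gcongr; exact hC ν hν k
      _ = _ := by rw [mul_pow]; ring
  have h0 : (0 : ℂ) ∈ Metric.ball (0 : ℂ) (1 / 2) := by simp
  have h1 := (Complex.differentiableOn_tsum_of_summable_norm hs hd Metric.isOpen_ball hb)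
    |>.differentiableAt (Metric.isOpen_ball.mem_nhds h0) |>.hasDerivAt
  have h2 := Complex.hasSum_deriv_of_summable_norm hs hd Metric.isOpen_ball hb h0
  have hjc : ∀ k : ℕ, x ^ k * ((k.factorial : ℂ)⁻¹ * (k.factorial : ℂ)⁻¹) =
      jCoeff k * (z ^ 2 / 4) ^ k := by
    intro k
    rw [hx, jCoeff, neg_div, neg_pow]; field_simp
  have h3 : ∀ k : ℕ, deriv (F k) 0 = Real.eulerMascheroniConstant *
      (jCoeff k * (z ^ 2 / 4) ^ k) - nCoeff k * (z ^ 2 / 4) ^ k := by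
    intro k
    have e : F k = fun ν => x ^ k * (k.factorial : ℂ)⁻¹ * (Complex.Gamma (ν + k + 1))⁻¹ :=
      funext (hF' k)
    rw [e, ((hasDerivAt_inv_Gamma_nat k).const_mul _).deriv, nCoeff, mul_assoc _ (jCoeff k),
      ← hjc k]
    ring
  have h4 : deriv (fun ν => ∑' k : ℕ, F k ν) 0 =
      Real.eulerMascheroniConstant * bj (z ^ 2 / 4) - bn (z ^ 2 / 4) := by
    rw [← h2.tsum_eq]
    simp_rw [h3]
    exact (((isEntireCoeff_j.summable _).hasSum.mul_left _).sub
      (isEntireCoeff_n.summable _).hasSum).tsum_eq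
  rw [h4] at h1
  have h5 : HasDerivAt (fun ν : ℂ => Complex.exp (ν * cutLog (z / 2))) (cutLog (z / 2)) 0 := by
    have := ((hasDerivAt_id (0 : ℂ)).mul_const (cutLog (z / 2))).cexp
    simpa using this
  have h6 := h5.mul h1
  have h7 : ∑' k : ℕ, F k 0 = bj (z ^ 2 / 4) := by
    have := besselJ_zero z
    rw [besselJ] at this
    simpa [hF] using this
  refine h6.congr_deriv ?_
  rw [h7]
  simp only [zero_mul, Complex.exp_zero, one_mul]
  ring

/-- For order zero the two order derivatives defining Y coincide, so Y₀ = (2/π) ∂_νJ. The summand J₀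
is moved into the logarithmic factor as the constant -iπ/2. -/
lemma hankel1_zero (z : ℂ) :
    hankel1 0 z = (2 * Complex.I / Real.pi) *
      ((cutLog (z / 2) + Real.eulerMascheroniConstant - Complex.I * (Real.pi / 2)) *
        bj (z ^ 2 / 4) - bn (z ^ 2 / 4)) := by
  have hpi : (Real.pi : ℂ) ≠ 0 := by exact_mod_cast Real.pi_ne_zero
  rw [hankel1, besselY, Int.cast_zero, neg_zero, (hasDerivAt_besselJ_order z).deriv, besselJ_zero,
    zpow_zero]
  field_simp
  linear_combination (Real.pi * bj (z ^ 2 / 4)) * Complex.I_sq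

open Set Filter Topology

/-! ### The decaying solution on the negative axis

`decayK y = 2 K₀(2√y)`, as an integral, and `decayM y = -y (decayK)'(y)`. -/

/-- `∫₀^∞ e^{-t-y/t} dt`. -/
def decayM (y : ℝ) : ℝ := ∫ t in Ioi (0 : ℝ), Real.exp (-t - y / t)

/-- `∫₀^∞ e^{-t-y/t} dt/t`. -/
def decayK (y : ℝ) : ℝ := ∫ t in Ioi (0 : ℝ), Real.exp (-t - y / t) / t

/-- `∫₀^∞ log t e^{-t-y/t} dt`. -/
def decayL (y : ℝ) : ℝ := ∫ t in Ioi (0 : ℝ), Real.log t * Real.exp (-t - y / t)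

lemma exp_sub_div_pow_le {y t : ℝ} (hy : 0 < y) (ht : 0 < t) (b : ℕ) :
    Real.exp (-t - y / t) / t ^ b ≤ (b.factorial / y ^ b) * Real.exp (-t) := by
  have h := Real.pow_div_factorial_le_exp (x := y / t) (by positivity) b
  have hb : (0 : ℝ) < b.factorial := by exact_mod_cast b.factorial_pos
  rw [sub_eq_add_neg, Real.exp_add, Real.exp_neg (y / t), div_eq_mul_inv, mul_comm (_ / _),
    mul_assoc]
  refine mul_le_mul_of_nonneg_left ?_ (Real.exp_pos _).le
  rw [← mul_inv, inv_le_comm₀ (by positivity) (by positivity)]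
  calc _ = (y / t) ^ b / b.factorial * t ^ b := by rw [div_pow]; field_simp
    _ ≤ _ := by gcongr

lemma exp_sub_le {y t : ℝ} (hy : 0 ≤ y) (ht : 0 < t) :
    Real.exp (-t - y / t) ≤ Real.exp (-t) := by
  have : 0 ≤ y / t := by positivity
  exact Real.exp_le_exp.2 (by linarith)

lemma integrableOn_one_add_mul_exp :
    IntegrableOn (fun t : ℝ => (1 + t) * Real.exp (-t)) (Ioi 0) := by
  have h1 := Real.GammaIntegral_convergent (s := 1) one_pos
  have h2 := Real.GammaIntegral_convergent (s := 2) two_pos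
  refine (h1.add h2).congr_fun (fun t ht => ?_) measurableSet_Ioi
  simp only [Pi.add_apply]
  norm_num
  ring

lemma integrableOn_of_exp_bound {f : ℝ → ℝ} (hf : ContinuousOn f (Ioi 0)) (C : ℝ)
    (h : ∀ t, 0 < t → |f t| ≤ C * ((1 + t) * Real.exp (-t))) : IntegrableOn f (Ioi 0) := by
  refine Integrable.mono' (integrableOn_one_add_mul_exp.const_mul C)
    (hf.aestronglyMeasurable measurableSet_Ioi) ?_
  filter_upwards [ae_restrict_mem measurableSet_Ioi] with t ht
  exact h t ht

lemma continuousOn_exp_sub_div (y : ℝ) :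
    ContinuousOn (fun t : ℝ => Real.exp (-t - y / t)) (Ioi 0) :=
  (continuousOn_id.neg.sub (continuousOn_const.div continuousOn_id
    fun _ ht => (mem_Ioi.1 ht).ne')).rexp

lemma exp_le_one_add_mul {t : ℝ} (ht : 0 < t) : Real.exp (-t) ≤ (1 + t) * Real.exp (-t) := by
  nlinarith [Real.exp_pos (-t)]

lemma integrableOn_exp_sub_div_pow {y : ℝ} (hy : 0 < y) (b : ℕ) :
    IntegrableOn (fun t : ℝ => Real.exp (-t - y / t) / t ^ b) (Ioi 0) := by
  refine integrableOn_of_exp_bound ((continuousOn_exp_sub_div y).div (by fun_prop)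
    fun t ht => pow_ne_zero _ (mem_Ioi.1 ht).ne') (b.factorial / y ^ b) fun t ht => ?_
  rw [abs_of_nonneg (by positivity)]
  refine (exp_sub_div_pow_le hy ht b).trans ?_
  gcongr
  exact exp_le_one_add_mul ht

lemma integrableOn_exp_sub_div {y : ℝ} (hy : 0 ≤ y) :
    IntegrableOn (fun t : ℝ => Real.exp (-t - y / t)) (Ioi 0) := by
  refine integrableOn_of_exp_bound (continuousOn_exp_sub_div y) 1 fun t ht => ?_
  rw [abs_of_nonneg (by positivity), one_mul]
  exact (exp_sub_le hy ht).trans (exp_le_one_add_mul ht)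

/-- Each y-derivative brings down -1/t. On z > y/2 the differentiated integrand is dominated by a
multiple of e^{-t}, because e^{-z/t} beats any power of 1/t. -/
lemma hasDerivAt_integral_exp_sub_div_pow {y : ℝ} (hy : 0 < y) (b : ℕ) :
    HasDerivAt (fun y : ℝ => ∫ t in Ioi (0 : ℝ), Real.exp (-t - y / t) / t ^ b)
      (-∫ t in Ioi (0 : ℝ), Real.exp (-t - y / t) / t ^ (b + 1)) y := by
  have hs : Ioi (y / 2) ∈ 𝓝 y := Ioi_mem_nhds (by linarith)
  have key := hasDerivAt_integral_of_dominated_loc_of_deriv_le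
    (μ := volume.restrict (Ioi (0 : ℝ)))
    (F := fun (y : ℝ) (t : ℝ) => Real.exp (-t - y / t) / t ^ b)
    (F' := fun (y : ℝ) (t : ℝ) => -(Real.exp (-t - y / t) / t ^ (b + 1)))
    (bound := fun t => ((b + 1).factorial / (y / 2) ^ (b + 1)) * Real.exp (-t)) hs ?_
    (integrableOn_exp_sub_div_pow hy b) (integrableOn_exp_sub_div_pow hy (b + 1)).neg.1 ?_ ?_ ?_
  · rw [← integral_neg]
    exact key.2
  · filter_upwards [hs] with z hz
    exact (integrableOn_exp_sub_div_pow (lt_trans (by positivity) (mem_Ioi.1 hz)) b).1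
  · filter_upwards [ae_restrict_mem measurableSet_Ioi] with t ht z hz
    have ht' : 0 < t := ht
    have hz' : y / 2 < z := hz
    rw [norm_neg, Real.norm_of_nonneg (by positivity)]
    refine (exp_sub_div_pow_le (lt_trans (by positivity) hz') ht' (b + 1)).trans ?_
    gcongr
  · refine Integrable.const_mul ?_ _
    exact integrableOn_of_exp_bound (by fun_prop) 1 fun t ht => by
      rw [abs_of_nonneg (by positivity), one_mul]; exact exp_le_one_add_mul ht
  · filter_upwards [ae_restrict_mem measurableSet_Ioi] with t ht z hz
    have ht' : t ≠ 0 := (mem_Ioi.1 ht).ne'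
    have h1 : HasDerivAt (fun z : ℝ => -t - z / t) (-(1 / t)) z :=
      ((hasDerivAt_id z).div_const t).const_sub (-t)
    refine (h1.exp.div_const (t ^ b)).congr_deriv ?_
    rw [pow_succ]; field_simp

lemma hasDerivAt_decayM {y : ℝ} (hy : 0 < y) : HasDerivAt decayM (-decayK y) y := by
  have h := hasDerivAt_integral_exp_sub_div_pow hy 0
  simp only [pow_zero, div_one, zero_add, pow_one] at h
  exact h

lemma integral_comp_div_Ioi {y : ℝ} (hy : 0 < y) (g : ℝ → ℝ) :
    ∫ t in Ioi (0 : ℝ), y / t ^ 2 * g (y / t) = ∫ t in Ioi (0 : ℝ), g t := by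
  have h1 := integral_comp_rpow_Ioi (fun x => y * g (y * x)) (p := -1) (by norm_num)
  have h2 := integral_comp_mul_left_Ioi' g 0 hy
  rw [mul_zero, smul_eq_mul, ← integral_const_mul] at h2
  rw [← h2, ← h1]
  refine setIntegral_congr_fun measurableSet_Ioi fun t ht => ?_
  have ht' : 0 < t := ht
  have e : t ^ ((-1 : ℝ) - 1) = (t ^ 2)⁻¹ := by
    rw [show (-1 : ℝ) - 1 = -((2 : ℕ) : ℝ) by norm_num, Real.rpow_neg ht'.le, Real.rpow_natCast]
  simp only [e, Real.rpow_neg_one, smul_eq_mul]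
  simp
  ring_nf

/-- The substitution t ↦ y/t preserves the exponent and turns dt/t² into dt/y. This closes the
system M′ = -K, K′ = -M/y. -/
lemma integral_exp_sub_div_sq {y : ℝ} (hy : 0 < y) :
    ∫ t in Ioi (0 : ℝ), Real.exp (-t - y / t) / t ^ 2 = decayM y / y := by
  rw [decayM, ← integral_comp_div_Ioi hy (fun t => Real.exp (-t - y / t)), eq_div_iff hy.ne',
    mul_comm, ← integral_const_mul]
  refine setIntegral_congr_fun measurableSet_Ioi fun t ht => ?_
  have ht' : t ≠ 0 := (mem_Ioi.1 ht).ne'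
  have : -(y / t) - y / (y / t) = -t - y / t := by field_simp; ring
  simp only [this]
  ring

lemma hasDerivAt_decayK {y : ℝ} (hy : 0 < y) : HasDerivAt decayK (-(decayM y / y)) y := by
  rw [← integral_exp_sub_div_sq hy]
  have h := hasDerivAt_integral_exp_sub_div_pow hy 1
  simp only [pow_one] at h
  exact h

lemma decayK_nonneg (y : ℝ) : 0 ≤ decayK y :=
  setIntegral_nonneg measurableSet_Ioi fun t ht => by
    have : 0 < t := ht
    positivity

lemma integral_exp_neg : ∫ t in Ioi (0 : ℝ), Real.exp (-t) = 1 := by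
  have := Real.Gamma_eq_integral one_pos
  rw [Real.Gamma_one] at this
  rw [this]
  refine setIntegral_congr_fun measurableSet_Ioi fun t ht => ?_
  simp

lemma integrableOn_exp_neg : IntegrableOn (fun t : ℝ => Real.exp (-t)) (Ioi 0) := by
  simpa using integrableOn_exp_sub_div le_rfl

lemma decayK_le {y : ℝ} (hy : 0 < y) : decayK y ≤ 1 / y := by
  have h : decayK y ≤ ∫ t in Ioi (0 : ℝ), 1 / y * Real.exp (-t) := by
    refine setIntegral_mono_on (by simpa using integrableOn_exp_sub_div_pow hy 1)
      (integrableOn_exp_neg.const_mul _) measurableSet_Ioi fun t ht => ?_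
    simpa using exp_sub_div_pow_le hy ht 1
  rwa [integral_const_mul, integral_exp_neg, mul_one] at h

lemma abs_log_le_add_inv {t : ℝ} (ht : 0 < t) : |Real.log t| ≤ t + 1 / t := by
  have h1 := Real.log_le_sub_one_of_pos ht
  have h2 := Real.log_le_sub_one_of_pos (inv_pos.2 ht)
  rw [Real.log_inv] at h2
  have h3 : 0 < t⁻¹ := inv_pos.2 ht
  rw [one_div, abs_le]
  constructor <;> linarith

lemma abs_log_mul_exp_le {y t : ℝ} (hy : 0 < y) (ht : 0 < t) :
    |Real.log t * Real.exp (-t - y / t)| ≤ (1 + 2 / y ^ 2) * (t * Real.exp (-t)) := by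
  rw [abs_mul, abs_of_pos (Real.exp_pos _)]
  have h1 := exp_sub_div_pow_le hy ht 2
  have h2 := exp_sub_le hy.le ht
  have h3 := mul_le_mul_of_nonneg_left h1 ht.le
  have h4 : t * (Real.exp (-t - y / t) / t ^ 2) = 1 / t * Real.exp (-t - y / t) := by
    field_simp
  rw [h4] at h3
  have h5 := mul_le_mul_of_nonneg_left h2 ht.le
  calc _ ≤ (t + 1 / t) * Real.exp (-t - y / t) := by gcongr; exact abs_log_le_add_inv ht
    _ ≤ _ := by
      rw [add_mul]
      norm_num [Nat.factorial] at h3 ⊢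
      nlinarith

lemma continuousOn_log_mul_exp (y : ℝ) :
    ContinuousOn (fun t : ℝ => Real.log t * Real.exp (-t - y / t)) (Ioi 0) :=
  (Real.continuousOn_log.mono fun _ ht => (mem_Ioi.1 ht).ne').mul (continuousOn_exp_sub_div y)

lemma integrableOn_log_mul_exp {y : ℝ} (hy : 0 < y) :
    IntegrableOn (fun t : ℝ => Real.log t * Real.exp (-t - y / t)) (Ioi 0) := by
  refine integrableOn_of_exp_bound (continuousOn_log_mul_exp y) (1 + 2 / y ^ 2) fun t ht =>
    (abs_log_mul_exp_le hy ht).trans ?_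
  gcongr
  linarith

lemma integrableOn_log_mul_exp_div {y : ℝ} (hy : 0 < y) :
    IntegrableOn (fun t : ℝ => Real.log t * (y / t ^ 2) * Real.exp (-t - y / t)) (Ioi 0) := by
  refine integrableOn_of_exp_bound
    (f := fun t : ℝ => Real.log t * (y / t ^ 2) * Real.exp (-t - y / t)) ?_
    (y * (1 / y + 6 / y ^ 3)) fun t ht => ?_
  · refine ContinuousOn.mul (ContinuousOn.mul ?_ ?_) (continuousOn_exp_sub_div y)
    · exact Real.continuousOn_log.mono fun _ ht => (mem_Ioi.1 ht).ne'
    · exact continuousOn_const.div (by fun_prop) fun t ht => pow_ne_zero _ (mem_Ioi.1 ht).ne'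
  · have h1 := exp_sub_div_pow_le hy ht 1
    have h2 := exp_sub_div_pow_le hy ht 3
    rw [abs_mul, abs_mul, abs_of_pos (Real.exp_pos _), abs_of_pos (by positivity : 0 < y / t ^ 2)]
    calc _ ≤ (t + 1 / t) * (y / t ^ 2) * Real.exp (-t - y / t) := by
          gcongr; exact abs_log_le_add_inv ht
      _ = y * (Real.exp (-t - y / t) / t ^ 1 + Real.exp (-t - y / t) / t ^ 3) := by
          field_simp
      _ ≤ y * (1 / y * Real.exp (-t) + 6 / y ^ 3 * Real.exp (-t)) := by
          norm_num [Nat.factorial] at h1 h2 ⊢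
          gcongr
      _ = y * (1 / y + 6 / y ^ 3) * Real.exp (-t) := by ring
      _ ≤ _ := by gcongr; exact exp_le_one_add_mul ht

/-- Integration by parts and the symmetry `t ↦ y / t`. -/
lemma decayK_eq {y : ℝ} (hy : 0 < y) :
    decayK y = 2 * decayL y - Real.log y * decayM y := by
  have hK : IntegrableOn (fun t : ℝ => Real.exp (-t - y / t) / t) (Ioi 0) := by
    simpa using integrableOn_exp_sub_div_pow hy 1
  have hL := integrableOn_log_mul_exp hy
  have hLd := integrableOn_log_mul_exp_div hy
  -- Under t ↦ y/t the logarithm becomes log y - log t. This isolates the singular term log y · M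
  -- and leaves only integrals that converge as y → 0.
  have hsym : ∫ t in Ioi (0 : ℝ), Real.log t * (y / t ^ 2) * Real.exp (-t - y / t) =
      Real.log y * decayM y - decayL y := by
    rw [decayM, decayL, ← integral_const_mul,
      ← integral_sub ((integrableOn_exp_sub_div hy.le).const_mul _) hL,
      ← integral_comp_div_Ioi hy (fun t => Real.log y * Real.exp (-t - y / t) -
        Real.log t * Real.exp (-t - y / t))]
    refine setIntegral_congr_fun measurableSet_Ioi fun t ht => ?_
    have ht' : 0 < t := ht
    have e : -(y / t) - y / (y / t) = -t - y / t := by field_simp; ring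
    simp only [e]
    rw [Real.log_div hy.ne' ht'.ne']
    ring
  -- The integrand is the derivative of log t · e^{-t-y/t}, which vanishes at both ends because y >
  -- 0.
  have hmain : ∫ t in Ioi (0 : ℝ), (Real.exp (-t - y / t) / t - Real.log t *
      Real.exp (-t - y / t) + Real.log t * (y / t ^ 2) * Real.exp (-t - y / t)) = 0 := by
    have h := integral_Ioi_of_hasDerivAt_of_tendsto (a := 0) (m := 0)
      (f := fun t : ℝ => Real.log t * Real.exp (-t - y / t))
      (f' := fun t : ℝ => Real.exp (-t - y / t) / t - Real.log t *
      Real.exp (-t - y / t) + Real.log t * (y / t ^ 2) * Real.exp (-t - y / t))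
      ?_ ?_ ((hK.sub hL).add hLd) ?_
    · simpa using h
    · rw [ContinuousWithinAt, Real.log_zero, zero_mul]
      have hb : Tendsto (fun t : ℝ => (1 + 2 / y ^ 2) * (t * Real.exp (-t)))
          (𝓝[≥] 0) (𝓝 0) := by
        have : Continuous (fun t : ℝ => (1 + 2 / y ^ 2) * (t * Real.exp (-t))) := by fun_prop
        have h0 := this.tendsto 0
        simp only [zero_mul, mul_zero] at h0
        exact h0.mono_left nhdsWithin_le_nhds
      refine squeeze_zero_norm' ?_ hb
      filter_upwards [self_mem_nhdsWithin] with t ht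
      rcases (mem_Ici.1 ht).eq_or_lt with h0 | h0
      · rw [← h0]; simp
      · exact abs_log_mul_exp_le hy h0
    · intro t ht
      have ht' : t ≠ 0 := (mem_Ioi.1 ht).ne'
      have h1 : HasDerivAt (fun t : ℝ => -t - y / t) (-1 - -(y / t ^ 2)) t := by
        have := (hasDerivAt_id t).neg.sub ((hasDerivAt_inv ht').const_mul y)
        refine this.congr_deriv ?_
        ring
      refine ((Real.hasDerivAt_log ht').mul h1.exp).congr_deriv ?_
      ring
    · have hb : Tendsto (fun t : ℝ => (1 + 2 / y ^ 2) * (t * Real.exp (-t))) atTop (𝓝 0) := by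
        have := (Real.tendsto_pow_mul_exp_neg_atTop_nhds_zero 1).const_mul (1 + 2 / y ^ 2)
        simpa using this
      refine squeeze_zero_norm' ?_ hb
      filter_upwards [eventually_gt_atTop 0] with t ht
      exact abs_log_mul_exp_le hy ht
  have hKL : IntegrableOn (fun t : ℝ => Real.exp (-t - y / t) / t -
      Real.log t * Real.exp (-t - y / t)) (Ioi 0) := hK.sub hL
  rw [integral_add hKL hLd, integral_sub hK hL, hsym] at hmain
  rw [decayL] at *
  rw [decayK]
  linarith

lemma one_sub_exp_neg_le_sqrt {x : ℝ} (hx : 0 ≤ x) : 1 - Real.exp (-x) ≤ √x := by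
  rcases le_total x 1 with h | h
  · have h1 := Real.add_one_le_exp (-x)
    have h2 : x ≤ √x := Real.le_sqrt_of_sq_le (by nlinarith)
    linarith
  · have h1 : 1 ≤ √x := Real.one_le_sqrt.2 h
    linarith [Real.exp_pos (-x)]

/-- The square root is used instead of 1 - e^{-x} ≤ x because e^{-t}y/t is not integrable at 0,
whereas t^{-1/2} is. The price is an error √y, still far smaller than any power of 1/|log y|. -/
lemma abs_exp_sub_le {y t : ℝ} (hy : 0 ≤ y) (ht : 0 < t) :
    |Real.exp (-t - y / t) - Real.exp (-t)| ≤ √y * (Real.exp (-t) * t ^ (-(1 / 2) : ℝ)) := by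
  have h1 := one_sub_exp_neg_le_sqrt (x := y / t) (by positivity)
  have h2 := exp_sub_le hy ht
  rw [abs_sub_comm, abs_of_nonneg (by linarith), sub_eq_add_neg (-t), Real.exp_add,
    Real.rpow_neg ht.le, ← Real.sqrt_eq_rpow]
  rw [Real.sqrt_div hy] at h1
  calc _ = Real.exp (-t) * (1 - Real.exp (-(y / t))) := by ring
    _ ≤ Real.exp (-t) * (√y / √t) := by gcongr
    _ = _ := by ring

lemma abs_decayM_sub_one_le : ∃ C : ℝ, ∀ y : ℝ, 0 < y → |decayM y - 1| ≤ C * √y := by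
  have hI := Real.GammaIntegral_convergent (s := 1 / 2) (by norm_num)
  rw [show (1 / 2 : ℝ) - 1 = -(1 / 2) by norm_num] at hI
  refine ⟨∫ t in Ioi (0 : ℝ), Real.exp (-t) * t ^ (-(1 / 2) : ℝ), fun y hy => ?_⟩
  have e : decayM y - 1 = ∫ t in Ioi (0 : ℝ), (Real.exp (-t - y / t) - Real.exp (-t)) := by
    rw [integral_sub (integrableOn_exp_sub_div hy.le) integrableOn_exp_neg, integral_exp_neg,
      decayM]
  rw [e, mul_comm, ← integral_const_mul, ← Real.norm_eq_abs]
  refine norm_integral_le_of_norm_le (hI.const_mul _) ?_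
  filter_upwards [ae_restrict_mem measurableSet_Ioi] with t ht
  exact abs_exp_sub_le hy.le ht

/-- The exponent 1/4 is chosen so that the product with t^{-1/2} remains integrable at 0. -/
lemma abs_log_le_rpow {t : ℝ} (ht : 0 < t) :
    |Real.log t| ≤ 4 * (t ^ (1 / 4 : ℝ) + t ^ (-(1 / 4) : ℝ)) := by
  have h1 := Real.log_le_rpow_div ht.le (show (0 : ℝ) < 1 / 4 by norm_num)
  have h2 := Real.log_le_rpow_div (inv_pos.2 ht).le (show (0 : ℝ) < 1 / 4 by norm_num)
  rw [Real.log_inv, Real.inv_rpow ht.le, ← Real.rpow_neg ht.le] at h2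
  have h3 : 0 < t ^ (1 / 4 : ℝ) := by positivity
  have h4 : 0 < t ^ (-(1 / 4) : ℝ) := by positivity
  rw [abs_le]
  constructor <;> linarith

/-- Both sides are Γ′(1), computed once under the integral sign. -/
lemma integral_log_mul_exp_neg :
    ∫ t in Ioi (0 : ℝ), Real.log t * Real.exp (-t) = -Real.eulerMascheroniConstant := by
  have h1 := Complex.hasDerivAt_GammaIntegral (s := 1) (by simp)
  have h2 : HasDerivAt Complex.GammaIntegral (-(Real.eulerMascheroniConstant : ℂ)) 1 := by
    refine Complex.hasDerivAt_Gamma_one.congr_of_eventuallyEq ?_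
    have : {s : ℂ | 0 < s.re} ∈ 𝓝 (1 : ℂ) :=
      (isOpen_lt continuous_const Complex.continuous_re).mem_nhds (by simp)
    filter_upwards [this] with s hs
    exact (Complex.Gamma_eq_integral hs).symm
  have h3 := h1.unique h2
  have h4 : ((∫ t in Ioi (0 : ℝ), Real.log t * Real.exp (-t) : ℝ) : ℂ) =
      ((-Real.eulerMascheroniConstant : ℝ) : ℂ) := by
    rw [← integral_complex_ofReal]
    push_cast at h3 ⊢
    rw [← h3]
    refine setIntegral_congr_fun measurableSet_Ioi fun t ht => ?_
    simp
  exact_mod_cast h4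

lemma abs_decayL_add_le :
    ∃ C : ℝ, ∀ y : ℝ, 0 < y → |decayL y + Real.eulerMascheroniConstant| ≤ C * √y := by
  have hI1 := Real.GammaIntegral_convergent (s := 3 / 4) (by norm_num)
  have hI2 := Real.GammaIntegral_convergent (s := 1 / 4) (by norm_num)
  have hI := (hI1.add hI2).const_mul 4
  have hlog : IntegrableOn (fun t : ℝ => Real.log t * Real.exp (-t)) (Ioi 0) := by
    have hJ1 := Real.GammaIntegral_convergent (s := 5 / 4) (by norm_num)
    refine Integrable.mono' ((hJ1.add hI1).const_mul 4) ?_ ?_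
    · simpa using (continuousOn_log_mul_exp 0).aestronglyMeasurable measurableSet_Ioi
    · filter_upwards [ae_restrict_mem measurableSet_Ioi] with t ht
      rw [norm_mul, Real.norm_eq_abs, Real.norm_of_nonneg (Real.exp_pos _).le]
      have := mul_le_mul_of_nonneg_right (abs_log_le_rpow ht) (Real.exp_pos (-t)).le
      refine this.trans (le_of_eq ?_)
      simp only [Pi.add_apply]
      norm_num
      ring
  refine ⟨∫ t in Ioi (0 : ℝ), 4 * (Real.exp (-t) * t ^ (3 / 4 - 1 : ℝ) +
    Real.exp (-t) * t ^ (1 / 4 - 1 : ℝ)), fun y hy => ?_⟩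
  have e : decayL y + Real.eulerMascheroniConstant = ∫ t in Ioi (0 : ℝ),
      (Real.log t * Real.exp (-t - y / t) - Real.log t * Real.exp (-t)) := by
    rw [integral_sub (integrableOn_log_mul_exp hy) hlog, integral_log_mul_exp_neg, decayL]
    ring
  rw [e, mul_comm, ← integral_const_mul, ← Real.norm_eq_abs]
  refine norm_integral_le_of_norm_le (hI.const_mul (√y)) ?_
  filter_upwards [ae_restrict_mem measurableSet_Ioi] with t ht
  have ht' : 0 < t := ht
  rw [← mul_sub, norm_mul, Real.norm_eq_abs, Real.norm_eq_abs]
  have e1 : t ^ (1 / 4 : ℝ) * t ^ (-(1 / 2) : ℝ) = t ^ (3 / 4 - 1 : ℝ) := by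
    rw [← Real.rpow_add ht']; norm_num
  have e2 : t ^ (-(1 / 4) : ℝ) * t ^ (-(1 / 2) : ℝ) = t ^ (1 / 4 - 1 : ℝ) := by
    rw [← Real.rpow_add ht']; norm_num
  calc _ ≤ 4 * (t ^ (1 / 4 : ℝ) + t ^ (-(1 / 4) : ℝ)) *
        (√y * (Real.exp (-t) * t ^ (-(1 / 2) : ℝ))) :=
        mul_le_mul (abs_log_le_rpow ht') (abs_exp_sub_le hy.le ht') (abs_nonneg _)
          (by positivity)
    _ = _ := by
      rw [← e1, ← e2]
      ring

/-- The behaviour of the decaying solution at the origin. -/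
lemma decay_asymptotics : ∃ C : ℝ, 0 < C ∧ ∀ y : ℝ, 0 < y →
    |decayM y - 1| ≤ C * √y ∧
    |decayK y + Real.log y + 2 * Real.eulerMascheroniConstant| ≤
      C * (√y * (1 + |Real.log y|)) := by
  obtain ⟨A, hA⟩ := abs_decayM_sub_one_le
  obtain ⟨B, hB⟩ := abs_decayL_add_le
  refine ⟨|A| + 2 * |B| + 1, by positivity, fun y hy => ?_⟩
  have hs : 0 ≤ √y := Real.sqrt_nonneg y
  have h1 : |decayM y - 1| ≤ |A| * √y :=
    (hA y hy).trans (mul_le_mul_of_nonneg_right (le_abs_self A) hs)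
  have h2 : |decayL y + Real.eulerMascheroniConstant| ≤ |B| * √y :=
    (hB y hy).trans (mul_le_mul_of_nonneg_right (le_abs_self B) hs)
  have hl := abs_nonneg (Real.log y)
  constructor
  · nlinarith [abs_nonneg B]
  · have e : decayK y + Real.log y + 2 * Real.eulerMascheroniConstant =
        2 * (decayL y + Real.eulerMascheroniConstant) - Real.log y * (decayM y - 1) := by
      rw [decayK_eq hy]; ring
    rw [e]
    have h3 : |Real.log y * (decayM y - 1)| ≤ |Real.log y| * (|A| * √y) := by
      rw [abs_mul]; gcongr
    have h4 : |2 * (decayL y + Real.eulerMascheroniConstant)| ≤ 2 * (|B| * √y) := by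
      rw [abs_mul, abs_two]; gcongr
    have h5 := abs_sub (2 * (decayL y + Real.eulerMascheroniConstant))
      (Real.log y * (decayM y - 1))
    have h6 : 0 ≤ |B| * √y * |Real.log y| := by positivity
    have h7 : 0 ≤ |A| * √y := by positivity
    have h8 : 0 ≤ √y * (1 + |Real.log y|) := by positivity
    nlinarith

/-! ### Radial functions on the plane -/

lemma volume_normSq_preimage_Iic (b : ℝ) :
    volume ((fun x : ℂ => ‖x‖ ^ 2) ⁻¹' Iic b) = ENNReal.ofReal Real.pi * ENNReal.ofReal b := by
  rcases lt_or_ge b 0 with hb | hb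
  · have : (fun x : ℂ => ‖x‖ ^ 2) ⁻¹' Iic b = ∅ := by
      ext x
      simp only [mem_preimage, mem_Iic, mem_empty_iff_false, iff_false, not_le]
      exact hb.trans_le (sq_nonneg _)
    rw [this, ENNReal.ofReal_of_nonpos hb.le]; simp
  · have : (fun x : ℂ => ‖x‖ ^ 2) ⁻¹' Iic b = Metric.closedBall 0 (√b) := by
      ext x
      simp only [mem_preimage, mem_Iic, mem_closedBall_zero_iff]
      exact (Real.le_sqrt (norm_nonneg _) hb).symm
    rw [this, Complex.volume_closedBall, ← ENNReal.ofReal_pow (Real.sqrt_nonneg _),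
      Real.sq_sqrt hb, mul_comm]
    congr 1
    rw [← NNReal.coe_real_pi, ENNReal.ofReal_coe_nnreal]

lemma measurable_norm_sq : Measurable (fun x : ℂ => ‖x‖ ^ 2) := by fun_prop

/-- The image of Lebesgue measure on the plane under `x ↦ ‖x‖²`. -/
lemma map_norm_sq_volume :
    Measure.map (fun x : ℂ => ‖x‖ ^ 2) volume =
      ENNReal.ofReal Real.pi • (volume : Measure ℝ).restrict (Ioi 0) := by
  have h1 : ∀ b : ℝ, Measure.map (fun x : ℂ => ‖x‖ ^ 2) volume (Iic b) =
      ENNReal.ofReal Real.pi * ENNReal.ofReal b := fun b => by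
    rw [Measure.map_apply measurable_norm_sq measurableSet_Iic, volume_normSq_preimage_Iic]
  have h2 : ∀ b : ℝ, (ENNReal.ofReal Real.pi • (volume : Measure ℝ).restrict (Ioi 0)) (Iic b) =
      ENNReal.ofReal Real.pi * ENNReal.ofReal b := fun b => by
    rw [Measure.smul_apply, Measure.restrict_apply measurableSet_Iic, smul_eq_mul,
      inter_comm, Ioi_inter_Iic, Real.volume_Ioc, sub_zero]
  have hfin : ∀ b : ℝ, ENNReal.ofReal Real.pi * ENNReal.ofReal b ≠ ⊤ := fun b =>
    ENNReal.mul_ne_top ENNReal.ofReal_ne_top ENNReal.ofReal_ne_top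
  have hd : ∀ a b : ℝ, Ioc a b = Iic b \ Iic a := fun a b => by
    ext x; simp [and_comm]
  refine Measure.ext_of_Ioc' _ _ (fun a b _ => ?_) fun a b hab => ?_
  · exact ne_top_of_le_ne_top (h1 b ▸ hfin b) (measure_mono Ioc_subset_Iic_self)
  · rw [hd, measure_sdiff (Iic_subset_Iic.2 hab.le) measurableSet_Iic.nullMeasurableSet
      (h1 a ▸ hfin a), measure_sdiff (Iic_subset_Iic.2 hab.le) measurableSet_Iic.nullMeasurableSet
      (h2 a ▸ hfin a), h1, h1, h2, h2]

lemma ofReal_pi_ne_zero : ENNReal.ofReal Real.pi ≠ 0 := by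
  simpa using Real.pi_pos

lemma ae_norm_sq_of_ae {P : ℝ → Prop} (h : ∀ᵐ s : ℝ, 0 < s → P s) : ∀ᵐ x : ℂ, P (‖x‖ ^ 2) := by
  refine ae_of_ae_map (p := P) measurable_norm_sq.aemeasurable ?_
  rw [map_norm_sq_volume]
  exact Measure.ae_smul_measure ((ae_restrict_iff' measurableSet_Ioi).2 h) _

lemma integral_comp_norm_sq {G : ℝ → ℂ} (hG : AEStronglyMeasurable G (volume.restrict (Ioi 0))) :
    ∫ x : ℂ, G (‖x‖ ^ 2) = Real.pi * ∫ s in Ioi (0 : ℝ), G s := by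
  rw [← integral_map (φ := fun x : ℂ => ‖x‖ ^ 2) measurable_norm_sq.aemeasurable,
    map_norm_sq_volume, integral_smul_measure, ENNReal.toReal_ofReal Real.pi_pos.le]
  · rw [Complex.real_smul]
  · rw [map_norm_sq_volume]
    exact hG.smul_measure _

lemma integrable_comp_norm_sq_iff {G : ℝ → ℂ}
    (hG : AEStronglyMeasurable G (volume.restrict (Ioi 0))) :
    Integrable (fun x : ℂ => G (‖x‖ ^ 2)) ↔ IntegrableOn G (Ioi 0) := by
  have h := integrable_map_measure (μ := (volume : Measure ℂ)) (f := fun x : ℂ => ‖x‖ ^ 2) (g := G)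
    (by rw [map_norm_sq_volume]; exact hG.smul_measure _) measurable_norm_sq.aemeasurable
  rw [map_norm_sq_volume,
    integrable_smul_measure ofReal_pi_ne_zero ENNReal.ofReal_ne_top] at h
  exact h.symm

/-- A property of almost every point holds at almost every point of almost every circle. -/
lemma ae_ae_polar {P : ℂ → Prop} (h : ∀ᵐ x : ℂ, P x) :
    ∀ᵐ (r : ℝ) ∂(volume.restrict (Ioi (0 : ℝ))),
      ∀ᵐ (θ : ℝ) ∂(volume.restrict (Ioo (-Real.pi) Real.pi)),
        P (r * Complex.exp (θ * Complex.I)) := by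
  have key : ∀ᵐ p ∂((volume : Measure (ℝ × ℝ)).restrict polarCoord.target),
      P (Complex.polarCoord.symm p) := by
    set N := toMeasurable (volume : Measure ℂ) {x : ℂ | ¬ P x}
    have hN : MeasurableSet N := measurableSet_toMeasurable _ _
    have hN0 : volume N = 0 := by rw [measure_toMeasurable]; exact h
    have h1 := Complex.lintegral_comp_polarCoord_symm (N.indicator 1)
    rw [lintegral_indicator_one hN, hN0] at h1
    have hm : Measurable fun p : ℝ × ℝ => Complex.polarCoord.symm p := by
      simp only [Complex.polarCoord_symm_apply]
      fun_prop
    rw [lintegral_eq_zero_iff] at h1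
    · filter_upwards [h1, ae_restrict_mem polarCoord.open_target.measurableSet] with p hp hp2
      by_contra hc
      have hmem : Complex.polarCoord.symm p ∈ N := subset_toMeasurable _ _ hc
      have hp1 : 0 < p.1 := hp2.1
      simp only [smul_eq_mul, Pi.zero_apply, mul_eq_zero, ENNReal.ofReal_eq_zero] at hp
      rcases hp with hp | hp
      · exact absurd hp (not_le.2 hp1)
      · rw [indicator_of_mem hmem] at hp
        exact one_ne_zero hp
    · refine Measurable.mul (by fun_prop) ?_
      exact (measurable_one.indicator hN).comp hm
  rw [polarCoord_target, Measure.volume_eq_prod, ← Measure.prod_restrict] at key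
  have := Measure.ae_ae_of_ae_prod key
  filter_upwards [this] with r hr
  filter_upwards [hr] with θ hθ
  simpa [Complex.exp_mul_I] using hθ

lemma ae_comp_norm_of_ae {P : ℝ → Prop} (h : ∀ᵐ r : ℝ, 0 < r → P r) : ∀ᵐ x : ℂ, P ‖x‖ := by
  set N := toMeasurable (volume : Measure ℝ) {r : ℝ | ¬ (0 < r → P r)}
  have hN : MeasurableSet N := measurableSet_toMeasurable _ _
  have hN0 : volume N = 0 := by rw [measure_toMeasurable]; exact h
  have hN' : MeasurableSet ((fun x : ℂ => ‖x‖) ⁻¹' N) := hN.preimage measurable_norm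
  have h1 := Complex.lintegral_comp_polarCoord_symm (((fun x : ℂ => ‖x‖) ⁻¹' N).indicator 1)
  rw [lintegral_indicator_one hN'] at h1
  have h2 : ∀ᵐ p : ℝ × ℝ, p.1 ∉ N := by
    have : ∀ᵐ r : ℝ, r ∉ N := measure_eq_zero_iff_ae_notMem.1 hN0
    exact Measure.quasiMeasurePreserving_fst.ae this
  have h3 : volume ((fun x : ℂ => ‖x‖) ⁻¹' N) = 0 := by
    rw [← h1, lintegral_eq_zero_of_ae_eq_zero]
    filter_upwards [ae_restrict_of_ae h2, ae_restrict_mem polarCoord.open_target.measurableSet]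
      with p hp hp2
    have hp1 : 0 < p.1 := hp2.1
    have : Complex.polarCoord.symm p ∉ (fun x : ℂ => ‖x‖) ⁻¹' N := by
      rw [mem_preimage, Complex.norm_polarCoord_symm, abs_of_pos hp1]
      exact hp
    rw [indicator_of_notMem this]
    simp
  have h0 : ∀ᵐ x : ℂ, x ≠ 0 := by simp [ae_iff]
  filter_upwards [measure_eq_zero_iff_ae_notMem.1 h3, h0] with x hx hx0
  by_contra hc
  exact hx (subset_toMeasurable _ _ (by simpa [hx0] using hc))

/-- A measurable radial profile, as a function of `‖x‖²`. -/
lemma IsRadial.exists_profile {u : ℂ → ℂ} (hu : IsRadial u) (hm : AEStronglyMeasurable u) :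
    ∃ F : ℝ → ℂ, StronglyMeasurable F ∧ ∀ᵐ x : ℂ, u x = F (‖x‖ ^ 2) := by
  obtain ⟨f, hf⟩ := hu
  have hv : StronglyMeasurable (hm.mk u) := hm.stronglyMeasurable_mk
  have h1 : ∀ᵐ x : ℂ, hm.mk u x = f ‖x‖ := by
    filter_upwards [hf, hm.ae_eq_mk] with x hx hx2
    rw [← hx2, hx]
  -- The given profile need not be measurable. Averaging a measurable representative over circles
  -- gives a measurable function that agrees with it at almost every radius.
  set g : ℝ → ℂ := fun r => ((2 * Real.pi : ℝ) : ℂ)⁻¹ *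
    ∫ θ in Ioo (-Real.pi) Real.pi, hm.mk u (r * Complex.exp (θ * Complex.I)) with hg
  have hgm : StronglyMeasurable g := by
    refine StronglyMeasurable.const_mul ?_ _
    refine StronglyMeasurable.integral_prod_right (f := fun (r : ℝ) (θ : ℝ) =>
      hm.mk u (r * Complex.exp (θ * Complex.I))) ?_
    exact hv.comp_measurable (by fun_prop)
  have h2 : ∀ᵐ r : ℝ, 0 < r → g r = f r := by
    refine (ae_restrict_iff' measurableSet_Ioi).1 ?_
    filter_upwards [ae_ae_polar h1, ae_restrict_mem measurableSet_Ioi] with r hr hr0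
    have e : ∫ θ in Ioo (-Real.pi) Real.pi, hm.mk u (r * Complex.exp (θ * Complex.I)) =
        ∫ θ in Ioo (-Real.pi) Real.pi, f r := by
      refine integral_congr_ae ?_
      filter_upwards [hr] with θ hθ
      rw [hθ]
      simp [abs_of_pos (mem_Ioi.1 hr0)]
    have hpi : ((2 * Real.pi : ℝ) : ℂ) ≠ 0 := by exact_mod_cast Real.two_pi_pos.ne'
    have hvol : (volume : Measure ℝ).real (Ioo (-Real.pi) Real.pi) = 2 * Real.pi := by
      rw [measureReal_def, Real.volume_Ioo, ENNReal.toReal_ofReal] <;> linarith [Real.pi_pos]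
    rw [hg]
    simp only
    rw [e, setIntegral_const, hvol, Complex.real_smul, inv_mul_cancel_left₀ hpi]
  refine ⟨fun s => g (√s), hgm.comp_measurable Real.continuous_sqrt.measurable, ?_⟩
  filter_upwards [ae_comp_norm_of_ae h2, hf] with x hx hx2
  rw [Real.sqrt_sq (norm_nonneg x), hx, hx2]

/-! ### Test functions of the form `g(‖x‖²)` -/

lemma hasFDerivAt_norm_sq (x : ℂ) :
    HasFDerivAt (fun x : ℂ => ‖x‖ ^ 2) (2 • innerSL ℝ x) x :=
  (hasStrictFDerivAt_norm_sq x).hasFDerivAt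

lemma fderiv_comp_norm_sq {g g' : ℝ → ℂ} (hg : ∀ s, HasDerivAt g (g' s) s) (x v : ℂ) :
    fderiv ℝ (fun x : ℂ => g (‖x‖ ^ 2)) x v = (2 * inner ℝ x v : ℝ) * g' (‖x‖ ^ 2) := by
  have h := (hg (‖x‖ ^ 2)).hasFDerivAt.comp x (hasFDerivAt_norm_sq x)
  have e : fderiv ℝ (fun x : ℂ => g (‖x‖ ^ 2)) x = _ := h.fderiv
  rw [e]
  simp only [ContinuousLinearMap.comp_apply, _root_.smul_apply, innerSL_apply_apply,
    ContinuousLinearMap.toSpanSingleton_apply, nsmul_eq_mul, Complex.real_smul]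
  push_cast
  ring

lemma fderiv_fderiv_comp_norm_sq {g g' g'' : ℝ → ℂ} (hg : ∀ s, HasDerivAt g (g' s) s)
    (hg' : ∀ s, HasDerivAt g' (g'' s) s) (hc : ContDiff ℝ 2 g) (x v : ℂ) :
    fderiv ℝ (fderiv ℝ (fun x : ℂ => g (‖x‖ ^ 2))) x v v =
      (2 * ‖v‖ ^ 2 : ℝ) * g' (‖x‖ ^ 2) + ((2 * inner ℝ x v) ^ 2 : ℝ) * g'' (‖x‖ ^ 2) := by
  have hcd : ContDiff ℝ 2 (fun x : ℂ => g (‖x‖ ^ 2)) := hc.comp (contDiff_norm_sq ℝ)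
  have hd : DifferentiableAt ℝ (fderiv ℝ (fun x : ℂ => g (‖x‖ ^ 2))) x :=
    (hcd.fderiv_right (m := 1) (by norm_num)).differentiable (by norm_num) x
  have h1 : fderiv ℝ (fderiv ℝ (fun x : ℂ => g (‖x‖ ^ 2))) x v v =
      fderiv ℝ (fun z => fderiv ℝ (fun x : ℂ => g (‖x‖ ^ 2)) z v) x v := by
    rw [fderiv_clm_apply hd (differentiableAt_const v)]
    simp
  rw [h1]
  have h2 : (fun z => fderiv ℝ (fun x : ℂ => g (‖x‖ ^ 2)) z v) =
      fun z : ℂ => ((2 * inner ℝ z v : ℝ) : ℂ) * g' (‖z‖ ^ 2) :=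
    funext fun z => fderiv_comp_norm_sq hg z v
  rw [h2]
  have h3 : HasFDerivAt (fun z : ℂ => ((2 * inner ℝ z v : ℝ) : ℂ))
      (Complex.ofRealCLM.comp ((2 : ℝ) • innerSL ℝ v)) x := by
    have : (fun z : ℂ => ((2 * inner ℝ z v : ℝ) : ℂ)) =
        Complex.ofRealCLM.comp ((2 : ℝ) • innerSL ℝ v) := by
      funext z
      simp only [ContinuousLinearMap.comp_apply, _root_.smul_apply,
        innerSL_apply_apply, smul_eq_mul, Complex.ofRealCLM_apply, real_inner_comm]
    rw [this]
    exact ContinuousLinearMap.hasFDerivAt _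
  have h4 : HasFDerivAt (fun z : ℂ => g' (‖z‖ ^ 2)) _ x :=
    (hg' (‖x‖ ^ 2)).hasFDerivAt.comp x (hasFDerivAt_norm_sq x)
  have h5 : fderiv ℝ (fun z : ℂ => ((2 * inner ℝ z v : ℝ) : ℂ) * g' (‖z‖ ^ 2)) x = _ :=
    (h3.mul h4).fderiv
  rw [h5]
  simp only [_root_.add_apply, ContinuousLinearMap.comp_apply,
    _root_.smul_apply, innerSL_apply_apply, ContinuousLinearMap.toSpanSingleton_apply,
    nsmul_eq_mul, smul_eq_mul, Complex.real_smul, Complex.ofRealCLM_apply,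
    real_inner_self_eq_norm_sq]
  push_cast
  ring

lemma laplacian_comp_norm_sq {g g' g'' : ℝ → ℂ} (hg : ∀ s, HasDerivAt g (g' s) s)
    (hg' : ∀ s, HasDerivAt g' (g'' s) s) (hc : ContDiff ℝ 2 g) (x : ℂ) :
    Laplacian.laplacian (fun x : ℂ => g (‖x‖ ^ 2)) x =
      4 * (‖x‖ ^ 2 : ℝ) * g'' (‖x‖ ^ 2) + 4 * g' (‖x‖ ^ 2) := by
  rw [InnerProductSpace.laplacian_eq_iteratedFDeriv_complexPlane]
  simp only [iteratedFDeriv_two_apply]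
  simp only [Matrix.cons_val_zero, Matrix.cons_val_one]
  rw [fderiv_fderiv_comp_norm_sq hg hg' hc, fderiv_fderiv_comp_norm_sq hg hg' hc]
  have h1 : inner ℝ x (1 : ℂ) = x.re := by simp [Complex.inner]
  have h2 : inner ℝ x Complex.I = x.im := by simp [Complex.inner]
  have h3 : ‖x‖ ^ 2 = x.re ^ 2 + x.im ^ 2 := by
    rw [← Complex.normSq_eq_norm_sq, Complex.normSq_apply]; ring
  rw [h1, h2, norm_one, Complex.norm_I]
  have h4 : ((‖x‖ ^ 2 : ℝ) : ℂ) = ((x.re ^ 2 + x.im ^ 2 : ℝ) : ℂ) := by rw [h3]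
  rw [h4]
  push_cast
  ring

/-! ### Distributional first order equations on the line -/

lemma hasCompactSupport_exists_Icc {g : ℝ → ℝ} (hg : HasCompactSupport g) :
    ∃ a b : ℝ, a < b ∧ ∀ s, s ∉ Icc a b → g s = 0 := by
  obtain ⟨N, hN⟩ := hg.isCompact.isBounded.subset_closedBall 0
  refine ⟨-(|N| + 1), |N| + 1, by linarith [abs_nonneg N], fun s hs => ?_⟩
  by_contra h
  have h1 := hN (subset_tsupport g h)
  rw [mem_closedBall_zero_iff, Real.norm_eq_abs, abs_le] at h1
  exact hs ⟨by linarith [le_abs_self N], by linarith [le_abs_self N]⟩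

lemma exists_Icc_of_tsupport_subset {g : ℝ → ℝ} (hg : HasCompactSupport g)
    (hs : tsupport g ⊆ Ioi 0) : ∃ a b : ℝ, 0 < a ∧ a < b ∧ ∀ s, s ∉ Icc a b → g s = 0 := by
  obtain ⟨_, b, _, hb⟩ := hasCompactSupport_exists_Icc hg
  rcases (tsupport g).eq_empty_or_nonempty with h | h
  · refine ⟨1, 2, one_pos, one_lt_two, fun s _ => ?_⟩
    rw [tsupport_eq_empty_iff.1 h]; rfl
  · obtain ⟨a, ha, hmin⟩ := hg.isCompact.exists_isLeast h
    have ha0 : 0 < a := hs ha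
    refine ⟨a, max b a + 1, ha0, by linarith [le_max_right b a], fun s hs' => ?_⟩
    by_contra hne
    refine hs' ⟨hmin (subset_tsupport g hne), ?_⟩
    by_contra hlt
    exact hne (hb s fun hmem => hlt (hmem.2.trans (by linarith [le_max_left b a])))

lemma exists_primitive {p : ℝ → ℝ} (hp : ContDiff ℝ ∞ p) {a b : ℝ}
    (hz : ∀ s, s ∉ Icc a b → p s = 0) (h0 : ∫ s, p s = 0) :
    ∃ g : ℝ → ℝ, ContDiff ℝ ∞ g ∧ (∀ s, HasDerivAt g (p s) s) ∧ ∀ s, s ∉ Icc a b → g s = 0 := by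
  have hd : ∀ s, HasDerivAt (fun s => ∫ t in (a - 1)..s, p t) (p s) s := fun s =>
    intervalIntegral.integral_hasDerivAt_right (hp.continuous.intervalIntegrable _ _)
      (hp.continuous.stronglyMeasurableAtFilter _ _) hp.continuous.continuousAt
  refine ⟨fun s => ∫ t in (a - 1)..s, p t, ?_, hd, fun s hs => ?_⟩
  · refine contDiff_infty_iff_deriv.2 ⟨fun s => (hd s).differentiableAt, ?_⟩
    rw [funext fun s => (hd s).deriv]
    exact hp
  · rcases lt_or_ge s a with h | h
    · refine intervalIntegral.integral_zero_ae (Eventually.of_forall fun t ht => hz t fun hm => ?_)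
      have := ht.2
      exact absurd hm.1 (not_le.2 (this.trans_lt (max_lt (by linarith) h)))
    · have hb : b < s := by
        by_contra hc
        exact hs ⟨h, not_lt.1 hc⟩
      dsimp only
      rw [intervalIntegral.integral_eq_integral_of_support_subset, h0]
      intro t ht
      have : t ∈ Icc a b := by
        by_contra hc
        exact ht (hz t hc)
      exact ⟨by linarith [this.1], by linarith [this.2]⟩

lemma hasCompactSupport_of_Icc {g : ℝ → ℝ} {a b : ℝ} (hz : ∀ s, s ∉ Icc a b → g s = 0) :
    HasCompactSupport g :=
  HasCompactSupport.intro isCompact_Icc fun s hs => hz s hs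

lemma intervalIntegrable_of_locallyIntegrable {E : Type*} [NormedAddCommGroup E] {B : ℝ → E}
    (hB : LocallyIntegrable B) (a b : ℝ) : IntervalIntegrable B volume a b :=
  (hB.integrableOn_isCompact isCompact_uIcc).intervalIntegrable

/-- Since `B` is only locally integrable, its primitive is only absolutely continuous, and
integration by parts is used in that form. No boundary term survives because `g` vanishes at ±M. -/
lemma integral_mul_eq_neg_integral_primitive_real {B : ℝ → ℝ} (hB : LocallyIntegrable B)
    {g : ℝ → ℝ} (hg : ContDiff ℝ ∞ g) {a b : ℝ} (hz : ∀ s, s ∉ Icc a b → g s = 0) :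
    ∫ s, g s * B s = -∫ s, deriv g s * ∫ t in (0 : ℝ)..s, B t := by
  set M := |a| + |b| + 1
  have hM1 : -M < a := by
    have := neg_abs_le a; have := abs_nonneg b; simp only [M]; linarith
  have hM2 : b < M := by
    have := le_abs_self b; have := abs_nonneg a; simp only [M]; linarith
  have hM0 : 0 < M := by positivity
  have hII : IntervalIntegrable B volume (-M) M := intervalIntegrable_of_locallyIntegrable hB _ _
  have h0mem : (0 : ℝ) ∈ uIcc (-M) M := by
    rw [uIcc_of_le (by linarith)]; constructor <;> linarith
  have hQ := hII.absolutelyContinuousOnInterval_intervalIntegral h0mem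
  have hgA : AbsolutelyContinuousOnInterval g (-M) M :=
    (hg.of_le (by norm_cast)).contDiffOn.absolutelyContinuousOnInterval
  have key := hgA.integral_mul_deriv_eq_deriv_mul hQ
  have hg1 : g M = 0 := hz M fun h => by linarith [h.2]
  have hg2 : g (-M) = 0 := hz (-M) fun h => by linarith [h.1]
  rw [hg1, hg2, zero_mul, zero_mul, sub_zero, zero_sub] at key
  have hz' : ∀ s, s ∉ Icc a b → deriv g s = 0 := by
    intro s hs
    have : g =ᶠ[𝓝 s] fun _ => 0 := by
      filter_upwards [isClosed_Icc.isOpen_compl.mem_nhds hs] with t ht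
      exact hz t ht
    rw [this.deriv_eq]; simp
  have e1 : ∫ s in (-M)..M, g s * deriv (fun x => ∫ t in (0 : ℝ)..x, B t) s = ∫ s, g s * B s := by
    rw [← intervalIntegral.integral_eq_integral_of_support_subset (a := -M) (b := M)]
    · refine intervalIntegral.integral_congr_ae ?_
      filter_upwards [hII.ae_hasDerivAt_integral] with s hs hsm
      rw [(hs (uIoc_subset_uIcc hsm) 0 h0mem).deriv]
    · intro s hs
      have : s ∈ Icc a b := by
        by_contra hc
        exact hs (by simp [hz s hc])
      exact ⟨by linarith [this.1], by linarith [this.2]⟩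
  rw [← e1, key, ← intervalIntegral.integral_eq_integral_of_support_subset (a := -M) (b := M)]
  intro s hs
  have : s ∈ Icc a b := by
    by_contra hc
    exact hs (by simp [hz' s hc])
  exact ⟨by linarith [this.1], by linarith [this.2]⟩

lemma integrable_mul_of_compactSupport {B : ℝ → ℂ} (hB : LocallyIntegrable B) {g : ℝ → ℝ}
    (hg : Continuous g) (hs : HasCompactSupport g) : Integrable fun s => (g s : ℂ) * B s := by
  have := hB.integrable_smul_left_of_hasCompactSupport hg hs
  simpa using this

lemma integral_mul_eq_neg_integral_primitive {B : ℝ → ℂ} (hB : LocallyIntegrable B)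
    {g : ℝ → ℝ} (hg : ContDiff ℝ ∞ g) {a b : ℝ} (hz : ∀ s, s ∉ Icc a b → g s = 0) :
    ∫ s, (g s : ℂ) * B s = -∫ s, ((deriv g s : ℝ) : ℂ) * ∫ t in (0 : ℝ)..s, B t := by
  have hgc := hasCompactSupport_of_Icc hz
  have hdc : Continuous (deriv g) := hg.continuous_deriv (by simp)
  have hQ : Continuous fun s => ∫ t in (0 : ℝ)..s, B t :=
    intervalIntegral.continuous_primitive
      (fun _ _ => intervalIntegrable_of_locallyIntegrable hB _ _) 0
  have hi1 := integrable_mul_of_compactSupport hB hg.continuous hgc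
  have hi2 := integrable_mul_of_compactSupport hQ.locallyIntegrable hdc hgc.deriv
  have key : ∀ L : ℂ →L[ℝ] ℝ, L (∫ s, (g s : ℂ) * B s) =
      L (-∫ s, ((deriv g s : ℝ) : ℂ) * ∫ t in (0 : ℝ)..s, B t) := by
    intro L
    have hL : ∀ (r : ℝ) (z : ℂ), L (r * z) = r * L z := fun r z => by
      rw [← Complex.real_smul, L.map_smul, smul_eq_mul]
    have hLB : LocallyIntegrable fun s => L (B s) := fun s =>
      let ⟨t, ht, hi⟩ := hB s
      ⟨t, ht, L.integrable_comp hi⟩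
    rw [map_neg, ← L.integral_comp_comm hi1, ← L.integral_comp_comm hi2]
    simp only [hL]
    rw [integral_mul_eq_neg_integral_primitive_real hLB hg hz]
    congr 2
    funext s
    rw [L.intervalIntegral_comp_comm (intervalIntegrable_of_locallyIntegrable hB _ _)]
  exact Complex.ext (key Complex.reCLM) (key Complex.imCLM)

/-- A distribution `f` on `(0, ∞)` with `f' = 0` is constant. -/
lemma ae_eq_const_of_integral_deriv_eq_zero {f : ℝ → ℂ} (hf : LocallyIntegrableOn f (Ioi 0))
    (h : ∀ P : ℝ → ℝ, ContDiff ℝ ∞ P → HasCompactSupport P → tsupport P ⊆ Ioi 0 →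
      ∫ s, ((deriv P s : ℝ) : ℂ) * f s = 0) :
    ∃ c : ℂ, ∀ᵐ s : ℝ, 0 < s → f s = c := by
  set φ : ContDiffBump (2 : ℝ) := ⟨1 / 2, 1, by norm_num, by norm_num⟩ with hφ
  set p₀ : ℝ → ℝ := φ.normed volume with hp₀
  have hp₀c : ContDiff ℝ ∞ p₀ := φ.contDiff_normed
  have hp₀s : HasCompactSupport p₀ := φ.hasCompactSupport_normed
  have hp₀i : ∫ s, p₀ s = 1 := φ.integral_normed
  have hp₀t : tsupport p₀ ⊆ Ioi 0 := by
    rw [hp₀, φ.tsupport_normed_eq]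
    intro s hs
    have h1 := abs_le.1 (mem_closedBall_iff_norm.1 hs)
    have h2 : φ.rOut = 1 := rfl
    rw [h2] at h1
    exact mem_Ioi.2 (by linarith [h1.1])
  set c := ∫ s, (p₀ s : ℂ) * f s with hc
  have hint : ∀ g : ℝ → ℝ, ContDiff ℝ ∞ g → HasCompactSupport g → tsupport g ⊆ Ioi 0 →
      Integrable fun s => (g s : ℂ) * f s := by
    intro g hg hgs hgt
    have h1 : IntegrableOn f (tsupport g) := hf.integrableOn_compact_subset hgt hgs.isCompact
    have h2 : IntegrableOn (fun s => (g s : ℂ) * f s) (tsupport g) :=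
      h1.continuousOn_mul (Complex.continuous_ofReal.comp hg.continuous).continuousOn hgs.isCompact
    refine (integrableOn_iff_integrable_of_support_subset ?_).1 h2
    intro s hs
    by_contra hn
    exact hs (by simp [image_eq_zero_of_notMem_tsupport hn])
  refine ⟨c, ?_⟩
  have hfc : LocallyIntegrableOn (fun s => f s - c) (Ioi 0) :=
    hf.sub (continuous_const.locallyIntegrable.locallyIntegrableOn _)
  have key := isOpen_Ioi.ae_eq_zero_of_integral_contDiff_smul_eq_zero hfc ?_
  · filter_upwards [key] with s hs h0
    exact sub_eq_zero.1 (hs h0)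
  intro g hg hgs hgt
  -- Subtracting m times the normalized bump leaves a function of mean zero, which is the derivative
  -- of a test function supported in (0, ∞). Testing against it compares f with the constant c.
  set m := ∫ s, g s
  have hq : ContDiff ℝ ∞ fun s => g s - m * p₀ s := hg.sub (contDiff_const.mul hp₀c)
  obtain ⟨a₁, b₁, ha₁, _, hz₁⟩ := exists_Icc_of_tsupport_subset hgs hgt
  obtain ⟨a₂, b₂, ha₂, _, hz₂⟩ := exists_Icc_of_tsupport_subset hp₀s hp₀t
  have hgi : Integrable g := hg.continuous.integrable_of_hasCompactSupport hgs
  have hpi : Integrable p₀ := hp₀c.continuous.integrable_of_hasCompactSupport hp₀s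
  have hz : ∀ s, s ∉ Icc (min a₁ a₂) (max b₁ b₂) → g s - m * p₀ s = 0 := by
    intro s hs
    rw [hz₁ s fun hm => hs ⟨(min_le_left _ _).trans hm.1, hm.2.trans (le_max_left _ _)⟩,
      hz₂ s fun hm => hs ⟨(min_le_right _ _).trans hm.1, hm.2.trans (le_max_right _ _)⟩]
    simp
  have hI : ∫ s, (g s - m * p₀ s) = 0 := by
    rw [integral_sub hgi (hpi.const_mul m), integral_const_mul, hp₀i]; simp [m]
  obtain ⟨P, hP, hPd, hPz⟩ := exists_primitive hq hz hI
  have hPt : tsupport P ⊆ Ioi 0 := by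
    refine (closure_minimal (fun s hs => ?_) isClosed_Icc :
      tsupport P ⊆ Icc (min a₁ a₂) (max b₁ b₂)).trans fun s hs => ?_
    · by_contra hn
      exact hs (hPz s hn)
    · exact lt_of_lt_of_le (lt_min ha₁ ha₂) hs.1
  have h1 := h P hP (hasCompactSupport_of_Icc hPz) hPt
  have hgf := hint g hg hgs hgt
  have hpf := hint p₀ hp₀c hp₀s hp₀t
  have h2 : ∫ s, ((g s : ℂ) * f s - m * ((p₀ s : ℂ) * f s)) = 0 := by
    rw [← h1]
    refine integral_congr_ae (Eventually.of_forall fun s => ?_)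
    simp only [(hPd s).deriv]
    push_cast
    ring
  rw [integral_sub hgf (hpf.const_mul _), integral_const_mul, ← hc] at h2
  have h3 : ∫ s, g s • (f s - c) = ∫ s, ((g s : ℂ) * f s - (g s : ℂ) * c) := by
    refine integral_congr_ae (Eventually.of_forall fun s => ?_)
    simp only [Complex.real_smul]; ring
  have hgc : Integrable fun s => (g s : ℂ) := hgi.ofReal
  rw [h3, integral_sub hgf (hgc.mul_const c), integral_mul_const,
    integral_complex_ofReal]
  exact h2

/-- One derivative is removed by testing with a primitive of `p`. Its support is compact only if the
mean vanishes, so a bump supported in s < 0, invisible to `F` and `B`, is subtracted. Since `p` need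
not vanish at s = 0, no constant of integration appears: the flux 4sF′ is exactly ∫₀ˢ B, which
excludes a logarithm at the origin. -/
lemma integral_first_order_of_weak {F B : ℝ → ℂ} (hF : LocallyIntegrable F)
    (hB : LocallyIntegrable B) (hF0 : ∀ s ≤ 0, F s = 0) (hB0 : ∀ s ≤ 0, B s = 0)
    (hw : ∀ g : ℝ → ℝ, ContDiff ℝ ∞ g → HasCompactSupport g →
      ∫ s, (-(((4 * (s * deriv (deriv g) s + deriv g s) : ℝ) : ℂ) * F s) + (g s : ℂ) * B s) = 0)
    {p : ℝ → ℝ} (hp : ContDiff ℝ ∞ p) (hps : HasCompactSupport p) :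
    ∫ s, (((4 * (s * deriv p s + p s) : ℝ) : ℂ) * F s +
      (p s : ℂ) * ∫ t in (0 : ℝ)..s, B t) = 0 := by
  set φ : ContDiffBump (-2 : ℝ) := ⟨1 / 2, 1, by norm_num, by norm_num⟩ with hφ
  set p₀ : ℝ → ℝ := φ.normed volume with hp₀
  have hp₀c : ContDiff ℝ ∞ p₀ := φ.contDiff_normed
  have hp₀s : HasCompactSupport p₀ := φ.hasCompactSupport_normed
  have hp₀i : ∫ s, p₀ s = 1 := φ.integral_normed
  have hp₀z : ∀ s, -1 < s → p₀ s = 0 := by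
    intro s hs
    by_contra hne
    have h1 : s ∈ Function.support p₀ := hne
    rw [hp₀, φ.support_normed_eq] at h1
    have h2 := (abs_lt.1 (mem_ball_iff_norm.1 h1)).2
    have h3 : φ.rOut = 1 := rfl
    rw [h3] at h2
    linarith
  have hQ0 : ∀ s ≤ 0, ∫ t in (0 : ℝ)..s, B t = 0 := by
    intro s hs
    refine intervalIntegral.integral_zero_ae (Eventually.of_forall fun t ht => hB0 t ?_)
    exact ht.2.trans (max_le le_rfl hs)
  set m := ∫ s, p s
  set q : ℝ → ℝ := fun s => p s - m * p₀ s with hq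
  have hqc : ContDiff ℝ ∞ q := hp.sub (contDiff_const.mul hp₀c)
  obtain ⟨a₁, b₁, _, hz₁⟩ := hasCompactSupport_exists_Icc hps
  obtain ⟨a₂, b₂, _, hz₂⟩ := hasCompactSupport_exists_Icc hp₀s
  have hz : ∀ s, s ∉ Icc (min a₁ a₂) (max b₁ b₂) → q s = 0 := by
    intro s hs
    simp only [hq]
    rw [hz₁ s fun hm => hs ⟨(min_le_left _ _).trans hm.1, hm.2.trans (le_max_left _ _)⟩,
      hz₂ s fun hm => hs ⟨(min_le_right _ _).trans hm.1, hm.2.trans (le_max_right _ _)⟩]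
    simp
  have hqs := hasCompactSupport_of_Icc hz
  have hI : ∫ s, q s = 0 := by
    rw [hq, integral_sub (hp.continuous.integrable_of_hasCompactSupport hps)
      ((hp₀c.continuous.integrable_of_hasCompactSupport hp₀s).const_mul m), integral_const_mul,
      hp₀i]
    simp [m]
  obtain ⟨g, hg, hgd, hgz⟩ := exists_primitive hqc hz hI
  have hgs := hasCompactSupport_of_Icc hgz
  have hdg : deriv g = q := funext fun s => (hgd s).deriv
  have hdq : Continuous (deriv q) := hqc.continuous_deriv (by simp)
  have h1 := hw g hg hgs
  rw [hdg] at h1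
  have hcs : HasCompactSupport fun s => 4 * (s * deriv q s + q s) := by
    refine HasCompactSupport.mul_left (f' := fun s => s * deriv q s + q s) ?_
    exact (hqs.deriv.mul_left).add hqs
  have hi1 := integrable_mul_of_compactSupport hF
    (g := fun s => 4 * (s * deriv q s + q s))
    (continuous_const.mul ((continuous_id.mul hdq).add hqc.continuous)) hcs
  have hi2 := integrable_mul_of_compactSupport hB hg.continuous hgs
  have hQ : Continuous fun s => ∫ t in (0 : ℝ)..s, B t :=
    intervalIntegral.continuous_primitive
      (fun _ _ => intervalIntegrable_of_locallyIntegrable hB _ _) 0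
  have hi3 := integrable_mul_of_compactSupport hQ.locallyIntegrable hqc.continuous hqs
  have hi1n : Integrable fun s => -(((4 * (s * deriv q s + q s) : ℝ) : ℂ) * F s) := hi1.neg
  rw [integral_add hi1n hi2, integral_neg, integral_mul_eq_neg_integral_primitive hB hg hgz,
    hdg] at h1
  have h2 : ∫ s, (((4 * (s * deriv q s + q s) : ℝ) : ℂ) * F s +
      (q s : ℂ) * ∫ t in (0 : ℝ)..s, B t) = 0 := by
    rw [integral_add hi1 hi3]
    linear_combination -h1
  rw [← h2]
  refine integral_congr_ae (Eventually.of_forall fun s => ?_)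
  simp only
  rcases le_or_gt s 0 with hs | hs
  · rw [hF0 s hs, hQ0 s hs]; simp
  · have hev : q =ᶠ[𝓝 s] p := by
      filter_upwards [Ioi_mem_nhds (show (-1 : ℝ) < s by linarith)] with t ht
      simp only [hq]
      rw [hp₀z t ht]; simp
    rw [hev.deriv_eq, hev.eq_of_nhds]

/-- If `4 (s F')' = B` as distributions on the line, `F` and `B` vanishing for `s ≤ 0`, then
`4 s F' = ∫₀ˢ B`. -/
lemma exists_ode_of_weak {F B : ℝ → ℂ} (hF : LocallyIntegrable F)
    (hB : LocallyIntegrable B) (hF0 : ∀ s ≤ 0, F s = 0) (hB0 : ∀ s ≤ 0, B s = 0)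
    (hw : ∀ g : ℝ → ℝ, ContDiff ℝ ∞ g → HasCompactSupport g →
      ∫ s, (-(((4 * (s * deriv (deriv g) s + deriv g s) : ℝ) : ℂ) * F s) + (g s : ℂ) * B s) = 0) :
    ∃ G : ℝ → ℂ, (∀ s, 0 < s → HasDerivAt G ((∫ t in (0 : ℝ)..s, B t) / (4 * s)) s) ∧
      ∀ᵐ s : ℝ, 0 < s → F s = G s := by
  set Q : ℝ → ℂ := fun s => ∫ t in (0 : ℝ)..s, B t with hQdef
  have hQ : Continuous Q :=
    intervalIntegral.continuous_primitive
      (fun _ _ => intervalIntegrable_of_locallyIntegrable hB _ _) 0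
  have hcont : ContinuousOn (fun s : ℝ => Q s / (4 * s)) (Ioi 0) := by
    refine hQ.continuousOn.div (by fun_prop) fun s hs => ?_
    have : (s : ℂ) ≠ 0 := by exact_mod_cast (mem_Ioi.1 hs).ne'
    simpa using this
  set T : ℝ → ℂ := fun s => ∫ t in (1 : ℝ)..s, Q t / (4 * t) with hT
  have hTd : ∀ s, 0 < s → HasDerivAt T (Q s / (4 * s)) s := by
    intro s hs
    refine intervalIntegral.integral_hasDerivAt_right ?_ ?_ (hcont.continuousAt (Ioi_mem_nhds hs))
    · refine (hcont.mono fun t ht => ?_).intervalIntegrable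
      exact lt_of_lt_of_le (lt_min one_pos hs) ht.1
    · exact hcont.stronglyMeasurableAtFilter isOpen_Ioi s hs
  have hTc : ContinuousOn T (Ioi 0) := fun s hs => (hTd s hs).continuousAt.continuousWithinAt
  have hloc : LocallyIntegrableOn (fun s => F s - T s) (Ioi 0) :=
    (hF.locallyIntegrableOn _).sub (hTc.locallyIntegrableOn measurableSet_Ioi)
  suffices hmain : ∀ P : ℝ → ℝ, ContDiff ℝ ∞ P → HasCompactSupport P → tsupport P ⊆ Ioi 0 →
      ∫ s, ((deriv P s : ℝ) : ℂ) * (F s - T s) = 0 by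
    obtain ⟨c, hc⟩ := ae_eq_const_of_integral_deriv_eq_zero hloc hmain
    refine ⟨fun s => T s + c, fun s hs => (hTd s hs).add_const c, ?_⟩
    filter_upwards [hc] with s hs h0
    rw [← hs h0]; ring
  intro P hP hPs hPt
  obtain ⟨a, b, ha, hab, hz⟩ := exists_Icc_of_tsupport_subset hPs hPt
  have hPd : ∀ s, HasDerivAt P (deriv P s) s := fun s =>
    (hP.differentiable (by simp) s).hasDerivAt
  have hPdc : Continuous (deriv P) := hP.continuous_deriv (by simp)
  have hz' : ∀ s, s ∉ Icc a b → deriv P s = 0 := by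
    intro s hs
    have : P =ᶠ[𝓝 s] fun _ => 0 := by
      filter_upwards [isClosed_Icc.isOpen_compl.mem_nhds hs] with t ht
      exact hz t ht
    rw [this.deriv_eq]; simp
  -- the test function `P(s) / s`
  have hpc : ContDiff ℝ ∞ fun s => P s / s := by
    rw [contDiff_iff_contDiffAt]
    intro s
    rcases lt_or_ge s a with h | h
    · have : (fun s => P s / s) =ᶠ[𝓝 s] fun _ => 0 := by
        filter_upwards [Iio_mem_nhds h] with t ht
        rw [hz t fun hm => absurd hm.1 (not_le.2 ht)]; simp
      exact contDiffAt_const.congr_of_eventuallyEq this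
    · exact hP.contDiffAt.div contDiffAt_id (by simp; linarith)
  have hps : HasCompactSupport fun s => P s / s :=
    hasCompactSupport_of_Icc (a := a) (b := b) fun s hs => by rw [hz s hs]; simp
  have h1 := integral_first_order_of_weak hF hB hF0 hB0 hw hpc hps
  -- The product rule gives s(P/s)′ + P/s = P′, so this test function isolates the distributional
  -- derivative of F.
  have h2 : ∀ s, ((4 * (s * deriv (fun s => P s / s) s + P s / s) : ℝ) : ℂ) * F s =
      4 * (((deriv P s : ℝ) : ℂ) * F s) := by
    intro s
    rcases le_or_gt s 0 with hs | hs
    · rw [hF0 s hs]; simp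
    · have : HasDerivAt (fun s => P s / s) ((deriv P s * s - P s * 1) / s ^ 2) s :=
        (hPd s).div (hasDerivAt_id s) hs.ne'
      rw [this.deriv, ← mul_assoc]
      congr 1
      rw [← Complex.ofReal_ofNat, ← Complex.ofReal_mul]
      congr 1
      field_simp
      ring
  have hsub : ∀ {f : ℝ → ℂ}, (∀ s, s ∉ Icc a b → f s = 0) →
      Function.support f ⊆ Ioc (a / 2) (b + 1) := by
    intro f hf s hs
    have : s ∈ Icc a b := by
      by_contra hn
      exact hs (hf s hn)
    exact ⟨by linarith [this.1], by linarith [this.2]⟩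
  have hpos : ∀ s ∈ uIcc (a / 2) (b + 1), 0 < s := by
    intro s hs
    rw [uIcc_of_le (by linarith)] at hs
    linarith [hs.1]
  -- Here Q/s = 4T′, so the flux term is integrated by parts and F can be compared with T.
  have h3 : ∫ s, ((P s / s : ℝ) : ℂ) * Q s = -(4 * ∫ s, ((deriv P s : ℝ) : ℂ) * T s) := by
    rw [← intervalIntegral.integral_eq_integral_of_support_subset
        (hsub (f := fun s => ((P s / s : ℝ) : ℂ) * Q s) fun s hs => by simp [hz s hs]),
      ← intervalIntegral.integral_eq_integral_of_support_subset
        (hsub (f := fun s => ((deriv P s : ℝ) : ℂ) * T s) fun s hs => by simp [hz' s hs])]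
    have key := intervalIntegral.integral_mul_deriv_eq_deriv_mul (a := a / 2) (b := b + 1)
      (u := fun s => (P s : ℂ)) (u' := fun s => ((deriv P s : ℝ) : ℂ)) (v := T)
      (v' := fun s => Q s / (4 * s)) (fun s _ => (hPd s).ofReal_comp)
      (fun s hs => hTd s (hpos s hs))
      ((Complex.continuous_ofReal.comp hPdc).intervalIntegrable _ _)
      (hcont.mono fun s hs => hpos s hs).intervalIntegrable
    rw [hz (b + 1) fun hm => by linarith [hm.2], hz (a / 2) fun hm => by linarith [hm.1]] at key
    simp only [Complex.ofReal_zero, zero_mul, sub_zero, zero_sub] at key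
    rw [← mul_neg, ← key, ← intervalIntegral.integral_const_mul]
    refine intervalIntegral.integral_congr fun s hs => ?_
    have hs0 : (s : ℂ) ≠ 0 := by exact_mod_cast (hpos s hs).ne'
    push_cast
    field_simp
  have hi1 := integrable_mul_of_compactSupport hF hPdc hPs.deriv
  have hi2 := integrable_mul_of_compactSupport hQ.locallyIntegrable hpc.continuous hps
  have hi3 : Integrable fun s => ((deriv P s : ℝ) : ℂ) * T s := by
    refine (integrableOn_iff_integrable_of_support_subset
      (hsub (f := fun s => ((deriv P s : ℝ) : ℂ) * T s) fun s hs => by simp [hz' s hs])).1 ?_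
    have : ContinuousOn (fun s => ((deriv P s : ℝ) : ℂ) * T s) (uIcc (a / 2) (b + 1)) :=
      (Complex.continuous_ofReal.comp hPdc).continuousOn.mul
        (hTc.mono fun s hs => hpos s hs)
    exact (this.integrableOn_compact isCompact_uIcc).mono_set
      (uIcc_of_le (show a / 2 ≤ b + 1 by linarith) ▸ Ioc_subset_Icc_self)
  have h4 : ∫ s, (4 * (((deriv P s : ℝ) : ℂ) * F s) + ((P s / s : ℝ) : ℂ) * Q s) = 0 := by
    rw [← h1]
    exact integral_congr_ae (Eventually.of_forall fun s => by simp only [h2 s, hQdef])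
  rw [integral_add (hi1.const_mul 4) hi2, integral_const_mul, h3] at h4
  simp only [mul_sub]
  rw [integral_sub hi1 hi3]
  linear_combination (1 / 4) * h4

/-! ### The ordinary differential equation of a radial solution -/

/-- `F` and `Q = 4 s F'` solve the radial equation in the variable `s = r²`, with constant `κ` for
`s < σ` and `z` for `s > σ`, and the solution is regular at the origin. -/
structure IsRadialProfile (σ : ℝ) (κ z : ℂ) (F Q : ℝ → ℂ) : Prop where
  hasDerivAt_fst : ∀ s, 0 < s → HasDerivAt F (Q s / (4 * s)) s
  continuous_snd : Continuous Q
  snd_zero : Q 0 = 0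
  hasDerivAt_inner : ∀ s, 0 < s → s < σ → HasDerivAt Q (-κ * F s) s
  hasDerivAt_outer : ∀ s, σ < s → HasDerivAt Q (-z * F s) s

lemma IsSolution.aestronglyMeasurable {V : ℂ → ℝ} {z : ℂ} {u : ℂ → ℂ} (h : IsSolution V z u) :
    AEStronglyMeasurable u := by
  rw [← Measure.restrict_univ (μ := (volume : Measure ℂ)), ← Metric.iUnion_closedBall_nat (0 : ℂ),
    aestronglyMeasurable_iUnion_iff]
  exact fun n => (h.1 _ (isCompact_closedBall 0 n)).1

lemma IsSolution.locallyIntegrable_profile {V : ℂ → ℝ} {z : ℂ} {u : ℂ → ℂ} (h : IsSolution V z u)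
    {f : ℝ → ℂ} (hf : StronglyMeasurable f) (huf : ∀ᵐ x : ℂ, u x = f (‖x‖ ^ 2)) :
    LocallyIntegrable (indicator (Ioi 0) f) := by
  rw [locallyIntegrable_iff]
  intro K hK
  obtain ⟨R, hR⟩ := hK.isBounded.subset_closedBall 0
  have hKR : K ⊆ Iic (|R| ^ 2 + 1) := by
    intro s hs
    have h1 := hR hs
    rw [mem_closedBall_zero_iff, Real.norm_eq_abs] at h1
    have h2 := le_abs_self s
    have h3 := le_abs_self R
    exact mem_Iic.2 (by nlinarith [sq_nonneg (|R| - 1 / 2)])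
  refine IntegrableOn.mono_set ?_ hKR
  set M := |R| ^ 2 + 1
  have hM : 0 ≤ M := by positivity
  have hball : IsCompact (Metric.closedBall (0 : ℂ) (√M)) := isCompact_closedBall _ _
  have : IsFiniteMeasure ((volume : Measure ℂ).restrict (Metric.closedBall 0 (√M))) :=
    ⟨by rw [Measure.restrict_apply_univ]; exact hball.measure_lt_top⟩
  have h1 : IntegrableOn u (Metric.closedBall 0 (√M)) :=
    (h.1 _ hball).integrable (by norm_num)
  rw [← integrable_indicator_iff measurableSet_closedBall] at h1
  have h2 : Integrable fun x : ℂ => (Iic M).indicator f (‖x‖ ^ 2) := by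
    refine h1.congr ?_
    filter_upwards [huf] with x hx
    by_cases hm : ‖x‖ ^ 2 ≤ M
    · rw [indicator_of_mem (mem_Iic.2 hm), indicator_of_mem, hx]
      rw [mem_closedBall_zero_iff]
      exact Real.le_sqrt_of_sq_le hm
    · rw [indicator_of_notMem (s := Iic M) (by simpa using hm), indicator_of_notMem]
      rw [mem_closedBall_zero_iff]
      exact fun hc => hm ((Real.le_sqrt (norm_nonneg _) hM).1 hc)
  rw [integrable_comp_norm_sq_iff (hf.indicator measurableSet_Iic).aestronglyMeasurable,
    ← integrable_indicator_iff measurableSet_Ioi, indicator_indicator] at h2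
  rw [← integrable_indicator_iff measurableSet_Iic, indicator_indicator, inter_comm]
  exact h2

lemma hasDerivAt_intervalIntegral_of_ae_eq {B B' : ℝ → ℂ} (hB : LocallyIntegrable B)
    (he : ∀ᵐ t : ℝ, B t = B' t) {s : ℝ} (hc : ContinuousAt B' s) :
    HasDerivAt (fun s => ∫ t in (0 : ℝ)..s, B t) (B' s) s := by
  have hB' : LocallyIntegrable B' := fun t =>
    let ⟨U, hU, hi⟩ := hB t
    ⟨U, hU, hi.congr (ae_restrict_of_ae he)⟩
  have e : (fun s => ∫ t in (0 : ℝ)..s, B t) = fun s => ∫ t in (0 : ℝ)..s, B' t := by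
    funext s
    exact intervalIntegral.integral_congr_ae (he.mono fun t ht _ => ht)
  rw [e]
  exact intervalIntegral.integral_hasDerivAt_right (intervalIntegrable_of_locallyIntegrable hB' _ _)
    hB'.aestronglyMeasurable.stronglyMeasurableAtFilter hc

/-- Testing with functions g(‖x‖²) reduces the equation to the half line, since Lebesgue measure on
the plane becomes π ds. These test functions may be nonzero at the origin, which is why the profile
obtained is regular there. -/
lemma IsSolution.exists_isRadialProfile {ρ asq : ℝ} (hρ : 0 < ρ) {z : ℂ} {u : ℂ → ℂ}
    (hr : IsRadial u) (h : IsSolution (circularWell ρ asq) z u) :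
    ∃ F Q : ℝ → ℂ, IsRadialProfile (ρ ^ 2) (asq + z) z F Q ∧ ∀ᵐ x : ℂ, u x = F (‖x‖ ^ 2) := by
  classical
  obtain ⟨f, hfm, huf⟩ := hr.exists_profile h.aestronglyMeasurable
  set F₀ := indicator (Ioi 0) f with hF₀
  set q : ℝ → ℂ := fun s => (if s ≤ ρ ^ 2 then -(asq : ℂ) else 0) - z with hq
  have hqm : Measurable q :=
    (Measurable.ite measurableSet_Iic measurable_const measurable_const).sub_const z
  have hqb : ∀ s, ‖q s‖ ≤ |asq| + ‖z‖ := by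
    intro s
    refine (norm_sub_le _ _).trans ?_
    gcongr
    split_ifs
    · rw [norm_neg, Complex.norm_real, Real.norm_eq_abs]
    · simp
  have hF : LocallyIntegrable F₀ := h.locallyIntegrable_profile hfm huf
  set B : ℝ → ℂ := fun s => q s * F₀ s with hB
  have hBl : LocallyIntegrable B := fun t =>
    let ⟨U, hU, hi⟩ := hF t
    ⟨U, hU, hi.bdd_mul hqm.aestronglyMeasurable (Eventually.of_forall hqb)⟩
  have hF0 : ∀ s ≤ 0, F₀ s = 0 := fun s hs =>
    indicator_of_notMem (by simpa using hs) _
  have hB0 : ∀ s ≤ 0, B s = 0 := fun s hs => by simp only [hB, hF0 s hs, mul_zero]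
  have hw : ∀ g : ℝ → ℝ, ContDiff ℝ ∞ g → HasCompactSupport g →
      ∫ s, (-(((4 * (s * deriv (deriv g) s + deriv g s) : ℝ) : ℂ) * F₀ s) + (g s : ℂ) * B s) =
        0 := by
    intro g hg hgs
    have hg1 : ∀ s, HasDerivAt g (deriv g s) s := fun s =>
      (hg.differentiable (by simp) s).hasDerivAt
    have hdg : ContDiff ℝ ∞ (deriv g) := (contDiff_infty_iff_deriv.1 hg).2
    have hg2 : ∀ s, HasDerivAt (deriv g) (deriv (deriv g) s) s := fun s =>
      (hdg.differentiable (by simp) s).hasDerivAt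
    have hddg : Continuous (deriv (deriv g)) := hdg.continuous_deriv (by simp)
    have hgC : ContDiff ℝ ∞ fun s => (g s : ℂ) := Complex.ofRealCLM.contDiff.comp hg
    have hφ : ContDiff ℝ ∞ fun x : ℂ => (g (‖x‖ ^ 2) : ℂ) :=
      hgC.comp (contDiff_norm_sq ℝ)
    have hφs : HasCompactSupport fun x : ℂ => (g (‖x‖ ^ 2) : ℂ) := by
      obtain ⟨a, b, _, hz⟩ := hasCompactSupport_exists_Icc hgs
      refine HasCompactSupport.intro (isCompact_closedBall (0 : ℂ) (√b)) fun x hx => ?_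
      rw [hz, Complex.ofReal_zero]
      intro hm
      exact hx (mem_closedBall_zero_iff.2 (Real.le_sqrt_of_sq_le hm.2))
    have key := h.2 _ hφ hφs
    set H : ℝ → ℂ := fun s =>
      f s * (-(4 * (s : ℂ) * ((deriv (deriv g) s : ℝ) : ℂ) + 4 * ((deriv g s : ℝ) : ℂ)) +
        q s * (g s : ℂ)) with hH
    have hHm : AEStronglyMeasurable H (volume.restrict (Ioi 0)) := by
      refine (hfm.aestronglyMeasurable).mul (Measurable.aestronglyMeasurable ?_)
      have m1 := hddg.measurable
      have m2 := hdg.continuous.measurable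
      have m3 := hg.continuous.measurable
      fun_prop
    have h1 : ∫ x : ℂ, H (‖x‖ ^ 2) = 0 := by
      rw [← key]
      refine integral_congr_ae ?_
      filter_upwards [huf] with x hx
      rw [laplacian_comp_norm_sq (g := fun s => (g s : ℂ)) (fun s => (hg1 s).ofReal_comp)
        (fun s => (hg2 s).ofReal_comp) (hgC.of_le (by norm_cast))]
      have hV : ((circularWell ρ asq x : ℝ) : ℂ) - z = q (‖x‖ ^ 2) := by
        simp only [circularWell, hq]
        have : ‖x‖ ≤ ρ ↔ ‖x‖ ^ 2 ≤ ρ ^ 2 := by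
          rw [sq_le_sq₀ (norm_nonneg x) hρ.le]
        by_cases hc : ‖x‖ ≤ ρ
        · rw [if_pos hc, if_pos (this.1 hc)]; push_cast; ring
        · rw [if_neg hc, if_neg (fun h' => hc (this.2 h'))]; push_cast; ring
      rw [hV, hx]
    rw [integral_comp_norm_sq hHm] at h1
    have hpi : (Real.pi : ℂ) ≠ 0 := by exact_mod_cast Real.pi_ne_zero
    have h2 := (mul_eq_zero.1 h1).resolve_left hpi
    rw [← integral_indicator measurableSet_Ioi] at h2
    rw [← h2]
    refine integral_congr_ae (Eventually.of_forall fun s => ?_)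
    by_cases hs : 0 < s
    · simp only [hB, hF₀]
      rw [indicator_of_mem (mem_Ioi.2 hs), indicator_of_mem (mem_Ioi.2 hs), hH]
      push_cast
      ring
    · simp only [hB0 s (not_lt.1 hs), hF0 s (not_lt.1 hs), mul_zero, neg_zero, add_zero]
      rw [indicator_of_notMem (by simpa using hs)]
  obtain ⟨G, hGd, hGe⟩ := exists_ode_of_weak hF hBl hF0 hB0 hw
  set Q : ℝ → ℂ := fun s => ∫ t in (0 : ℝ)..s, B t with hQ
  have hBe : ∀ᵐ t : ℝ, B t = indicator (Ioi 0) (fun s => q s * G s) t := by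
    filter_upwards [hGe] with t ht
    by_cases h0 : 0 < t
    · rw [indicator_of_mem (mem_Ioi.2 h0), ← ht h0]
    · rw [indicator_of_notMem (by simpa using h0), hB0 t (not_lt.1 h0)]
  -- The flux is a primitive of a function known only almost everywhere. Where the potential is
  -- locally constant that function has a continuous representative, so the flux is differentiable
  -- there; only the edge of the well is left out.
  have hQd : ∀ s, 0 < s → ∀ c : ℂ, (∀ᶠ t in 𝓝 s, q t = c) → HasDerivAt Q (c * G s) s := by
    intro s hs c hqc
    have hev : indicator (Ioi 0) (fun s => q s * G s) =ᶠ[𝓝 s] fun t => c * G t := by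
      filter_upwards [hqc, Ioi_mem_nhds hs] with t ht ht0
      rw [indicator_of_mem ht0, ht]
    have hca : ContinuousAt (indicator (Ioi 0) (fun s => q s * G s)) s :=
      ((hGd s hs).continuousAt.const_mul c).congr hev.symm
    have := hasDerivAt_intervalIntegral_of_ae_eq hBl hBe hca
    rwa [hev.eq_of_nhds] at this
  refine ⟨G, Q, ⟨hGd, ?_, by simp [hQ], fun s hs hs2 => ?_, fun s hs => ?_⟩, ?_⟩
  · exact intervalIntegral.continuous_primitive
      (fun _ _ => intervalIntegrable_of_locallyIntegrable hBl _ _) 0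
  · refine hQd s hs _ ?_
    filter_upwards [Iio_mem_nhds hs2] with t ht
    simp only [hq]
    rw [if_pos (le_of_lt ht)]; ring
  · refine hQd s ((sq_pos_of_pos hρ).trans hs) _ ?_
    filter_upwards [Ioi_mem_nhds hs] with t ht
    simp only [hq]
    rw [if_neg (not_le.2 ht)]; ring
  · have h1 : ∀ᵐ s : ℝ, 0 < s → f s = G s := by
      filter_upwards [hGe] with s hs h0
      rw [← hs h0, hF₀, indicator_of_mem (mem_Ioi.2 h0)]
    filter_upwards [huf, ae_norm_sq_of_ae h1] with x hx hx2
    rw [hx, hx2]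

/-! ### Wronskians -/

/-- `F' = Q / (4 s)` and `Q' = -c F` at `s`. -/
def IsPairAt (c : ℂ) (F Q : ℝ → ℂ) (s : ℝ) : Prop :=
  HasDerivAt F (Q s / (4 * s)) s ∧ HasDerivAt Q (-c * F s) s

/-- The Wronskian of two pairs. -/
def wronskian (F Q G R : ℝ → ℂ) (s : ℝ) : ℂ := F s * R s - Q s * G s

lemma exists_wronskian_const {c : ℂ} {F Q G R : ℝ → ℂ} {U : Set ℝ} (hU : IsOpen U)
    (hU' : IsPreconnected U) (h1 : ∀ s ∈ U, IsPairAt c F Q s) (h2 : ∀ s ∈ U, IsPairAt c G R s) :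
    ∃ w : ℂ, ∀ s ∈ U, wronskian F Q G R s = w := by
  have hd : ∀ s ∈ U, HasDerivAt (wronskian F Q G R) 0 s := by
    intro s hs
    refine (((h1 s hs).1.mul (h2 s hs).2).sub ((h1 s hs).2.mul (h2 s hs).1)).congr_deriv ?_
    ring
  exact hU.exists_is_const_of_deriv_eq_zero hU'
    (fun s hs => (hd s hs).differentiableAt.differentiableWithinAt) fun s hs => (hd s hs).deriv

/-- The regular solution. -/
def regF (c : ℂ) (s : ℝ) : ℂ := bj (c * s / 4)
/-- `4 s` times the derivative of the regular solution. -/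
def regQ (c : ℂ) (s : ℝ) : ℂ := c * s * bj' (c * s / 4)
/-- The logarithmic solution, plus a multiple of the regular one. -/
def logF (c C : ℂ) (s : ℝ) : ℂ := ((Real.log s : ℂ) / 2 + C) * bj (c * s / 4) - bn (c * s / 4)
/-- `4 s` times the derivative of the logarithmic solution. -/
def logQ (c C : ℂ) (s : ℝ) : ℂ :=
  2 * bj (c * s / 4) +
    c * s * (((Real.log s : ℂ) / 2 + C) * bj' (c * s / 4) - bn' (c * s / 4))

lemma hasDerivAt_comp_scale {f : ℂ → ℂ} {f' : ℂ} (c : ℂ) (s : ℝ)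
    (hf : HasDerivAt f f' (c * s / 4)) :
    HasDerivAt (fun s : ℝ => f (c * s / 4)) (f' * (c / 4)) s := by
  have h1 : HasDerivAt (fun s : ℝ => c * (s : ℂ) / 4) (c / 4) s := by
    have := ((hasDerivAt_id s).ofReal_comp.const_mul c).div_const 4
    simpa using this
  exact hf.comp s h1

lemma hasDerivAt_mul_ofReal (c : ℂ) (s : ℝ) : HasDerivAt (fun s : ℝ => c * (s : ℂ)) c s := by
  simpa using (hasDerivAt_id s).ofReal_comp.const_mul c

lemma isPairAt_reg (c : ℂ) {s : ℝ} (hs : 0 < s) : IsPairAt c (regF c) (regQ c) s := by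
  have hs' : (s : ℂ) ≠ 0 := by exact_mod_cast hs.ne'
  constructor
  · refine (hasDerivAt_comp_scale c s (hasDerivAt_bj _)).congr_deriv ?_
    rw [regQ]; field_simp
  · refine ((hasDerivAt_mul_ofReal c s).mul
      (hasDerivAt_comp_scale c s (hasDerivAt_bj' _))).congr_deriv ?_
    rw [regF]
    linear_combination c * bj_ode (c * s / 4)

lemma isPairAt_log (c C : ℂ) {s : ℝ} (hs : 0 < s) : IsPairAt c (logF c C) (logQ c C) s := by
  have hs' : (s : ℂ) ≠ 0 := by exact_mod_cast hs.ne'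
  have hlog : HasDerivAt (fun s : ℝ => (Real.log s : ℂ) / 2 + C) ((s : ℂ)⁻¹ / 2) s := by
    have := ((Real.hasDerivAt_log hs.ne').ofReal_comp.div_const 2).add_const C
    simpa using this
  constructor
  · refine ((hlog.mul (hasDerivAt_comp_scale c s (hasDerivAt_bj _))).sub
      (hasDerivAt_comp_scale c s (hasDerivAt_bn _))).congr_deriv ?_
    rw [logQ]; field_simp; ring
  · refine (((hasDerivAt_comp_scale c s (hasDerivAt_bj _)).const_mul 2).add
      ((hasDerivAt_mul_ofReal c s).mul ((hlog.mul
        (hasDerivAt_comp_scale c s (hasDerivAt_bj' _))).sub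
      (hasDerivAt_comp_scale c s (hasDerivAt_bn' _))))).congr_deriv ?_
    have e1 : bj'' (c * s / 4) * (c * s / 4) = -bj' (c * s / 4) - bj (c * s / 4) := by
      linear_combination bj_ode (c * s / 4)
    have e2 : bn'' (c * s / 4) * (c * s / 4) =
        bj' (c * s / 4) - bn' (c * s / 4) - bn (c * s / 4) := by
      linear_combination bn_ode (c * s / 4)
    have e3 : (s : ℂ) * (s : ℂ)⁻¹ = 1 := mul_inv_cancel₀ hs'
    rw [logF]
    simp only [Pi.sub_apply, Pi.mul_apply]
    linear_combination (c * ((Real.log s : ℂ) / 2 + C)) * e1 - c * e2 +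
      c * bj' (c * s / 4) / 2 * e3

/-- The logarithms cancel in the Wronskian, so its constant value can be read off at s = 0, where it
is 2 · bj(0)² = 2. -/
lemma wronskian_reg_log (c : ℂ) {s : ℝ} (hs : 0 < s) :
    wronskian (regF c) (regQ c) (logF c 0) (logQ c 0) s = 2 := by
  obtain ⟨w, hw⟩ := exists_wronskian_const (c := c) isOpen_Ioi (isPreconnected_Ioi (a := (0 : ℝ)))
    (fun s hs => isPairAt_reg c hs) fun s hs => isPairAt_log c 0 hs
  have hform : ∀ s : ℝ, wronskian (regF c) (regQ c) (logF c 0) (logQ c 0) s =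
      2 * bj (c * s / 4) ^ 2 + c * s * (bj' (c * s / 4) * bn (c * s / 4) -
        bj (c * s / 4) * bn' (c * s / 4)) := by
    intro s
    rw [wronskian, regF, regQ, logF, logQ]; ring
  have hc : Continuous fun s : ℝ => 2 * bj (c * s / 4) ^ 2 + c * s *
      (bj' (c * s / 4) * bn (c * s / 4) - bj (c * s / 4) * bn' (c * s / 4)) := by
    have h1 := continuous_bj
    have h2 := continuous_bj'
    have h3 := continuous_bn
    have h4 := continuous_bn'
    fun_prop
  have ht := (hc.tendsto 0).mono_left (nhdsWithin_le_nhds (s := Ioi 0))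
  have h0 : (2 : ℂ) * bj (c * (0 : ℝ) / 4) ^ 2 + c * (0 : ℝ) * (bj' (c * (0 : ℝ) / 4) *
      bn (c * (0 : ℝ) / 4) - bj (c * (0 : ℝ) / 4) * bn' (c * (0 : ℝ) / 4)) = 2 := by
    simp [bj_zero]
  rw [h0] at ht
  have hw2 : w = 2 := by
    refine tendsto_nhds_unique (tendsto_const_nhds.congr' ?_) ht
    filter_upwards [self_mem_nhdsWithin] with s hs
    rw [← hform s, hw s hs]
  rw [hw s hs, hw2]

/-! ### Matching of radial profiles at the edge of the well -/

namespace IsRadialProfile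

variable {σ : ℝ} {κ z : ℂ} {F Q : ℝ → ℂ}

lemma continuousAt_fst (h : IsRadialProfile σ κ z F Q) {s : ℝ} (hs : 0 < s) : ContinuousAt F s :=
  (h.hasDerivAt_fst s hs).continuousAt

/-- The flux is bounded by M near 0, so |F′| ≤ M/(4s) on [s, δ] and s|F(s)| ≤ s|F(δ)| + Mδ/4. The
number δ is fixed small before s tends to 0. -/
lemma tendsto_mul_fst (h : IsRadialProfile σ κ z F Q) :
    Tendsto (fun s : ℝ => (s : ℂ) * F s) (𝓝[>] 0) (𝓝 0) := by
  obtain ⟨M, hM⟩ := (isCompact_Icc (a := (0 : ℝ)) (b := 1)).exists_bound_of_continuousOn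
    h.continuous_snd.continuousOn
  have hM0 : 0 ≤ M := (norm_nonneg _).trans (hM 0 (by simp))
  rw [Metric.tendsto_nhds]
  intro ε hε
  obtain ⟨δ, hδ0, hδ1, hδ⟩ : ∃ δ : ℝ, 0 < δ ∧ δ ≤ 1 ∧ M * δ < ε := by
    refine ⟨min 1 (ε / (M + 1)), by positivity, min_le_left _ _, ?_⟩
    calc M * min 1 (ε / (M + 1)) ≤ M * (ε / (M + 1)) := by gcongr; exact min_le_right _ _
      _ < ε := by
        rw [mul_div_assoc', div_lt_iff₀ (by positivity)]; nlinarith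
  have hlim : Tendsto (fun s : ℝ => s * ‖F δ‖ + M / 4 * δ) (𝓝[>] 0) (𝓝 (0 * ‖F δ‖ + M / 4 * δ)) :=
    ((Continuous.tendsto (by fun_prop) 0).mono_left nhdsWithin_le_nhds)
  have hlt : 0 * ‖F δ‖ + M / 4 * δ < ε := by nlinarith [mul_nonneg hM0 hδ0.le]
  filter_upwards [hlim.eventually_lt_const hlt, Ioo_mem_nhdsGT hδ0] with s hs hsm
  have hs0 : 0 < s := hsm.1
  have hb := Convex.norm_image_sub_le_of_norm_hasDerivWithin_le (f := F)
    (f' := fun t => Q t / (4 * t)) (C := M / (4 * s)) (s := Icc s δ) (x := δ) (y := s)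
    (fun t ht => (h.hasDerivAt_fst t (hs0.trans_le ht.1)).hasDerivWithinAt) (fun t ht => ?_)
    (convex_Icc _ _) ⟨hsm.2.le, le_rfl⟩ ⟨le_rfl, hsm.2.le⟩
  · rw [dist_zero_right, norm_mul, Complex.norm_real, Real.norm_of_nonneg hs0.le]
    refine lt_of_le_of_lt ?_ hs
    have h1 : ‖F s‖ ≤ ‖F δ‖ + M / (4 * s) * ‖s - δ‖ := by
      calc ‖F s‖ = ‖F δ + (F s - F δ)‖ := by ring_nf
        _ ≤ ‖F δ‖ + ‖F s - F δ‖ := norm_add_le _ _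
        _ ≤ _ := by gcongr
    have h2 : ‖s - δ‖ ≤ δ := by
      rw [Real.norm_eq_abs, abs_le]; constructor <;> linarith [hsm.2]
    calc s * ‖F s‖ ≤ s * (‖F δ‖ + M / (4 * s) * δ) := by
          gcongr; exact h1.trans (by gcongr)
      _ = _ := by field_simp
  · have ht0 : 0 < t := hs0.trans_le ht.1
    rw [norm_div, norm_mul, Complex.norm_real, Real.norm_of_nonneg ht0.le]
    have hQ := hM t ⟨ht0.le, ht.2.trans hδ1⟩
    have h4 : ‖(4 : ℂ)‖ = 4 := by simp
    rw [h4]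
    gcongr
    exact ht.1

lemma wronskian_inner_eq (h : IsRadialProfile σ κ z F Q) {G R : ℝ → ℂ}
    (hG : ∀ s, 0 < s → IsPairAt κ G R s) {s : ℝ} (hs : 0 < s) (hsσ : s < σ) :
    wronskian F Q G R s = wronskian F Q G R σ := by
  have hσ : 0 < σ := hs.trans hsσ
  obtain ⟨w, hw⟩ := exists_wronskian_const (c := κ) isOpen_Ioo (isPreconnected_Ioo (a := (0 : ℝ))
    (b := σ)) (fun t ht => ⟨h.hasDerivAt_fst t ht.1, h.hasDerivAt_inner t ht.1 ht.2⟩)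
    fun t ht => hG t ht.1
  have hc : ContinuousAt (wronskian F Q G R) σ :=
    ((h.continuousAt_fst hσ).mul (hG σ hσ).2.continuousAt).sub
      (h.continuous_snd.continuousAt.mul (hG σ hσ).1.continuousAt)
  rw [hw s ⟨hs, hsσ⟩]
  refine tendsto_nhds_unique (tendsto_const_nhds.congr' ?_)
    (hc.tendsto.mono_left (nhdsWithin_le_nhds (s := Iio σ)))
  filter_upwards [Ioo_mem_nhdsLT hσ] with t ht
  rw [hw t ht]

lemma wronskian_outer_eq (h : IsRadialProfile σ κ z F Q) (hσ : 0 < σ) {G R : ℝ → ℂ}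
    (hG : ∀ s, 0 < s → IsPairAt z G R s) {s : ℝ} (hs : σ < s) :
    wronskian F Q G R s = wronskian F Q G R σ := by
  obtain ⟨w, hw⟩ := exists_wronskian_const (c := z) isOpen_Ioi (isPreconnected_Ioi (a := σ))
    (fun t ht => ⟨h.hasDerivAt_fst t (hσ.trans ht), h.hasDerivAt_outer t ht⟩)
    fun t ht => hG t (hσ.trans ht)
  have hc : ContinuousAt (wronskian F Q G R) σ :=
    ((h.continuousAt_fst hσ).mul (hG σ hσ).2.continuousAt).sub
      (h.continuous_snd.continuousAt.mul (hG σ hσ).1.continuousAt)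
  rw [hw s hs]
  refine tendsto_nhds_unique (tendsto_const_nhds.congr' ?_)
    (hc.tendsto.mono_left (nhdsWithin_le_nhds (s := Ioi σ)))
  filter_upwards [self_mem_nhdsWithin] with t ht
  rw [hw t ht]

/-- Inside the well the solution is proportional to the regular one. -/
lemma wronskian_reg_eq_zero (h : IsRadialProfile σ κ z F Q) (hσ : 0 < σ) :
    wronskian F Q (regF κ) (regQ κ) σ = 0 := by
  have hconst : ∀ s, 0 < s → s < σ →
      wronskian F Q (regF κ) (regQ κ) s = wronskian F Q (regF κ) (regQ κ) σ :=
    fun s hs hsσ => h.wronskian_inner_eq (fun t ht => isPairAt_reg κ ht) hs hsσ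
  have hc1 : Continuous fun s : ℝ => κ * bj' (κ * s / 4) := by
    have := continuous_bj'
    fun_prop
  have hc2 : Continuous fun s : ℝ => Q s * bj (κ * s / 4) := by
    have := continuous_bj
    have := h.continuous_snd
    fun_prop
  -- As s → 0 both terms of the Wronskian vanish: sF → 0 and Q(0) = 0. Its constant value inside the
  -- well is therefore zero.
  have ht : Tendsto (fun s : ℝ => ((s : ℂ) * F s) * (κ * bj' (κ * s / 4)) -
      Q s * bj (κ * s / 4)) (𝓝[>] 0) (𝓝 0) := by
    have := (h.tendsto_mul_fst.mul ((hc1.tendsto 0).mono_left nhdsWithin_le_nhds)).sub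
      ((hc2.tendsto 0).mono_left (nhdsWithin_le_nhds (s := Ioi 0)))
    simpa [h.snd_zero] using this
  refine tendsto_nhds_unique (tendsto_const_nhds.congr' ?_) ht
  filter_upwards [Ioo_mem_nhdsGT hσ] with s hs
  rw [← hconst s hs.1 hs.2, wronskian, regF, regQ]
  ring

/-- A solution with vanishing Cauchy data at the edge of the well vanishes. -/
lemma fst_eq_zero (h : IsRadialProfile σ κ z F Q) (hσ : 0 < σ) (hF : F σ = 0) (hQ : Q σ = 0)
    {s : ℝ} (hs : 0 < s) : F s = 0 := by
  -- The regular and logarithmic solutions have Wronskian 2, so they span: 2F is a combination of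
  -- its two Wronskians with them.
  have key : ∀ c : ℂ, wronskian F Q (regF c) (regQ c) s = 0 →
      wronskian F Q (logF c 0) (logQ c 0) s = 0 → F s = 0 := by
    intro c h1 h2
    have h3 := wronskian_reg_log c hs
    rw [wronskian] at h1 h2 h3
    linear_combination (-F s / 2) * h3 + (regF c s / 2) * h2 - (logF c 0 s / 2) * h1
  have h0 : ∀ G R : ℝ → ℂ, wronskian F Q G R σ = 0 := fun G R => by
    rw [wronskian, hF, hQ]; ring
  rcases lt_trichotomy s σ with hlt | heq | hgt
  · refine key κ ?_ ?_
    · rw [h.wronskian_inner_eq (fun t ht => isPairAt_reg κ ht) hs hlt, h0]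
    · rw [h.wronskian_inner_eq (fun t ht => isPairAt_log κ 0 ht) hs hlt, h0]
  · rw [heq, hF]
  · refine key z ?_ ?_
    · rw [h.wronskian_outer_eq hσ (fun t ht => isPairAt_reg z ht) hgt, h0]
    · rw [h.wronskian_outer_eq hσ (fun t ht => isPairAt_log z 0 ht) hgt, h0]

/-- The matching condition at the edge of the well. -/
lemma matching (h : IsRadialProfile σ κ z F Q) (hσ : 0 < σ) {u : ℂ → ℂ}
    (hu : ∀ᵐ x : ℂ, u x = F (‖x‖ ^ 2)) (hn : IsNontrivial u) {G R : ℝ → ℂ}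
    (hw : wronskian F Q G R σ = 0) : regQ κ σ * G σ = R σ * regF κ σ := by
  have h1 := h.wronskian_reg_eq_zero hσ
  rw [wronskian] at h1 hw
  -- Nonzero Cauchy data at the edge are parallel to both solution vectors, so those two vectors are
  -- parallel to each other.
  have hne : F σ ≠ 0 ∨ Q σ ≠ 0 := by
    by_contra hc
    push Not at hc
    refine hn ?_
    have h0 : ∀ᵐ x : ℂ, x ≠ 0 := by simp [ae_iff]
    filter_upwards [hu, h0] with x hx hx0
    rw [hx, h.fst_eq_zero hσ hc.1 hc.2 (by positivity)]
  rcases hne with hne | hne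
  · refine mul_left_cancel₀ hne ?_
    linear_combination G σ * h1 - regF κ σ * hw
  · refine mul_left_cancel₀ hne ?_
    linear_combination R σ * h1 - regQ κ σ * hw

end IsRadialProfile

/-! ### Matching for eigenfunctions -/

lemma isPairAt_decay {E : ℝ} (hE : E < 0) {s : ℝ} (hs : 0 < s) :
    IsPairAt (E : ℂ) (fun s => (decayK (-E * s / 4) : ℂ))
      (fun s => ((-4 * decayM (-E * s / 4) : ℝ) : ℂ)) s := by
  have hy : 0 < -E * s / 4 := by
    have := mul_pos (neg_pos.2 hE) hs
    positivity
  have h1 : HasDerivAt (fun s : ℝ => -E * s / 4) (-E / 4) s := by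
    simpa using ((hasDerivAt_id s).const_mul (-E)).div_const 4
  have hs' : (s : ℂ) ≠ 0 := by exact_mod_cast hs.ne'
  have hE' : (E : ℂ) ≠ 0 := by exact_mod_cast hE.ne
  constructor
  · refine ((hasDerivAt_decayK hy).comp s h1).ofReal_comp.congr_deriv ?_
    push_cast
    field_simp
  · refine (((hasDerivAt_decayM hy).comp s h1).const_mul (-4)).ofReal_comp.congr_deriv ?_
    push_cast
    ring

lemma volume_norm_sq_gt (S : ℝ) : volume {x : ℂ | S < ‖x‖ ^ 2} = ⊤ := by
  have h1 : {x : ℂ | S < ‖x‖ ^ 2} = ((fun x : ℂ => ‖x‖ ^ 2) ⁻¹' Iic S)ᶜ := by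
    ext x; simp
  have hm : MeasurableSet ((fun x : ℂ => ‖x‖ ^ 2) ⁻¹' Iic S) :=
    measurable_norm_sq measurableSet_Iic
  have hfin : volume ((fun x : ℂ => ‖x‖ ^ 2) ⁻¹' Iic S) ≠ ⊤ := by
    rw [volume_normSq_preimage_Iic]
    exact ENNReal.mul_ne_top ENNReal.ofReal_ne_top ENNReal.ofReal_ne_top
  rw [h1, measure_compl hm hfin]
  simp [hfin]

/-- A square integrable function exceeds a positive level only on a set of finite area, while the
exterior of a disc has infinite area. -/
lemma not_memLp_of_le_norm {F : ℝ → ℂ} {ψ : ℂ → ℂ} (hψ : MemLp ψ 2 volume)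
    (he : ∀ᵐ x : ℂ, ψ x = F (‖x‖ ^ 2)) {S c : ℝ} (hc : 0 < c) : ¬ ∀ s, S < s → c ≤ ‖F s‖ := by
  intro h
  have h1 := hψ.meas_ge_lt_top (by norm_num) (by norm_num) (ε := c.toNNReal)
    (by simpa using hc)
  have h2 : volume {x : ℂ | S < ‖x‖ ^ 2} ≤ volume {x : ℂ | c.toNNReal ≤ ‖ψ x‖₊} := by
    refine measure_mono_ae ?_
    filter_upwards [he] with x hx hxS
    have : c ≤ ‖ψ x‖ := hx ▸ h _ hxS
    exact Real.toNNReal_le_iff_le_coe.2 this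
  rw [volume_norm_sq_gt] at h2
  exact absurd h1 (not_lt.2 h2)

lemma IsEigenfunction.matching {ρ asq E : ℝ} (hρ : 0 < ρ) (hE : E < 0) {ψ : ℂ → ℂ}
    (hr : IsRadial ψ) (h : IsEigenfunction (circularWell ρ asq) E ψ) :
    regQ (asq + E) (ρ ^ 2) * decayK (-E * ρ ^ 2 / 4) =
      -4 * decayM (-E * ρ ^ 2 / 4) * regF (asq + E) (ρ ^ 2) := by
  obtain ⟨hL, hn, hsol⟩ := h
  obtain ⟨F, Q, hp, he⟩ := hsol.exists_isRadialProfile hρ hr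
  have hσ : 0 < ρ ^ 2 := by positivity
  set K : ℝ → ℂ := fun s => (decayK (-E * s / 4) : ℂ) with hK
  set M : ℝ → ℂ := fun s => ((-4 * decayM (-E * s / 4) : ℝ) : ℂ) with hM
  have hw : wronskian F Q K M (ρ ^ 2) = 0 := by
    by_contra hne
    set w := wronskian F Q K M (ρ ^ 2) with hwdef
    set w₁ := wronskian F Q (regF E) (regQ E) (ρ ^ 2) with hw₁
    obtain ⟨w₂, hw₂⟩ := exists_wronskian_const (c := (E : ℂ)) isOpen_Ioi
      (isPreconnected_Ioi (a := (0 : ℝ))) (fun s hs => isPairAt_decay hE hs)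
      fun s hs => isPairAt_reg (E : ℂ) hs
    -- Three solutions of a second order equation are linearly dependent, with Wronskians as
    -- coefficients. Since |`regF`| ≥ 1 and K → 0, a nonzero w would keep |F| away from 0 at
    -- infinity, against square integrability.
    have hid : ∀ s, ρ ^ 2 < s → regF E s * w = K s * w₁ - F s * w₂ := by
      intro s hs
      rw [hwdef, ← hp.wronskian_outer_eq hσ (fun t ht => isPairAt_decay hE ht) hs, hw₁,
        ← hp.wronskian_outer_eq hσ (fun t ht => isPairAt_reg (E : ℂ) ht) hs,
        ← hw₂ s (hσ.trans hs)]
      simp only [wronskian]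
      ring
    have hI : ∀ s, 0 < s → 1 ≤ ‖regF (E : ℂ) s‖ := by
      intro s hs
      have hy : 0 ≤ -E * s / 4 := by
        have := mul_pos (neg_pos.2 hE) hs
        positivity
      have e : regF (E : ℂ) s = bj (-((-E * s / 4 : ℝ) : ℂ)) := by
        rw [regF]; congr 1; push_cast; ring
      rw [e]
      exact one_le_norm_bj_neg hy
    have hw0 : 0 < ‖w‖ := norm_pos_iff.2 hne
    have hKlim : Tendsto (fun s : ℝ => 4 / (-E * s) * ‖w₁‖) atTop (𝓝 0) := by
      have h1 : Tendsto (fun s : ℝ => -E * s) atTop atTop :=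
        tendsto_id.const_mul_atTop (neg_pos.2 hE)
      simpa using (tendsto_const_nhds.div_atTop h1).mul_const ‖w₁‖
    obtain ⟨S, hS⟩ := (((hKlim.eventually_lt_const (half_pos hw0)).and
      (eventually_gt_atTop (ρ ^ 2))).exists_forall_of_atTop)
    have hbound : ∀ s, S < s → ‖w‖ / 2 ≤ ‖F s‖ * ‖w₂‖ := by
      intro s hs
      obtain ⟨h1, h2⟩ := hS s hs.le
      have hs0 : 0 < s := hσ.trans h2
      have hpos := mul_pos (neg_pos.2 hE) hs0
      have hKs : ‖K s‖ ≤ 4 / (-E * s) := by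
        rw [hK]
        simp only
        rw [Complex.norm_real, Real.norm_of_nonneg (decayK_nonneg _)]
        refine (decayK_le (by positivity)).trans (le_of_eq ?_)
        rw [one_div_div]
      have h3 : ‖w‖ ≤ ‖K s‖ * ‖w₁‖ + ‖F s‖ * ‖w₂‖ := by
        calc ‖w‖ ≤ ‖regF (E : ℂ) s‖ * ‖w‖ := le_mul_of_one_le_left hw0.le (hI s hs0)
          _ = ‖K s * w₁ - F s * w₂‖ := by rw [← hid s h2, norm_mul]
          _ ≤ _ := by rw [← norm_mul, ← norm_mul]; exact norm_sub_le _ _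
      have h4 : ‖K s‖ * ‖w₁‖ ≤ 4 / (-E * s) * ‖w₁‖ := by gcongr
      linarith
    rcases eq_or_ne w₂ 0 with h0 | h0
    · have := hbound (S + 1) (by linarith)
      rw [h0, norm_zero, mul_zero] at this
      linarith
    · have hw2 : 0 < ‖w₂‖ := norm_pos_iff.2 h0
      refine not_memLp_of_le_norm hL he (S := S) (c := ‖w‖ / 2 / ‖w₂‖) (by positivity) ?_
      intro s hs
      rw [div_le_iff₀ hw2]
      exact hbound s hs
  have := hp.matching hσ he hn hw
  rw [this]
  simp only [hM]
  push_cast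
  ring

/-! ### Matching for resonant states -/

lemma integral_exp_int {l : ℤ} (hl : l ≠ 0) :
    ∫ θ in Ioo (-Real.pi) Real.pi, Complex.exp (θ * Complex.I) ^ l = 0 := by
  have hc : (l : ℂ) * Complex.I ≠ 0 := mul_ne_zero (by exact_mod_cast hl) Complex.I_ne_zero
  have h := integral_exp_mul_complex (a := -Real.pi) (b := Real.pi) hc
  have e : Complex.exp ((l : ℂ) * Complex.I * (Real.pi : ℝ)) =
      Complex.exp ((l : ℂ) * Complex.I * ((-Real.pi : ℝ) : ℂ)) := by
    rw [Complex.exp_eq_exp_iff_exists_int]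
    exact ⟨l, by push_cast; ring⟩
  rw [e, sub_self, zero_div, intervalIntegral.integral_of_le (by linarith [Real.pi_pos]),
    integral_Ioc_eq_integral_Ioo] at h
  rw [← h]
  refine setIntegral_congr_fun measurableSet_Ioo fun θ _ => ?_
  rw [← Complex.exp_int_mul]
  ring_nf

/-- The mean of a Fourier series. -/
lemma eq_zero_coeff_of_hasSum {a : ℤ → ℂ} {v : ℂ}
    (h : ∀ᵐ (θ : ℝ) ∂(volume.restrict (Ioo (-Real.pi) Real.pi)),
      HasSum (fun l : ℤ => a l * Complex.exp (θ * Complex.I) ^ l) v) : v = a 0 := by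
  have hvol : (volume : Measure ℝ).real (Ioo (-Real.pi) Real.pi) = 2 * Real.pi := by
    rw [measureReal_def, Real.volume_Ioo, ENNReal.toReal_ofReal] <;> linarith [Real.pi_pos]
  have hne : (volume.restrict (Ioo (-Real.pi) Real.pi)) ≠ 0 := by
    simp [Measure.restrict_eq_zero, Real.pi_pos]
  have : NeBot (ae (volume.restrict (Ioo (-Real.pi) Real.pi))) := ae_neBot.2 hne
  have hnorm : ∀ (l : ℤ) (θ : ℝ), ‖a l * Complex.exp (θ * Complex.I) ^ l‖ = ‖a l‖ := by
    intro l θ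
    rw [norm_mul, norm_zpow, Complex.norm_exp_ofReal_mul_I, one_zpow, mul_one]
  -- Convergence at a single angle suffices: unconditional convergence in ℂ is absolute, and the
  -- exponentials have modulus one. This supplies the dominating series.
  have hs : Summable fun l => ‖a l‖ := by
    obtain ⟨θ, hθ⟩ := h.exists
    exact hθ.summable.norm.congr fun l => hnorm l θ
  have hfin : IsFiniteMeasure ((volume : Measure ℝ).restrict (Ioo (-Real.pi) Real.pi)) :=
    ⟨by simp⟩
  have key := hasSum_integral_of_dominated_convergence
    (μ := volume.restrict (Ioo (-Real.pi) Real.pi))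
    (F := fun (l : ℤ) (θ : ℝ) => a l * Complex.exp (θ * Complex.I) ^ l) (f := fun _ => v)
    (fun l _ => ‖a l‖) (fun l => ?_) (fun l => Eventually.of_forall fun θ => (hnorm l θ).le)
    (Eventually.of_forall fun _ => hs) (integrable_const _) h
  · have hterm : ∀ l : ℤ, l ≠ 0 →
        ∫ θ in Ioo (-Real.pi) Real.pi, a l * Complex.exp (θ * Complex.I) ^ l = 0 := by
      intro l hl
      rw [integral_const_mul, integral_exp_int hl, mul_zero]
    have h2 := key.unique (hasSum_single 0 hterm)
    simp only [zpow_zero, mul_one] at h2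
    rw [setIntegral_const, setIntegral_const, hvol] at h2
    exact smul_right_injective ℂ Real.two_pi_pos.ne' h2
  · refine (Continuous.aestronglyMeasurable ?_)
    refine continuous_const.mul (Continuous.zpow₀ (by fun_prop) l fun θ => Or.inl ?_)
    exact Complex.exp_ne_zero _

/-- The radial outgoing solution at `λ` is `H₀⁽¹⁾(λ r)`, or `1` for `λ = 0`. -/
lemma IsOutgoing.profile {lam : ℂ} {u : ℂ → ℂ} (h : IsOutgoing lam u) {F : ℝ → ℂ}
    (he : ∀ᵐ x : ℂ, u x = F (‖x‖ ^ 2)) :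
    ∃ (c : ℂ) (R : ℝ), 0 ≤ R ∧ ∀ᵐ r : ℝ, R < r →
      F (r ^ 2) = c * (if lam = 0 then 1 else hankel1 0 (lam * r)) := by
  obtain ⟨c, R, hc⟩ := h
  refine ⟨c 0, max R 0, le_max_right _ _, ?_⟩
  have h1 := (ae_restrict_iff' measurableSet_Ioi).1 (ae_ae_polar (hc.and he))
  filter_upwards [h1] with r hr hR
  have hr0 : 0 < r := (le_max_right _ _).trans_lt hR
  have hrR : R < r := (le_max_left _ _).trans_lt hR
  have hr0' : (r : ℂ) ≠ 0 := by exact_mod_cast hr0.ne'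
  have := eq_zero_coeff_of_hasSum (a := fun l => c l *
    (if lam = 0 then (r : ℂ) ^ (-|l|) else hankel1 l (lam * r))) (v := F (r ^ 2)) ?_
  · simpa using this
  filter_upwards [hr hr0] with θ hθ
  have hnorm : ‖(r : ℂ) * Complex.exp (θ * Complex.I)‖ = r := by
    rw [norm_mul, Complex.norm_exp_ofReal_mul_I, Complex.norm_real, Real.norm_of_nonneg hr0.le,
      mul_one]
  rw [hnorm] at hθ
  have h3 := hθ.1 hrR
  rw [hθ.2, mul_div_cancel_left₀ _ hr0'] at h3
  exact h3

/-- Continuity upgrades the almost everywhere identity to all large s. Differentiating it there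
makes the fluxes proportional with the same constant, and the Wronskian carries this back to the
edge. -/
lemma IsRadialProfile.wronskian_eq_zero_of_eventually {σ : ℝ} {κ z : ℂ} {F Q G R : ℝ → ℂ}
    (h : IsRadialProfile σ κ z F Q) (hσ : 0 < σ) (hG : ∀ s, 0 < s → IsPairAt z G R s)
    {c : ℂ} {S : ℝ} (hS : 0 ≤ S) (he : ∀ᵐ r : ℝ, S < r → F (r ^ 2) = c * G (r ^ 2)) :
    wronskian F Q G R σ = 0 := by
  have heq : EqOn (fun r : ℝ => F (r ^ 2)) (fun r : ℝ => c * G (r ^ 2)) (Ioi S) := by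
    refine Measure.eqOn_open_of_ae_eq (μ := volume)
      ((ae_restrict_iff' measurableSet_Ioi).2 he) isOpen_Ioi ?_ ?_
    · intro r hr
      have hr0 : 0 < r := hS.trans_lt hr
      have h1 : ContinuousAt F (r ^ 2) := h.continuousAt_fst (by positivity)
      exact (ContinuousAt.comp (f := fun r : ℝ => r ^ 2) h1
        (continuous_pow 2).continuousAt).continuousWithinAt
    · intro r hr
      have hr0 : 0 < r := hS.trans_lt hr
      have h1 : ContinuousAt G (r ^ 2) := (hG (r ^ 2) (by positivity)).1.continuousAt
      exact (continuousAt_const.mul (ContinuousAt.comp (f := fun r : ℝ => r ^ 2) h1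
        (continuous_pow 2).continuousAt)).continuousWithinAt
  have heq2 : ∀ s, S ^ 2 < s → F s = c * G s := by
    intro s hs
    have hs0 : 0 ≤ s := (sq_nonneg S).trans hs.le
    have := heq (show √s ∈ Ioi S from Real.lt_sqrt_of_sq_lt hs)
    simpa [Real.sq_sqrt hs0] using this
  set s := max (S ^ 2) σ + 1 with hs
  have hs1 : S ^ 2 < s := by linarith [le_max_left (S ^ 2) σ]
  have hs2 : σ < s := by linarith [le_max_right (S ^ 2) σ]
  have hs0 : 0 < s := hσ.trans hs2
  have hs0' : (4 * (s : ℂ)) ≠ 0 := mul_ne_zero (by norm_num) (by exact_mod_cast hs0.ne')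
  have hev : F =ᶠ[𝓝 s] fun t => c * G t := by
    filter_upwards [Ioi_mem_nhds hs1] with t ht
    exact heq2 t ht
  have hd := (h.hasDerivAt_fst s hs0).unique
    (((hG s hs0).1.const_mul c).congr_of_eventuallyEq hev)
  have hQ : Q s = c * R s := by
    rwa [← mul_div_assoc, div_left_inj' hs0'] at hd
  rw [← h.wronskian_outer_eq hσ hG hs2, wronskian, heq2 s hs1, hQ]
  ring

/-- The constant in the outgoing logarithmic solution. -/
def outgoingConst (lam : ℂ) : ℂ :=
  cutLog (lam / 2) + Real.eulerMascheroniConstant - Complex.I * (Real.pi / 2)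

lemma hankel1_eq_logF {lam : ℂ} (hl : lam ≠ 0) {r : ℝ} (hr : 0 < r) :
    hankel1 0 (lam * r) =
      (2 * Complex.I / Real.pi) * logF (lam ^ 2) (outgoingConst lam) (r ^ 2) := by
  have h1 : lam * r / 2 = r * (lam / 2) := by ring
  have h2 : (lam * r) ^ 2 / 4 = lam ^ 2 * ((r ^ 2 : ℝ) : ℂ) / 4 := by push_cast; ring
  rw [hankel1_zero, h1, cutLog_ofReal_mul hr (div_ne_zero hl two_ne_zero), h2, logF,
    outgoingConst, Real.log_pow]
  push_cast
  ring

lemma IsResonantState.matching {ρ asq : ℝ} (hρ : 0 < ρ) {lam : ℂ} {u : ℂ → ℂ}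
    (hr : IsRadial u) (h : IsResonantState (circularWell ρ asq) lam u) :
    (lam = 0 → regQ asq (ρ ^ 2) = 0) ∧
    (lam ≠ 0 → regQ (asq + lam ^ 2) (ρ ^ 2) * logF (lam ^ 2) (outgoingConst lam) (ρ ^ 2) =
      logQ (lam ^ 2) (outgoingConst lam) (ρ ^ 2) * regF (asq + lam ^ 2) (ρ ^ 2)) := by
  obtain ⟨hn, hsol, hout⟩ := h
  obtain ⟨F, Q, hp, he⟩ := hsol.exists_isRadialProfile hρ hr
  have hσ : 0 < ρ ^ 2 := by positivity
  obtain ⟨c, R, hR, hc⟩ := hout.profile he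
  constructor
  · intro hl
    rw [hl] at hp hc
    -- At λ = 0 the outgoing radial solution is constant, which is the regular solution with c = 0
    -- and has zero flux.
    have hw := hp.wronskian_eq_zero_of_eventually hσ (fun s hs => isPairAt_reg _ hs) hR (c := c) ?_
    · have := hp.matching hσ he hn hw
      simpa [regF, regQ, bj_zero] using this
    · filter_upwards [hc] with r hr hrR
      rw [hr hrR]
      simp [regF, bj_zero]
  · intro hl
    refine hp.matching hσ he hn (hp.wronskian_eq_zero_of_eventually hσ
      (fun s hs => isPairAt_log _ _ hs) hR (c := c * (2 * Complex.I / Real.pi)) ?_)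
    filter_upwards [hc] with r hr hrR
    rw [hr hrR, if_neg hl, hankel1_eq_logF hl (hR.trans_lt hrR)]
    ring

/-! ### The logarithmic derivative of the regular solution near a zero of `bj'` -/

/-- A common zero of `bj` and `bj'` would make a Wronskian equal to 2 vanish; the choice s = 4 makes
cs/4 equal to w. -/
lemma bj_ne_zero_of_bj' {w : ℂ} (h : bj' w = 0) : bj w ≠ 0 := by
  intro h0
  have key := wronskian_reg_log w (s := 4) (by norm_num)
  have e : w * ((4 : ℝ) : ℂ) / 4 = w := by push_cast; ring
  rw [wronskian, regF, regQ, e, h, h0] at key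
  norm_num at key

/-- `w bj'(w) / bj(w)`. -/
def logDerivJ (w : ℂ) : ℂ := w * bj' w / bj w

/-- This is the Riccati form of the second order equation for `bj`. -/
lemma hasDerivAt_logDerivJ {w : ℂ} (hw : w ≠ 0) (hj : bj w ≠ 0) :
    HasDerivAt logDerivJ (-1 - logDerivJ w ^ 2 / w) w := by
  refine (((hasDerivAt_id w).mul (hasDerivAt_bj' w)).div (hasDerivAt_bj w) hj).congr_deriv ?_
  rw [logDerivJ]
  simp only [Pi.mul_apply, id_eq, one_mul]
  field_simp
  linear_combination bj w * bj_ode w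

/-- By the Riccati equation there is no quadratic term. -/
lemma logDerivJ_cubic {w₀ : ℂ} (hw : w₀ ≠ 0) (h : bj' w₀ = 0) :
    ∃ C r : ℝ, 0 < C ∧ 0 < r ∧ ∀ w : ℂ, ‖w - w₀‖ < r →
      bj w ≠ 0 ∧ ‖logDerivJ w + (w - w₀)‖ ≤ C * ‖w - w₀‖ ^ 3 := by
  have hj := bj_ne_zero_of_bj' h
  have hg0 : logDerivJ w₀ = 0 := by simp [logDerivJ, h]
  have hd := hasDerivAt_logDerivJ hw hj
  obtain ⟨A, hA0, hA⟩ := hd.isBigO_sub.exists_pos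
  have hev := hA.bound.and ((continuous_bj.continuousAt.eventually_ne hj).and
    (lt_mem_nhds (show ‖w₀‖ / 2 < ‖w₀‖ from half_lt_self (norm_pos_iff.2 hw)) |> fun hn =>
      (continuous_norm.continuousAt (x := w₀)).eventually hn))
  obtain ⟨r, hr, hball⟩ := Metric.eventually_nhds_iff.1 hev
  have hw0 : 0 < ‖w₀‖ := norm_pos_iff.2 hw
  refine ⟨A ^ 2 * (2 / ‖w₀‖), r, by positivity, hr, fun w hwr => ?_⟩
  have hb : ∀ v ∈ Metric.closedBall w₀ ‖w - w₀‖,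
      ‖logDerivJ v‖ ≤ A * ‖w - w₀‖ ∧ bj v ≠ 0 ∧ ‖w₀‖ / 2 < ‖v‖ := by
    intro v hv
    rw [mem_closedBall_iff_norm] at hv
    obtain ⟨h1, h2, h3⟩ := hball (y := v) (by rw [dist_eq_norm]; exact hv.trans_lt hwr)
    rw [hg0, sub_zero] at h1
    exact ⟨h1.trans (by gcongr), h2, h3⟩
  have hmem : w ∈ Metric.closedBall w₀ ‖w - w₀‖ := by simp [dist_eq_norm]
  refine ⟨(hb w hmem).2.1, ?_⟩
  -- The derivative of g + (v - w₀) is -g²/v. Since g = O(|w - w₀|) on the ball, this is quadratic,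
  -- and the mean value inequality makes the difference cubic.
  have key := Convex.norm_image_sub_le_of_norm_hasDerivWithin_le
    (f := fun v => logDerivJ v + (v - w₀)) (f' := fun v => -(logDerivJ v ^ 2 / v))
    (C := A ^ 2 * (2 / ‖w₀‖) * ‖w - w₀‖ ^ 2) (s := Metric.closedBall w₀ ‖w - w₀‖)
    (x := w₀) (y := w) (fun v hv => ?_) (fun v hv => ?_) (convex_closedBall _ _) (by simp) hmem
  · simp only [hg0, sub_self, add_zero, sub_zero] at key
    exact key.trans (le_of_eq (by ring))
  · obtain ⟨_, h2, h3⟩ := hb v hv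
    have hv0 : v ≠ 0 := norm_pos_iff.1 (lt_trans (by positivity) h3)
    refine (((hasDerivAt_logDerivJ hv0 h2).add
      ((hasDerivAt_id v).sub_const w₀)).congr_deriv ?_).hasDerivWithinAt
    ring
  · obtain ⟨h1, _, h3⟩ := hb v hv
    rw [norm_neg, norm_div, norm_pow]
    calc ‖logDerivJ v‖ ^ 2 / ‖v‖ ≤ (A * ‖w - w₀‖) ^ 2 / (‖w₀‖ / 2) := by gcongr
      _ = _ := by field_simp

lemma regF_eq (c : ℂ) (s : ℝ) : regF c s = bj (c * s / 4) := rfl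

lemma regQ_eq {c : ℂ} {s : ℝ} (h : bj (c * s / 4) ≠ 0) :
    regQ c s = 4 * logDerivJ (c * s / 4) * bj (c * s / 4) := by
  rw [regQ, logDerivJ]; field_simp

/-! ### The decaying solution near the origin -/

lemma tendsto_log_pow_mul_sqrt :
    Tendsto (fun y : ℝ => |Real.log y| ^ 3 * √y) (𝓝[>] 0) (𝓝 0) := by
  -- The exponent 1/6 becomes 1/2 after cubing; the cube of the logarithm serves the bound y ≤ t³.
  have h := (tendsto_log_mul_rpow_nhdsGT_zero (r := 1 / 6) (by norm_num)).abs.pow 3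
  simp only [abs_zero, ne_eq, OfNat.ofNat_ne_zero, not_false_eq_true, zero_pow] at h
  refine h.congr' ?_
  filter_upwards [self_mem_nhdsWithin] with y hy
  have hy0 : 0 < y := hy
  rw [abs_mul, mul_pow, abs_of_nonneg (Real.rpow_nonneg hy0.le _), ← Real.rpow_natCast (y ^ _),
    ← Real.rpow_mul hy0.le, Real.sqrt_eq_rpow]
  norm_num

lemma tendsto_neg_log : Tendsto (fun y : ℝ => -Real.log y) (𝓝[>] 0) atTop :=
  tendsto_neg_atBot_atTop.comp Real.tendsto_log_nhdsGT_zero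

lemma decay_eventually : ∀ᶠ y in 𝓝[>] (0 : ℝ),
    0 < decayK y ∧ 1 / 2 ≤ decayM y ∧ decayM y ≤ 2 ∧ -Real.log y / 2 ≤ decayK y ∧
    y ≤ (decayM y / decayK y) ^ 3 ∧
    |decayK y + Real.log y + 2 * Real.eulerMascheroniConstant| ≤ decayM y / decayK y ∧
    |decayK y - decayK y / decayM y| ≤ decayM y / decayK y := by
  obtain ⟨C, hC, hasym⟩ := decay_asymptotics
  have hsmall := tendsto_log_pow_mul_sqrt.eventually_lt_const
    (show (0 : ℝ) < 1 / (8 * (C + 1)) by positivity)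
  filter_upwards [self_mem_nhdsWithin, tendsto_neg_log.eventually_ge_atTop 6, hsmall]
    with y hy hl hs
  have hy0 : 0 < y := hy
  obtain ⟨h1, h2⟩ := hasym y hy0
  set l := -Real.log y with hldef
  have hla : |Real.log y| = l := by
    rw [hldef, abs_of_neg (by linarith)]
  rw [hla] at h2 hs
  have hlog : Real.log y = -l := by rw [hldef]; ring
  have hr0 : 0 ≤ √y := Real.sqrt_nonneg y
  -- the basic smallness
  have hb : l ^ 3 * √y * (8 * (C + 1)) < 1 := by
    rwa [lt_div_iff₀ (by positivity)] at hs
  have hCs : 0 ≤ l ^ 3 * √y := by positivity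
  have hCX : 0 ≤ C * (l ^ 3 * √y) := by positivity
  have hbe : l ^ 3 * √y * (8 * (C + 1)) = 8 * (C * (l ^ 3 * √y)) + 8 * (l ^ 3 * √y) := by ring
  have hb1 : C * (l ^ 3 * √y) ≤ 1 / 8 := by linarith
  have hb2 : l ^ 3 * √y ≤ 1 / 8 := by linarith
  have hl6 : 0 ≤ l - 6 := by linarith
  have hl2 : 6 * l ^ 2 ≤ l ^ 3 := by nlinarith [mul_nonneg hl6 (sq_nonneg l)]
  have hl1 : 6 * l ≤ l ^ 2 := by nlinarith
  have hCr : 0 ≤ C * √y := by positivity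
  have hc1 : C * √y * l ^ 2 ≤ 1 / 48 := by
    have := mul_le_mul_of_nonneg_left hl2 hCr
    linarith
  have hc0 : C * √y * l ≤ 1 / 200 := by
    have := mul_le_mul_of_nonneg_left hl1 hCr
    linarith
  have hcc : C * √y ≤ 1 / 200 := by
    have := mul_le_mul_of_nonneg_left hl hCr
    linarith
  have hM1 := abs_le.1 (h1.trans hcc)
  have hγ1 := Real.one_half_lt_eulerMascheroniConstant
  have hγ2 := Real.eulerMascheroniConstant_lt_two_thirds
  -- Together with 1/2 < γ < 2/3 and l ≥ 6 this gives l/2 ≤ K ≤ l. Hence t = M/K ≥ 1/(2l), and every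
  -- error below is compared with 1/(2l).
  have h2' : |decayK y + Real.log y + 2 * Real.eulerMascheroniConstant| ≤ 2 * (C * √y * l) := by
    refine h2.trans ?_
    have := mul_le_mul_of_nonneg_left hl hCr
    linarith
  have hK := abs_le.1 h2'
  rw [hlog] at hK
  have hK1 : decayK y ≤ l := by linarith
  have hK2 : l / 2 ≤ decayK y := by linarith
  have hK0 : 0 < decayK y := by linarith
  have hm : 1 / 2 ≤ decayM y := by linarith
  have hm2 : decayM y ≤ 2 := by linarith
  have ht : 1 / (2 * l) ≤ decayM y / decayK y := by
    rw [div_le_div_iff₀ (by linarith) hK0]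
    nlinarith
  have ht0 : (0 : ℝ) < 1 / (2 * l) := by positivity
  refine ⟨hK0, hm, hm2, hK2, ?_, ?_, ?_⟩
  · refine le_trans ?_ (pow_le_pow_left₀ ht0.le ht 3)
    have hr1 : √y ≤ 1 := by
      have h3 : (1 : ℝ) ≤ l ^ 3 := one_le_pow₀ (by linarith)
      have := mul_le_mul_of_nonneg_right h3 hr0
      linarith
    have hyr : y ≤ √y := by
      calc y = √y * √y := (Real.mul_self_sqrt hy0.le).symm
        _ ≤ √y * 1 := by gcongr
        _ = √y := mul_one _
    refine hyr.trans ?_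
    rw [div_pow, one_pow, le_div_iff₀ (by positivity)]
    linarith
  · refine (h2'.trans ?_).trans ht
    rw [le_div_iff₀ (by positivity)]
    linarith
  · refine le_trans ?_ ht
    have e : decayK y - decayK y / decayM y = decayK y * (decayM y - 1) / decayM y := by
      field_simp
    rw [e, abs_div, abs_mul, abs_of_pos hK0, abs_of_pos (by linarith : 0 < decayM y),
      div_le_iff₀ (by linarith)]
    have h3 : decayK y * |decayM y - 1| ≤ l * (C * √y) := by gcongr
    refine h3.trans ?_
    rw [div_mul_eq_mul_div, le_div_iff₀ (by positivity)]
    linarith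

lemma tendsto_decay_ratio : Tendsto (fun y => decayM y / decayK y) (𝓝[>] 0) (𝓝 0) := by
  have h1 : Tendsto (fun y : ℝ => 2 / (-Real.log y / 2)) (𝓝[>] 0) (𝓝 0) :=
    tendsto_const_nhds.div_atTop (tendsto_neg_log.atTop_div_const two_pos)
  refine squeeze_zero' ?_ ?_ h1
  · filter_upwards [decay_eventually] with y hy
    exact div_nonneg (by linarith [hy.2.1]) hy.1.le
  · filter_upwards [decay_eventually, tendsto_neg_log.eventually_gt_atTop 0] with y hy hl
    have := hy.1
    have := hy.2.1
    gcongr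
    · exact hy.2.2.1
    · exact hy.2.2.2.1

/-! ### The eigenvalue near the threshold -/

lemma IsEigenfunction.bj_relation {ρ asq E : ℝ} (hρ : 0 < ρ) (hE : E < 0) {ψ : ℂ → ℂ}
    (hr : IsRadial ψ) (h : IsEigenfunction (circularWell ρ asq) E ψ)
    (hK : decayK (-E * ρ ^ 2 / 4) ≠ 0) :
    (((asq + E) * ρ ^ 2 / 4 : ℝ) : ℂ) * bj' (((asq + E) * ρ ^ 2 / 4 : ℝ) : ℂ) =
      -((decayM (-E * ρ ^ 2 / 4) / decayK (-E * ρ ^ 2 / 4) : ℝ) : ℂ) *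
        bj (((asq + E) * ρ ^ 2 / 4 : ℝ) : ℂ) := by
  have key := h.matching hρ hE hr
  have e : ((asq : ℂ) + E) * ((ρ ^ 2 : ℝ) : ℂ) / 4 = (((asq + E) * ρ ^ 2 / 4 : ℝ) : ℂ) := by
    push_cast; ring
  have hK' : (decayK (-E * ρ ^ 2 / 4) : ℂ) ≠ 0 := by exact_mod_cast hK
  rw [regQ, regF, e] at key
  have e' : ((asq : ℂ) + E) * ((ρ ^ 2 : ℝ) : ℂ) = 4 * (((asq + E) * ρ ^ 2 / 4 : ℝ) : ℂ) := by
    rw [← e]; ring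
  rw [e'] at key
  rw [Complex.ofReal_div (decayM _)]
  have aux : ∀ W K M J J' : ℂ, K ≠ 0 → 4 * W * J' * K = -4 * M * J → W * J' = -(M / K) * J := by
    intro W K M J J' hK h
    field_simp
    linear_combination (1 / 4) * h
  exact aux _ _ _ _ _ hK' key

section Threshold

variable {ρ a₀ ε₁ : ℝ} {E : ℝ → ℝ}

lemma tendsto_scaled_energy (hρ : 0 < ρ) (hE : Tendsto E (𝓝[<] 0) (𝓝[<] 0)) :
    Tendsto (fun ε => -E ε * ρ ^ 2 / 4) (𝓝[<] 0) (𝓝[>] 0) := by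
  refine tendsto_nhdsWithin_iff.2 ⟨?_, ?_⟩
  · have h1 : Tendsto E (𝓝[<] 0) (𝓝 0) := hE.mono_right nhdsWithin_le_nhds
    simpa using ((h1.neg.mul_const (ρ ^ 2)).div_const 4)
  · filter_upwards [hE.eventually self_mem_nhdsWithin] with ε hε
    have h1 : E ε < 0 := hε
    have := mul_pos (neg_pos.2 h1) (sq_pos_of_pos hρ)
    exact mem_Ioi.2 (by linarith)

lemma tendsto_scaled_depth (hE : Tendsto E (𝓝[<] 0) (𝓝[<] 0)) :
    Tendsto (fun ε => (a₀ ^ 2 - ε + E ε) * ρ ^ 2 / 4) (𝓝[<] 0) (𝓝 (a₀ ^ 2 * ρ ^ 2 / 4)) := by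
  have h1 : Tendsto E (𝓝[<] 0) (𝓝 0) := hE.mono_right nhdsWithin_le_nhds
  have h2 : Tendsto (fun ε : ℝ => ε) (𝓝[<] 0) (𝓝 0) := tendsto_id.mono_left nhdsWithin_le_nhds
  have := ((((tendsto_const_nhds (x := a₀ ^ 2)).sub h2).add h1).mul_const (ρ ^ 2)).div_const 4
  simpa using this

lemma eventually_bj_relation (hρ : 0 < ρ) (hε₁ : 0 < ε₁)
    (hψ : ∀ ε ∈ Ioo (-ε₁) 0, ∃ ψ : ℂ → ℂ, IsRadial ψ ∧
      IsEigenfunction (circularWell ρ (a₀ ^ 2 - ε)) (E ε) ψ)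
    (hE : Tendsto E (𝓝[<] 0) (𝓝[<] 0)) :
    ∀ᶠ ε in 𝓝[<] (0 : ℝ),
      (((a₀ ^ 2 - ε + E ε) * ρ ^ 2 / 4 : ℝ) : ℂ) *
          bj' (((a₀ ^ 2 - ε + E ε) * ρ ^ 2 / 4 : ℝ) : ℂ) =
        -((decayM (-E ε * ρ ^ 2 / 4) / decayK (-E ε * ρ ^ 2 / 4) : ℝ) : ℂ) *
          bj (((a₀ ^ 2 - ε + E ε) * ρ ^ 2 / 4 : ℝ) : ℂ) := by
  filter_upwards [Ioo_mem_nhdsLT (neg_lt_zero.2 hε₁), hE.eventually self_mem_nhdsWithin,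
    (tendsto_scaled_energy hρ hE).eventually decay_eventually] with ε hε hneg hd
  obtain ⟨ψ, hr, h⟩ := hψ ε hε
  exact h.bj_relation hρ hneg hr hd.1.ne'

/-- In the limit of the matching relation the decay ratio t tends to 0 while w tends to w₀ ≠ 0, so
j′(w₀) = 0. -/
lemma bj'_threshold (hρ : 0 < ρ) (ha₀ : 0 < a₀) (hε₁ : 0 < ε₁)
    (hψ : ∀ ε ∈ Ioo (-ε₁) 0, ∃ ψ : ℂ → ℂ, IsRadial ψ ∧
      IsEigenfunction (circularWell ρ (a₀ ^ 2 - ε)) (E ε) ψ)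
    (hE : Tendsto E (𝓝[<] 0) (𝓝[<] 0)) : bj' ((a₀ ^ 2 * ρ ^ 2 / 4 : ℝ) : ℂ) = 0 := by
  have hW : Tendsto (fun ε => (((a₀ ^ 2 - ε + E ε) * ρ ^ 2 / 4 : ℝ) : ℂ)) (𝓝[<] 0)
      (𝓝 ((a₀ ^ 2 * ρ ^ 2 / 4 : ℝ) : ℂ)) :=
    (Complex.continuous_ofReal.tendsto _).comp (tendsto_scaled_depth hE)
  have hl := hW.mul ((continuous_bj'.tendsto _).comp hW)
  have ht : Tendsto (fun ε => ((decayM (-E ε * ρ ^ 2 / 4) / decayK (-E ε * ρ ^ 2 / 4) : ℝ) : ℂ))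
      (𝓝[<] 0) (𝓝 ((0 : ℝ) : ℂ)) :=
    (Complex.continuous_ofReal.tendsto _).comp
      (tendsto_decay_ratio.comp (tendsto_scaled_energy hρ hE))
  have hr := ht.neg.mul ((continuous_bj.tendsto _).comp hW)
  have h0 := tendsto_nhds_unique (hl.congr' (eventually_bj_relation hρ hε₁ hψ hE)) hr
  simp only [Complex.ofReal_zero, neg_zero, zero_mul] at h0
  refine (mul_eq_zero.1 h0).resolve_left ?_
  have : (0 : ℝ) < a₀ ^ 2 * ρ ^ 2 / 4 := by positivity
  exact_mod_cast this.ne'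

/-- If `t = D + O(D³)` and `y ≤ t³`, then `1 / (D + y)` is `1 / t` up to `O(t)`. -/
lemma abs_inv_sub_inv_le {C t D y : ℝ} (hC : 0 < C) (ht : 0 < t) (hy0 : 0 < y) (hy : y ≤ t ^ 3)
    (hD : |t - D| ≤ C * |D| ^ 3) (hDs : C * |D| ^ 2 ≤ 1 / 2) (hts : (8 * C + 1) * t ^ 2 ≤ 1 / 2) :
    t ≤ 2 * (D + y) ∧ |1 / t - 1 / (D + y)| ≤ 2 * (8 * C + 1) * t := by
  have h1 : |t - D| ≤ |D| / 2 := by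
    calc |t - D| ≤ C * |D| ^ 2 * |D| := hD.trans (le_of_eq (by ring))
      _ ≤ 1 / 2 * |D| := by gcongr
      _ = _ := by ring
  have h2 : |D| ≤ 2 * t := by
    have h3 : |D| ≤ |t| + |t - D| := by
      -- The cubic error is at most half of |D|, so D and t are comparable and the error may be
      -- expressed in t.
      have := abs_sub t (t - D)
      simpa using this
    rw [abs_of_pos ht] at h3
    linarith
  have h3 : |t - D| ≤ 8 * C * t ^ 3 := by
    calc |t - D| ≤ C * |D| ^ 3 := hD
      _ ≤ C * (2 * t) ^ 3 := by gcongr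
      _ = _ := by ring
  have h4 : |D + y - t| ≤ (8 * C + 1) * t ^ 3 := by
    calc |D + y - t| = |(D - t) + y| := by ring_nf
      _ ≤ |D - t| + |y| := abs_add_le _ _
      _ ≤ 8 * C * t ^ 3 + t ^ 3 := by
        rw [abs_sub_comm, abs_of_pos hy0]; gcongr
      _ = _ := by ring
  have h5 : (8 * C + 1) * t ^ 3 ≤ t / 2 := by
    calc (8 * C + 1) * t ^ 3 = (8 * C + 1) * t ^ 2 * t := by ring
      _ ≤ 1 / 2 * t := by gcongr
      _ = _ := by ring
  have h6 := abs_le.1 (h4.trans h5)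
  have h7 : t ≤ 2 * (D + y) := by linarith
  refine ⟨h7, ?_⟩
  have hpos : 0 < D + y := by linarith
  have e : 1 / t - 1 / (D + y) = (D + y - t) / (t * (D + y)) := by
    field_simp
  rw [e, abs_div, abs_of_pos (by positivity : 0 < t * (D + y)), div_le_iff₀ (by positivity)]
  refine h4.trans ?_
  calc (8 * C + 1) * t ^ 3 = (8 * C + 1) * t ^ 2 * t := by ring
    _ ≤ (8 * C + 1) * t ^ 2 * (2 * (D + y)) := by gcongr
    _ = _ := by ring

/-- This is item 3 before exponentiation. An error O(ε) in log(-E) is what gives the relative error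
O(ε) in E, so 1/t must be known up to O(t). -/
lemma eventually_log_energy (hρ : 0 < ρ) (ha₀ : 0 < a₀) (hε₁ : 0 < ε₁)
    (hψ : ∀ ε ∈ Ioo (-ε₁) 0, ∃ ψ : ℂ → ℂ, IsRadial ψ ∧
      IsEigenfunction (circularWell ρ (a₀ ^ 2 - ε)) (E ε) ψ)
    (hE : Tendsto E (𝓝[<] 0) (𝓝[<] 0)) :
    ∃ C : ℝ, 0 < C ∧ ∀ᶠ ε in 𝓝[<] (0 : ℝ),
      |Real.log (-E ε * ρ ^ 2 / 4) + 2 * Real.eulerMascheroniConstant - 4 / (ρ ^ 2 * ε)| ≤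
        C * |ε| := by
  have hj := bj'_threshold hρ ha₀ hε₁ hψ hE
  have hw0 : (((a₀ ^ 2 * ρ ^ 2 / 4 : ℝ) : ℂ)) ≠ 0 := by
    have : (0 : ℝ) < a₀ ^ 2 * ρ ^ 2 / 4 := by positivity
    exact_mod_cast this.ne'
  obtain ⟨C, r, hC, hr, hcub⟩ := logDerivJ_cubic hw0 hj
  refine ⟨(2 + 2 * (8 * C + 1)) * 2 * (ρ ^ 2 / 4), by positivity, ?_⟩
  have hy := tendsto_scaled_energy hρ hE
  have hDlim : Tendsto (fun ε => (a₀ ^ 2 - ε + E ε) * ρ ^ 2 / 4 - a₀ ^ 2 * ρ ^ 2 / 4) (𝓝[<] 0)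
      (𝓝 0) := by
    have h := (tendsto_scaled_depth (ρ := ρ) (a₀ := a₀) hE).sub_const (a₀ ^ 2 * ρ ^ 2 / 4)
    rwa [sub_self] at h
  have hDabs := hDlim.abs
  rw [abs_zero] at hDabs
  have hD2 := (hDabs.pow 2).const_mul C
  have htlim := tendsto_decay_ratio.comp hy
  have ht2 := (htlim.pow 2).const_mul (8 * C + 1)
  rw [zero_pow two_ne_zero, mul_zero] at hD2 ht2
  filter_upwards [eventually_bj_relation hρ hε₁ hψ hE, hy.eventually decay_eventually,
    hy.eventually self_mem_nhdsWithin, hDabs.eventually_lt_const hr,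
    hD2.eventually_le_const (show (0 : ℝ) < 1 / 2 by norm_num),
    ht2.eventually_le_const (show (0 : ℝ) < 1 / 2 by norm_num), self_mem_nhdsWithin]
    with ε hrel hdec hypos hDr hDs hts hε
  have hε0 : ε < 0 := hε
  set y := -E ε * ρ ^ 2 / 4 with hydef
  obtain ⟨hK0, hM, _, _, hy3, hlog, hKM⟩ := hdec
  have hy0 : 0 < y := hypos
  set t := decayM y / decayK y with htdef
  have ht0 : 0 < t := div_pos (by linarith) hK0
  set D := (a₀ ^ 2 - ε + E ε) * ρ ^ 2 / 4 - a₀ ^ 2 * ρ ^ 2 / 4 with hDdef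
  have hnorm : ‖(((a₀ ^ 2 - ε + E ε) * ρ ^ 2 / 4 : ℝ) : ℂ) - ((a₀ ^ 2 * ρ ^ 2 / 4 : ℝ) : ℂ)‖ =
      |D| := by
    rw [← Complex.ofReal_sub, Complex.norm_real, Real.norm_eq_abs]
  obtain ⟨hne, hc3⟩ := hcub _ (hnorm ▸ hDr)
  have hg : logDerivJ (((a₀ ^ 2 - ε + E ε) * ρ ^ 2 / 4 : ℝ) : ℂ) = -(t : ℂ) := by
    rw [logDerivJ, hrel, mul_div_assoc, div_self hne, mul_one]
  rw [hnorm, hg, ← Complex.ofReal_sub, ← Complex.ofReal_neg, ← Complex.ofReal_add,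
    Complex.norm_real, Real.norm_eq_abs] at hc3
  have htD : |t - D| ≤ C * |D| ^ 3 := by
    rw [abs_sub_comm]
    refine le_trans (le_of_eq ?_) hc3
    congr 1
    ring
  obtain ⟨h1, h2⟩ := abs_inv_sub_inv_le hC ht0 hy0 hy3 htD hDs hts
  -- Adding y removes the energy from the interior displacement, leaving an explicit multiple of ε.
  have hη : D + y = -ε * (ρ ^ 2 / 4) := by rw [hDdef, hydef]; ring
  have hinv : 1 / (D + y) = -(4 / (ρ ^ 2 * ε)) := by
    rw [hη]; field_simp
  have htinv : 1 / t = decayK y / decayM y := by rw [htdef, one_div_div]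
  have htε : t ≤ 2 * (ρ ^ 2 / 4) * |ε| := by
    rw [abs_of_neg hε0]
    rw [hη] at h1
    linarith
  have hsum : |Real.log y + 2 * Real.eulerMascheroniConstant - 4 / (ρ ^ 2 * ε)| ≤
      t + t + 2 * (8 * C + 1) * t := by
    -- Three errors: the logarithmic asymptotics of K, the replacement of K by K/M = 1/t, and the
    -- replacement of 1/t by 1/(D + y). Each is O(t), hence O(ε).
    have e : Real.log y + 2 * Real.eulerMascheroniConstant - 4 / (ρ ^ 2 * ε) =
        (decayK y + Real.log y + 2 * Real.eulerMascheroniConstant) -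
          (decayK y - decayK y / decayM y) - (1 / t - 1 / (D + y)) := by
      rw [hinv, htinv]; ring
    rw [e]
    refine (abs_sub _ _).trans ?_
    gcongr
    refine (abs_sub _ _).trans ?_
    gcongr
  refine hsum.trans ?_
  calc t + t + 2 * (8 * C + 1) * t = (2 + 2 * (8 * C + 1)) * t := by ring
    _ ≤ (2 + 2 * (8 * C + 1)) * (2 * (ρ ^ 2 / 4) * |ε|) := by gcongr
    _ = _ := by ring

lemma energy_asymptotics (hρ : 0 < ρ) (ha₀ : 0 < a₀) (hε₁ : 0 < ε₁)
    (hψ : ∀ ε ∈ Ioo (-ε₁) 0, ∃ ψ : ℂ → ℂ, IsRadial ψ ∧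
      IsEigenfunction (circularWell ρ (a₀ ^ 2 - ε)) (E ε) ψ)
    (hE : Tendsto E (𝓝[<] 0) (𝓝[<] 0)) :
    ∃ f : ℝ → ℝ, f =O[𝓝[<] 0] (fun ε : ℝ => ε) ∧ ∀ᶠ ε in 𝓝[<] (0 : ℝ),
      E ε = -(4 / ρ ^ 2) *
        Real.exp (4 / (ρ ^ 2 * ε) - 2 * Real.eulerMascheroniConstant) * (1 + f ε) := by
  obtain ⟨C, hC, hev⟩ := eventually_log_energy hρ ha₀ hε₁ hψ hE
  set x : ℝ → ℝ := fun ε =>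
    Real.log (-E ε * ρ ^ 2 / 4) + 2 * Real.eulerMascheroniConstant - 4 / (ρ ^ 2 * ε) with hx
  refine ⟨fun ε => Real.exp (x ε) - 1, ?_, ?_⟩
  · have hsmall : ∀ᶠ ε in 𝓝[<] (0 : ℝ), C * |ε| < 1 := by
      have : Tendsto (fun ε : ℝ => C * |ε|) (𝓝[<] 0) (𝓝 0) := by
        have h : Tendsto (fun ε : ℝ => C * |ε|) (𝓝 0) (𝓝 (C * |0|)) :=
          Continuous.tendsto (by fun_prop) 0
        rw [abs_zero, mul_zero] at h
        exact h.mono_left nhdsWithin_le_nhds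
      exact this.eventually_lt_const one_pos
    refine Asymptotics.IsBigO.of_bound (2 * C) ?_
    filter_upwards [hev, hsmall] with ε h1 h2
    rw [Real.norm_eq_abs, Real.norm_eq_abs]
    have h3 := Real.abs_exp_sub_one_le (x := x ε) (h1.trans h2.le)
    refine h3.trans ?_
    calc 2 * |x ε| ≤ 2 * (C * |ε|) := by gcongr
      _ = _ := by ring
  · filter_upwards [(tendsto_scaled_energy hρ hE).eventually self_mem_nhdsWithin] with ε hy
    have hy0 : 0 < -E ε * ρ ^ 2 / 4 := hy
    have e : Real.exp (4 / (ρ ^ 2 * ε) - 2 * Real.eulerMascheroniConstant) *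
        (1 + (Real.exp (x ε) - 1)) = -E ε * ρ ^ 2 / 4 := by
      rw [add_sub_cancel, ← Real.exp_add, ← Real.exp_log hy0]
      congr 1
      rw [hx]
      ring
    rw [mul_assoc, e]
    field_simp

end Threshold

/-! ### Absence of resonances on the other side of the threshold -/

lemma bj_bn_bounds : ∃ C : ℝ, 0 < C ∧ ∀ w : ℂ, ‖w‖ ≤ 1 →
    ‖bj w - 1‖ ≤ C * ‖w‖ ∧ ‖bn w‖ ≤ C * ‖w‖ ∧ ‖bj' w‖ ≤ C ∧ ‖bn' w‖ ≤ C := by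
  obtain ⟨A, hA⟩ := (isCompact_closedBall (0 : ℂ) 1).exists_bound_of_continuousOn
    continuous_bj'.continuousOn
  obtain ⟨B, hB⟩ := (isCompact_closedBall (0 : ℂ) 1).exists_bound_of_continuousOn
    continuous_bn'.continuousOn
  refine ⟨max A B + 1, ?_, fun w hw => ?_⟩
  · have := (norm_nonneg _).trans (hA 0 (by simp))
    linarith [le_max_left A B]
  have hmem : w ∈ Metric.closedBall (0 : ℂ) 1 := by simpa using hw
  have h0 : (0 : ℂ) ∈ Metric.closedBall (0 : ℂ) 1 := by simp
  have hA' : ∀ v ∈ Metric.closedBall (0 : ℂ) 1, ‖bj' v‖ ≤ max A B + 1 := fun v hv =>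
    (hA v hv).trans (by linarith [le_max_left A B])
  have hB' : ∀ v ∈ Metric.closedBall (0 : ℂ) 1, ‖bn' v‖ ≤ max A B + 1 := fun v hv =>
    (hB v hv).trans (by linarith [le_max_right A B])
  have k1 := Convex.norm_image_sub_le_of_norm_hasDerivWithin_le
    (fun v _ => (hasDerivAt_bj v).hasDerivWithinAt) hA' (convex_closedBall _ _) h0 hmem
  have k2 := Convex.norm_image_sub_le_of_norm_hasDerivWithin_le
    (fun v _ => (hasDerivAt_bn v).hasDerivWithinAt) hB' (convex_closedBall _ _) h0 hmem
  rw [bj_zero, sub_zero] at k1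
  rw [bn_zero, sub_zero, sub_zero] at k2
  exact ⟨k1, k2, hA' w hmem, hB' w hmem⟩

lemma cutLog_re {z : ℂ} : (cutLog z).re = Real.log ‖z‖ := by
  simp [cutLog, Complex.log_re]

lemma cutLog_im {z : ℂ} :
    (cutLog z).im = Real.pi / 2 - Complex.arg (starRingEnd ℂ (-Complex.I * z)) := by
  rw [cutLog, Complex.add_im, Complex.conj_im, Complex.log_im]
  simp
  ring

lemma outgoing_re {ρ : ℝ} (hρ : 0 < ρ) {lam : ℂ} (hl : lam ≠ 0) :
    ((Real.log (ρ ^ 2) : ℂ) / 2 + outgoingConst lam).re =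
      Real.log (‖lam‖ ^ 2 * ρ ^ 2 / 4) / 2 + Real.eulerMascheroniConstant := by
  have h0 : 0 < ‖lam‖ := norm_pos_iff.2 hl
  have e : ‖lam‖ ^ 2 * ρ ^ 2 / 4 = (‖lam‖ / 2 * ρ) ^ 2 := by ring
  have h1 : ((Real.log (ρ ^ 2) : ℂ) / 2).re = Real.log ρ := by
    rw [Real.log_pow]
    push_cast
    rw [mul_div_cancel_left₀ _ two_ne_zero, Complex.ofReal_re]
  have h2 : (Complex.I * ((Real.pi : ℂ) / 2)).re = 0 := by simp
  rw [Complex.add_re, h1, outgoingConst, Complex.sub_re, h2, Complex.add_re, cutLog_re,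
    Complex.ofReal_re, e, Real.log_pow, Real.log_mul (by positivity) hρ.ne', norm_div]
  simp
  ring

/-- The branch puts arg(λ/2) in [-π/2, 3π/2), and the shift -iπ/2 from the Hankel function centres
this interval at 0. The imaginary part thus stays bounded while the real part diverges. -/
lemma abs_outgoing_im_le (ρ : ℝ) (lam : ℂ) :
    |((Real.log (ρ ^ 2) : ℂ) / 2 + outgoingConst lam).im| ≤ Real.pi := by
  have h1 : ((Real.log (ρ ^ 2) : ℂ) / 2).im = 0 := by
    have : ((Real.log (ρ ^ 2) : ℂ) / 2) = ((Real.log (ρ ^ 2) / 2 : ℝ) : ℂ) := by push_cast; ring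
    rw [this, Complex.ofReal_im]
  have h2 : (Complex.I * ((Real.pi : ℂ) / 2)).im = Real.pi / 2 := by
    have : ((Real.pi : ℂ) / 2) = ((Real.pi / 2 : ℝ) : ℂ) := by push_cast; ring
    rw [this, Complex.mul_im]; simp
  rw [Complex.add_im, h1, outgoingConst, Complex.sub_im, h2, Complex.add_im, cutLog_im,
    Complex.ofReal_im]
  have h3 := Complex.abs_arg_le_pi (starRingEnd ℂ (-Complex.I * (lam / 2)))
  rw [← abs_neg]
  refine le_trans (le_of_eq ?_) h3
  congr 1
  ring

/-- The two sides of the matching condition have different real parts. -/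
lemma matching_contradiction {C C₁ η T x : ℝ} (hC : 0 < C) (hC₁ : 0 < C₁) (hη : 0 < η)
    {L w g J N J' N' : ℂ} (hx : ‖w‖ = x) (hx1 : x ≤ 1) (hLre : L.re = -T) (hLim : |L.im| ≤ T)
    (hT : 1 ≤ T) (hJ : ‖J - 1‖ ≤ C₁ * x) (hN : ‖N‖ ≤ C₁ * x) (hJ' : ‖J'‖ ≤ C₁) (hN' : ‖N'‖ ≤ C₁)
    (hg : ‖g - η + w‖ ≤ C * (η + x) ^ 3) (hx6 : 6 * C₁ * x ≤ 1)
    (hη24 : 24 * C * η ^ 2 ≤ 1) (hTx : (6 * (1 + 4 * C) + 7 * C₁) * (T * x) < 1) :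
    2 * g * (L * J - N) ≠ J + 2 * w * (L * J' - N') := by
  intro heq
  have hx0 : 0 ≤ x := hx ▸ norm_nonneg w
  have hL : ‖L‖ ≤ 2 * T := by
    refine (Complex.norm_le_abs_re_add_abs_im L).trans ?_
    rw [hLre, abs_neg, abs_of_pos (by linarith)]
    linarith
  -- With d = g - η, the condition becomes 2ηL + 2ηe₁ + 2d(L + e₁) = 1 + e₂. The main term has real
  -- part -2ηT. Of this budget one ηT absorbs 2ηe₁ and the other the η³ part of d; the remaining
  -- errors are multiples of Tx, too small to balance the 1.
  set e₁ := L * (J - 1) - N with he₁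
  set e₂ := (J - 1) + 2 * w * (L * J' - N') with he₂
  set d := g - η with hd
  have hC₁x : 0 ≤ C₁ * x := by positivity
  have hTC : C₁ * x ≤ T * (C₁ * x) := le_mul_of_one_le_left hC₁x hT
  have b1 : ‖e₁‖ ≤ 3 * (T * (C₁ * x)) := by
    calc ‖e₁‖ ≤ ‖L‖ * ‖J - 1‖ + ‖N‖ := by rw [← norm_mul]; exact norm_sub_le _ _
      _ ≤ 2 * T * (C₁ * x) + C₁ * x := by gcongr
      _ ≤ _ := by linarith
  have b2 : ‖e₂‖ ≤ 7 * (T * (C₁ * x)) := by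
    calc ‖e₂‖ ≤ ‖J - 1‖ + ‖2 * w * (L * J' - N')‖ := norm_add_le _ _
      _ ≤ ‖J - 1‖ + 2 * x * (‖L‖ * ‖J'‖ + ‖N'‖) := by
        rw [norm_mul, norm_mul, hx, ← norm_mul L]
        gcongr
        · simp
        · exact norm_sub_le _ _
      _ ≤ C₁ * x + 2 * x * (2 * T * C₁ + C₁) := by gcongr
      _ ≤ _ := by linarith
  have b3 : ‖d‖ ≤ x + 4 * C * (η ^ 3 + x ^ 3) := by
    calc ‖d‖ = ‖(g - η + w) - w‖ := by rw [hd]; ring_nf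
      _ ≤ ‖g - η + w‖ + ‖w‖ := norm_sub_le _ _
      _ ≤ C * (η + x) ^ 3 + x := by rw [hx]; gcongr
      _ ≤ C * (4 * (η ^ 3 + x ^ 3)) + x := by
        gcongr
        nlinarith [mul_nonneg (add_nonneg hη.le hx0) (sq_nonneg (η - x))]
      _ = _ := by ring
  have b4 : ‖L + e₁‖ ≤ 3 * T := by
    have : T * (6 * C₁ * x) ≤ T * 1 := by gcongr
    calc ‖L + e₁‖ ≤ ‖L‖ + ‖e₁‖ := norm_add_le _ _
      _ ≤ 3 * T := by linarith
  have b5 : x ^ 3 ≤ x := by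
    calc x ^ 3 ≤ x ^ 1 := pow_le_pow_of_le_one hx0 hx1 (by norm_num)
      _ = x := pow_one x
  have b6 : ‖2 * d * (L + e₁)‖ ≤ η * T + 6 * (1 + 4 * C) * (T * x) := by
    have h1 : 24 * C * η ^ 2 * (η * T) ≤ 1 * (η * T) := by gcongr
    have h2 : 24 * C * T * x ^ 3 ≤ 24 * C * T * x := by gcongr
    calc ‖2 * d * (L + e₁)‖ = 2 * ‖d‖ * ‖L + e₁‖ := by rw [norm_mul, norm_mul]; simp
      _ ≤ 2 * (x + 4 * C * (η ^ 3 + x ^ 3)) * (3 * T) := by gcongr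
      _ ≤ _ := by linarith
  have b7 : ‖2 * (η : ℂ) * e₁‖ ≤ η * T := by
    have h1 : η * T * (6 * C₁ * x) ≤ η * T * 1 := by gcongr
    calc ‖2 * (η : ℂ) * e₁‖ = 2 * η * ‖e₁‖ := by
          rw [norm_mul, norm_mul, Complex.norm_real, Real.norm_of_nonneg hη.le]; simp
      _ ≤ 2 * η * (3 * (T * (C₁ * x))) := by gcongr
      _ ≤ _ := by linarith
  have hre : 2 * η * L.re + (2 * (η : ℂ) * e₁).re + (2 * d * (L + e₁)).re = 1 + e₂.re := by
    have h1 : 2 * (η : ℂ) * L + 2 * (η : ℂ) * e₁ + 2 * d * (L + e₁) = 1 + e₂ := by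
      rw [he₁, he₂, hd]
      linear_combination heq
    have h2 := congrArg Complex.re h1
    have h3 : (2 * (η : ℂ) * L).re = 2 * η * L.re := by
      have : 2 * (η : ℂ) * L = ((2 * η : ℝ) : ℂ) * L := by push_cast; ring
      rw [this, Complex.re_ofReal_mul]
    rwa [Complex.add_re, Complex.add_re, Complex.add_re, h3, Complex.one_re] at h2
  have r1 := (Complex.abs_re_le_norm _).trans b6
  have r2 := (Complex.abs_re_le_norm _).trans b7
  have r3 := (Complex.abs_re_le_norm _).trans b2
  rw [hLre] at hre
  have := (abs_le.1 r1).2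
  have := (abs_le.1 r2).2
  have := (abs_le.1 r3).1
  linarith

lemma eventually_outgoing_small (A B : ℝ) : ∀ᶠ x in 𝓝[>] (0 : ℝ),
    x ≤ 1 ∧ Real.pi ≤ -(Real.log x / 2 + Real.eulerMascheroniConstant) ∧ A * x < 1 ∧
      B * (-(Real.log x / 2 + Real.eulerMascheroniConstant) * x) < 1 := by
  have h1 : Tendsto (fun x : ℝ => x) (𝓝[>] 0) (𝓝 0) := tendsto_id.mono_left nhdsWithin_le_nhds
  have h2 : Tendsto (fun x : ℝ => Real.log x * x) (𝓝[>] 0) (𝓝 0) := by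
    simpa using tendsto_log_mul_rpow_nhdsGT_zero (r := 1) one_pos
  have h3 : Tendsto (fun x : ℝ => A * x) (𝓝[>] 0) (𝓝 0) := by simpa using h1.const_mul A
  have h4 : Tendsto (fun x : ℝ => B * (-(Real.log x / 2 + Real.eulerMascheroniConstant) * x))
      (𝓝[>] 0) (𝓝 0) := by
    have := (((h2.div_const 2).add (h1.const_mul Real.eulerMascheroniConstant)).neg).const_mul B
    simp only [zero_div, mul_zero, add_zero, neg_zero] at this
    refine this.congr fun x => ?_
    ring
  filter_upwards [h1.eventually_lt_const one_pos, tendsto_neg_log.eventually_ge_atTop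
    (2 * (Real.pi + Real.eulerMascheroniConstant)), h3.eventually_lt_const one_pos,
    h4.eventually_lt_const one_pos] with x hx hl hA hB
  exact ⟨hx.le, by linarith, hA, hB⟩

lemma no_resonance {ρ a₀ : ℝ} (hρ : 0 < ρ) (ha₀ : 0 < a₀)
    (hj : bj' ((a₀ ^ 2 * ρ ^ 2 / 4 : ℝ) : ℂ) = 0) :
    ∃ δ₀ > (0 : ℝ), ∃ ε₀ > (0 : ℝ), ∀ ε : ℝ, 0 < ε → ε < ε₀ → ∀ lam : ℂ, ‖lam‖ < δ₀ →
      ¬ ∃ u : ℂ → ℂ, IsRadial u ∧ IsResonantState (circularWell ρ (a₀ ^ 2 - ε)) lam u := by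
  have hw0 : (((a₀ ^ 2 * ρ ^ 2 / 4 : ℝ) : ℂ)) ≠ 0 := by
    have : (0 : ℝ) < a₀ ^ 2 * ρ ^ 2 / 4 := by positivity
    exact_mod_cast this.ne'
  obtain ⟨C, r, hC, hr, hcub⟩ := logDerivJ_cubic hw0 hj
  obtain ⟨C₁, hC₁, hb⟩ := bj_bn_bounds
  -- The coefficient 6C₁ + 2/r yields both 6C₁x ≤ 1 and x < r/2. The threshold X does not depend on
  -- ε, so δ₀ is uniform in ε.
  obtain ⟨X, hX, hXev⟩ := mem_nhdsGT_iff_exists_Ioo_subset.1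
    (eventually_outgoing_small (6 * C₁ + 2 / r) (6 * (1 + 4 * C) + 7 * C₁))
  have hX0 : 0 < X := hX
  set b := ρ ^ 2 / 4 with hbdef
  have hb0 : 0 < b := by positivity
  -- The bound on λ means x = b‖λ‖² < X. The first bound on ε gives η < r/2, so that η + x stays
  -- within the radius r of the cubic estimate; the second gives 24Cη² < 1.
  refine ⟨√(X / b), by positivity, min (r / 2 / b) (1 / (24 * C + 1) / (b + b ^ 2)),
    by positivity, fun ε hε hεlt lam hlam => ?_⟩
  rintro ⟨u, hrad, hres⟩
  obtain ⟨hm0, hm1⟩ := hres.matching hρ hrad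
  set η := ε * b with hη
  have hη0 : 0 < η := by positivity
  have hηr : η < r / 2 := by
    have := hεlt.trans_le (min_le_left _ _)
    rwa [lt_div_iff₀ hb0] at this
  have hη24 : 24 * C * η ^ 2 < 1 := by
    have h1 := hεlt.trans_le (min_le_right _ _)
    rw [lt_div_iff₀ (by positivity), lt_div_iff₀ (by positivity)] at h1
    have h2 : 0 < ε * b ^ 2 * (24 * C + 1) := by positivity
    have h3 : η * (24 * C + 1) < 1 := by
      rw [hη]; linarith
    have h4 : 0 < η * C := by positivity
    have h5 : η < 1 := by linarith
    calc 24 * C * η ^ 2 = 24 * (η * C) * η := by ring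
      _ ≤ 24 * (η * C) * 1 := by gcongr
      _ < 1 := by linarith
  set w := lam ^ 2 * ((ρ ^ 2 : ℝ) : ℂ) / 4 with hw
  set x := ‖lam‖ ^ 2 * ρ ^ 2 / 4 with hx
  have hwx : ‖w‖ = x := by
    rw [hw, norm_div, norm_mul, norm_pow, Complex.norm_real, Real.norm_of_nonneg (by positivity)]
    simp [hx]
  have hW : (((a₀ ^ 2 - ε : ℝ) : ℂ) + lam ^ 2) * ((ρ ^ 2 : ℝ) : ℂ) / 4 -
      ((a₀ ^ 2 * ρ ^ 2 / 4 : ℝ) : ℂ) = -(η : ℂ) + w := by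
    rw [hw, hη, hbdef]; push_cast; ring
  have hηn : ‖-(η : ℂ)‖ = η := by
    rw [norm_neg, Complex.norm_real, Real.norm_of_nonneg hη0.le]
  rcases eq_or_ne lam 0 with hl | hl
  · have hw' : w = 0 := by rw [hw, hl]; simp
    rw [hw', add_zero, hl, zero_pow two_ne_zero, add_zero] at hW
    obtain ⟨hne, hc3⟩ := hcub _ (by rw [hW, hηn]; linarith)
    have h0 := hm0 hl
    rw [regQ_eq hne] at h0
    have hg0 : logDerivJ (((a₀ ^ 2 - ε : ℝ) : ℂ) * ((ρ ^ 2 : ℝ) : ℂ) / 4) = 0 := by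
      exact (mul_eq_zero.1 ((mul_eq_zero.1 h0).resolve_right hne)).resolve_left (by norm_num)
    -- With g = 0 the cubic estimate reads η ≤ Cη³, which contradicts Cη² < 1/24.
    rw [hg0, zero_add, hW, hηn] at hc3
    have h1 : C * η ^ 3 = C * η ^ 2 * η := by ring
    have h2 : C * η ^ 2 * η ≤ 1 / 24 * η := by gcongr; linarith
    linarith
  · have hl0 : 0 < ‖lam‖ := norm_pos_iff.2 hl
    have hx0 : 0 < x := by positivity
    have hxX : x < X := by
      have h1 := (Real.lt_sqrt hl0.le).1 hlam
      rw [lt_div_iff₀ hb0] at h1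
      rw [hx]
      refine lt_of_eq_of_lt ?_ h1
      rw [hbdef]; ring
    obtain ⟨hx1, hxT, hxA, hxB⟩ := hXev ⟨hx0, hxX⟩
    have hxr : x < r / 2 := by
      have h1 : 2 / r * x < 1 := by
        have : 0 < 6 * C₁ * x := by positivity
        linarith
      rw [div_mul_eq_mul_div, div_lt_one hr] at h1
      linarith
    have hx6 : 6 * C₁ * x ≤ 1 := by
      have : 0 < 2 / r * x := by positivity
      linarith
    have hWn : ‖-(η : ℂ) + w‖ ≤ η + x := by
      refine (norm_add_le _ _).trans (le_of_eq ?_)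
      rw [hηn, hwx]
    obtain ⟨hne, hc3⟩ := hcub _ (by rw [hW]; linarith)
    have hm := hm1 hl
    rw [regQ_eq hne, regF_eq] at hm
    set g := logDerivJ ((((a₀ ^ 2 - ε : ℝ) : ℂ) + lam ^ 2) * ((ρ ^ 2 : ℝ) : ℂ) / 4) with hg
    set L := (Real.log (ρ ^ 2) : ℂ) / 2 + outgoingConst lam with hL
    obtain ⟨hb1, hb2, hb3, hb4⟩ := hb w (hwx ▸ hx1)
    rw [hwx] at hb1 hb2
    refine matching_contradiction (T := -(Real.log x / 2 + Real.eulerMascheroniConstant)) (L := L)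
      (g := g) hC hC₁ hη0 hwx hx1 ?_ ?_ ?_ hb1 hb2 hb3 hb4 ?_ hx6 hη24.le hxB ?_
    · rw [hL, outgoing_re hρ hl, neg_neg]
    · exact (abs_outgoing_im_le ρ lam).trans hxT
    · linarith [Real.pi_gt_three]
    · rw [hW] at hc3
      have e : g - η + w = g + (-(η : ℂ) + w) := by ring
      rw [e]
      refine hc3.trans ?_
      gcongr
    · have h1 : 4 * g * logF (lam ^ 2) (outgoingConst lam) (ρ ^ 2) =
          logQ (lam ^ 2) (outgoingConst lam) (ρ ^ 2) := by
        refine mul_right_cancel₀ hne ?_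
        rw [← hm]; ring
      rw [logF, logQ, ← hL, ← hw] at h1
      have h2 : lam ^ 2 * ((ρ ^ 2 : ℝ) : ℂ) = 4 * w := by rw [hw]; ring
      rw [h2] at h1
      linear_combination (1 / 2) * h1

end CircularWell

end

theorem lemmal (ρ a₀ ε₁ : ℝ) (hρ : 0 < ρ) (ha₀ : 0 < a₀) (hε₁ : 0 < ε₁)
    (E : ℝ → ℝ)
    (hψ : ∀ ε ∈ Set.Ioo (-ε₁) 0, ∃ ψ : ℂ → ℂ, CircularWell.IsRadial ψ ∧
      CircularWell.IsEigenfunction (CircularWell.circularWell ρ (a₀ ^ 2 - ε)) (E ε) ψ)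
    -- `E_ε ↑ 0` as `ε ↑ 0`
    (hE : Filter.Tendsto E (nhdsWithin 0 (Set.Iio 0)) (nhdsWithin 0 (Set.Iio 0))) :
    CircularWell.besselJ 1 ((ρ * a₀ : ℝ) : ℂ) = 0 ∧
    (∃ δ₀ > (0 : ℝ), ∃ ε₀ > (0 : ℝ), ∀ ε : ℝ, 0 < ε → ε < ε₀ →
      ∀ lam : ℂ, ‖lam‖ < δ₀ → |Complex.arg lam| ≤ Real.pi / 2 →
        ¬ ∃ u : ℂ → ℂ, CircularWell.IsRadial u ∧
          CircularWell.IsResonantState (CircularWell.circularWell ρ (a₀ ^ 2 - ε)) lam u) ∧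
    (∃ f : ℝ → ℝ, f =O[nhdsWithin 0 (Set.Iio 0)] (fun ε : ℝ => ε) ∧
      ∀ᶠ ε in nhdsWithin (0 : ℝ) (Set.Iio 0),
        E ε = -(4 / ρ ^ 2) *
          Real.exp (4 / (ρ ^ 2 * ε) - 2 * Real.eulerMascheroniConstant) * (1 + f ε)) := by
  have hj := CircularWell.bj'_threshold hρ ha₀ hε₁ hψ hE
  refine ⟨?_, ?_, CircularWell.energy_asymptotics hρ ha₀ hε₁ hψ hE⟩
  · have hz : ((ρ * a₀ : ℝ) : ℂ) ≠ 0 := by exact_mod_cast (mul_pos hρ ha₀).ne'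
    have e : ((ρ * a₀ : ℝ) : ℂ) ^ 2 / 4 = ((a₀ ^ 2 * ρ ^ 2 / 4 : ℝ) : ℂ) := by push_cast; ring
    rw [CircularWell.besselJ_one hz, e, hj, mul_zero]
  · obtain ⟨δ₀, hδ, ε₀, hε, h⟩ := CircularWell.no_resonance hρ ha₀ hj
    exact ⟨δ₀, hδ, ε₀, hε, fun ε h0 h1 lam hlam _ => h ε h0 h1 lam hlam⟩
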